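/- Let $\tilde{\mathbb C}^n$ be the blow-up of $\mathbb C^n$ at the origin, i.e. the tautological line bundle $E=\{([v],z)\in\mathbb{CP}^{n-1}\times\mathbb C^n : z\in[v]\}$ with bundle projection $\pi:E\to\mathbb{CP}^{n-1}$, blow-down map $([v],z)\mapsto z$ and complex structure $J$, and let $E_*=\{([v],z)\in E: z\neq 0\}$. Call a bounded domain $D\subset\mathbb C^n$ *admissible* if it is complete circular ($\zeta z\in D$ for all $z\in D$ and all $\zeta\in\mathbb C$ with $|\zeta|\le 1$) and has a smooth, strongly pseudoconvex boundary. For such a $D$ let $\mu_D(z)=1/t_z$, $t_z=\sup\{s\in\mathbb R: sz\in D\}$ (with $\mu_D(0)=0$), be its Minkowski function, let $\tilde\mu_D([v],z)=\mu_D(z)$ be its lift to $E$, and let $\mathcal H^{D}$ be the distribution on $E_*$ $$\mathcal H^{D}_u=\{w\in T_uE_* : d(\tilde\mu_D)_u(w)=d(\tilde\mu_D)_u(J_uw)=0\}.$$ For the unit ball $B^n$ write $\tilde\mu_o=\tilde\mu_{B^n}$, so that $\tilde\mu_o([v],z)=|z|$, and $\mathcal H_o=\mathcal H^{B^n}$.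 **Lemma 4.5.** Let $D\subset\mathbb C^n$ be admissible. Then there exists a (smooth) diffeomorphism $\phi:\tilde{\mathbb C}^n\to\tilde{\mathbb C}^n$ such that i) $\phi$ maps fibers of $\pi$ to fibers of $\pi$ and is holomorphic on each fiber; ii) $\tilde\mu_o=\tilde\mu_D\circ\phi$; iii) $\phi_*(\mathcal H_o)=\mathcal H^{D}$, i.e. $d\phi_u(\mathcal H_{o,u})=\mathcal H^{D}_{\phi(u)}$ for all $u\in E_*$. Moreover, if $(D_t)_{t\in[0,1]}$ is a family of admissible domains whose Minkowski functions form a smooth family, i.e. $(t,z)\mapsto\mu_{D_t}(z)$ is $C^\infty$ on $[0,1]\times(\mathbb C^n\setminus\{0\})$, then there are diffeomorphisms $\phi^{(t)}:\tilde{\mathbb C}^n\to\tilde{\mathbb C}^n$, $t\in[0,1]$, such that $\phi^{(t)}$ satisfies i)–iii) for $D=D_t$ and $(t,p)\mapsto\phi^{(t)}(p)$ is $C^\infty$ on $[0,1]\times\tilde{\mathbb C}^n$. -/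

import Mathlib

open Set Topology
open scoped Manifold ContDiff LinearAlgebra.Projectivization

noncomputable section

namespace Circular

/-- `ℂⁿ` with its Euclidean norm. -/
abbrev Cn (n : ℕ) : Type := EuclideanSpace ℂ (Fin n)

/-- The complex projective space `ℂP^{n-1}` of lines through the origin of `ℂⁿ`. -/
abbrev CP (n : ℕ) : Type := ℙ ℂ (Cn n)

/-- `ℂP^{n-1}` carries the quotient topology from `ℂⁿ ∖ {0}`. -/
instance instTopologicalSpaceCP (n : ℕ) : TopologicalSpace (CP n) :=
  TopologicalSpace.coinduced (Projectivization.mk' ℂ : {v : Cn n // v ≠ 0} → CP n) inferInstance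

/-! ### The blow-up of `ℂⁿ` at the origin, i.e. the tautological line bundle -/

/-- The blow-up of `ℂⁿ` at the origin: all pairs `([v], z)` in `ℂP^{n-1} × ℂⁿ` with `z ∈ [v]`. -/
def Blowup (n : ℕ) : Type := {p : CP n × Cn n // p.2 ∈ p.1.submodule}

/-- The blow-up carries the topology of a subspace of `ℂP^{n-1} × ℂⁿ`. -/
instance instTopologicalSpaceBlowup (n : ℕ) : TopologicalSpace (Blowup n) :=
  inferInstanceAs (TopologicalSpace {p : CP n × Cn n // p.2 ∈ p.1.submodule})

namespace Blowup

variable {n : ℕ}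

/-- The bundle projection `([v], z) ↦ [v]`, whose fibers are the lines. -/
def line (p : Blowup n) : CP n := p.1.1

/-- The blow-down map `([v], z) ↦ z`. -/
def vec (p : Blowup n) : Cn n := p.1.2

/-- The parametrization `ζ ↦ ([v], ζ v)` of the fiber over `[v]`. -/
def fiberMap (v : Cn n) (hv : v ≠ 0) (ζ : ℂ) : Blowup n :=
  ⟨(Projectivization.mk ℂ v hv, ζ • v), by
    rw [Projectivization.submodule_mk]
    exact Submodule.smul_mem _ _ (Submodule.mem_span_singleton_self v)⟩

/-- The vector `(v¹, …, 1, …, vⁿ)` with a `1` in the `i`-th place. -/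
def affVec (i : Fin n) (w : Fin n → ℂ) : Cn n := WithLp.toLp 2 (Function.update w i 1)

lemma affVec_self (i : Fin n) (w : Fin n → ℂ) : affVec i w i = 1 := by simp [affVec]

lemma affVec_of_ne {i k : Fin n} (h : k ≠ i) (w : Fin n → ℂ) : affVec i w k = w k := by
  simp [affVec, h]

lemma affVec_ne_zero (i : Fin n) (w : Fin n → ℂ) : affVec i w ≠ 0 := by
  intro h
  have := affVec_self i w
  rw [h] at this
  simp at this

lemma continuous_affVec (i : Fin n) : Continuous (affVec i) :=
  (PiLp.continuous_toLp 2 _).comp (continuous_id.update i continuous_const)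

/-- The affine coordinate `v^k / v^i` of `[v]`. -/
def ratio (i k : Fin n) (L : CP n) : ℂ := L.rep k / L.rep i

lemma exists_rep (v : Cn n) (hv : v ≠ 0) :
    ∃ a : ℂ, a ≠ 0 ∧ ∀ k, (Projectivization.mk ℂ v hv).rep k = a * v k := by
  obtain ⟨a, ha⟩ := Projectivization.exists_smul_eq_mk_rep ℂ v hv
  refine ⟨a, a.ne_zero, fun k => ?_⟩
  rw [← ha]
  rfl

lemma ratio_mk (i k : Fin n) (v : Cn n) (hv : v ≠ 0) :
    ratio i k (Projectivization.mk ℂ v hv) = v k / v i := by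
  obtain ⟨a, ha, h⟩ := exists_rep v hv
  rw [ratio, h, h, mul_div_mul_left _ _ ha]

lemma rep_mk_ne_zero_iff (i : Fin n) (v : Cn n) (hv : v ≠ 0) :
    (Projectivization.mk ℂ v hv).rep i ≠ 0 ↔ v i ≠ 0 := by
  obtain ⟨a, ha, h⟩ := exists_rep v hv
  rw [h]
  simp [ha]

lemma isQuotientMap_mk' :
    IsQuotientMap (Projectivization.mk' ℂ : {v : Cn n // v ≠ 0} → CP n) :=
  ⟨⟨rfl⟩, fun L => ⟨⟨L.rep, L.rep_nonzero⟩, L.mk_rep⟩⟩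

lemma isOpen_affine (i : Fin n) : IsOpen {L : CP n | L.rep i ≠ 0} := by
  rw [← isQuotientMap_mk'.isOpen_preimage]
  have : (Projectivization.mk' ℂ : {v : Cn n // v ≠ 0} → CP n) ⁻¹' {L : CP n | L.rep i ≠ 0}
      = {v : {v : Cn n // v ≠ 0} | (v : Cn n) i ≠ 0} := by
    ext v
    exact rep_mk_ne_zero_iff i v.1 v.2
  rw [this]
  exact isOpen_ne_fun (by fun_prop) continuous_const

lemma continuousOn_ratio (i k : Fin n) : ContinuousOn (ratio i k) {L : CP n | L.rep i ≠ 0} := by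
  rw [isQuotientMap_mk'.continuousOn_isOpen_iff (isOpen_affine i)]
  have : (ratio i k ∘ (Projectivization.mk' ℂ : {v : Cn n // v ≠ 0} → CP n))
      = fun v : {v : Cn n // v ≠ 0} => (v : Cn n) k / (v : Cn n) i := by
    ext v
    exact ratio_mk i k v.1 v.2
  rw [this]
  refine ContinuousOn.div (by fun_prop) (by fun_prop) fun v hv => ?_
  exact (rep_mk_ne_zero_iff i v.1 v.2).1 hv

/-- The coordinates `(v, ζ)` of the blow-up over the affine open set `{[v] | vⁱ ≠ 0}`: the slots
`k ≠ i` hold the affine coordinates `v^k / v^i` of `[v]`, and the slot `i` holds the number `ζ` such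
that `z = ζ · (v¹, …, 1, …, vⁿ)`, which is the `i`-th coordinate of `z`. -/
def chart (i : Fin n) : OpenPartialHomeomorph (Blowup n) (Fin n → ℂ) where
  toFun p := Function.update (fun k => ratio i k p.line) i (p.vec i)
  invFun w := fiberMap (affVec i w) (affVec_ne_zero i w) (w i)
  source := {p | p.line.rep i ≠ 0}
  target := univ
  map_source' _ _ := mem_univ _
  map_target' w _ := by
    change (Projectivization.mk ℂ (affVec i w) (affVec_ne_zero i w)).rep i ≠ 0
    rw [rep_mk_ne_zero_iff, affVec_self]
    exact one_ne_zero
  left_inv' := by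
    rintro ⟨⟨L, z⟩, hz⟩ hL
    change L.rep i ≠ 0 at hL
    have key : L.rep = L.rep i •
        affVec i (Function.update (fun k => ratio i k L) i (z i)) := by
      ext k
      by_cases hk : k = i
      · subst hk
        simp [affVec_self]
      · simp only [PiLp.smul_apply, affVec_of_ne hk, Function.update_of_ne hk, ratio, smul_eq_mul]
        field_simp
    refine Subtype.ext (Prod.ext ?_ ?_)
    · change Projectivization.mk ℂ _ (affVec_ne_zero _ _) = L
      conv_rhs => rw [← L.mk_rep]
      rw [Projectivization.mk_eq_mk_iff']
      exact ⟨(L.rep i)⁻¹, (inv_smul_eq_iff₀ hL).2 key⟩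
    · change (Function.update (fun k => ratio i k L) i (z i)) i •
        affVec i (Function.update (fun k => ratio i k L) i (z i)) = z
      change z ∈ L.submodule at hz
      rw [Projectivization.submodule_eq, Submodule.mem_span_singleton] at hz
      obtain ⟨c, rfl⟩ := hz
      conv_rhs => rw [key]
      rw [Function.update_self, smul_smul]
      rfl
  right_inv' := by
    intro w _
    ext k
    by_cases hk : k = i
    · subst hk
      change Function.update (fun j => ratio k j _) k ((w k • affVec k w) k) k = w k
      simp [affVec_self]
    · change Function.update (fun j => ratio i j
        (Projectivization.mk ℂ (affVec i w) (affVec_ne_zero i w))) i _ k = w k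
      rw [Function.update_of_ne hk, ratio_mk, affVec_self, affVec_of_ne hk, div_one]
  open_source := (isOpen_affine i).preimage (continuous_fst.comp continuous_subtype_val)
  open_target := isOpen_univ
  continuousOn_toFun := by
    rw [continuousOn_pi]
    intro k
    by_cases hk : k = i
    · subst hk
      simp only [Function.update_self]
      have : Continuous fun p : Blowup n => p.vec :=
        continuous_snd.comp continuous_subtype_val
      exact ((PiLp.continuous_apply 2 _ k).comp this).continuousOn
    · simp only [Function.update_of_ne hk]
      have : Continuous fun p : Blowup n => p.line :=
        continuous_fst.comp continuous_subtype_val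
      exact (continuousOn_ratio i k).comp this.continuousOn fun p hp => hp
  continuousOn_invFun := by
    refine Continuous.continuousOn ?_
    refine Continuous.subtype_mk (Continuous.prodMk ?_ ?_) _
    · exact isQuotientMap_mk'.continuous.comp
        ((continuous_affVec i).subtype_mk (affVec_ne_zero i))
    · exact (continuous_apply i).smul (continuous_affVec i)

lemma exists_rep_ne_zero (L : CP n) : ∃ i, L.rep i ≠ 0 := by
  by_contra! h
  exact L.rep_nonzero (by ext i; simpa using h i)

/-- The blow-up as a manifold of complex dimension `n`, with the charts `chart i`. -/
instance instChartedSpace : ChartedSpace (Fin n → ℂ) (Blowup n) where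
  atlas := range chart
  chartAt p := chart (exists_rep_ne_zero p.line).choose
  mem_chart_source p := (exists_rep_ne_zero p.line).choose_spec
  chart_mem_atlas _ := mem_range_self _

lemma chart_transition (i k : Fin n) :
    ContDiffOn ℂ ω (chart k ∘ (chart i).symm) ((chart i).symm ≫ₕ chart k).source := by
  have hsrc : ∀ w ∈ ((chart i).symm ≫ₕ chart k).source, affVec i w k ≠ 0 := by
    intro w hw
    have h2 : (Projectivization.mk ℂ (affVec i w) (affVec_ne_zero i w)).rep k ≠ 0 := hw.2
    rwa [rep_mk_ne_zero_iff] at h2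
  have hlin : ∀ j, ContDiff ℂ ω fun w : Fin n → ℂ => affVec i w j := by
    intro j
    by_cases hj : j = i
    · subst hj
      simp only [affVec_self]
      exact contDiff_const
    · simp only [affVec_of_ne hj]
      exact contDiff_apply ℂ ℂ j
  rw [contDiffOn_pi]
  intro j
  by_cases hj : j = k
  · subst hj
    have : (fun w => (chart j ∘ (chart i).symm) w j) = fun w => w i * affVec i w j := by
      ext w
      change Function.update (fun l => ratio j l _) j ((w i • affVec i w) j) j = _
      simp
    rw [this]
    exact ((contDiff_apply ℂ ℂ i).mul (hlin j)).contDiffOn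
  · have : (fun w => (chart k ∘ (chart i).symm) w j) = fun w => affVec i w j / affVec i w k := by
      ext w
      change Function.update (fun l => ratio k l
        (Projectivization.mk ℂ (affVec i w) (affVec_ne_zero i w))) k _ j = _
      rw [Function.update_of_ne hj, ratio_mk]
    rw [this]
    exact (hlin j).contDiffOn.div (hlin k).contDiffOn hsrc

/-- The blow-up is a complex manifold. -/
instance instIsManifoldComplex : IsManifold 𝓘(ℂ, Fin n → ℂ) ω (Blowup n) := by
  refine isManifold_of_contDiffOn _ _ _ ?_
  rintro _ _ ⟨i, rfl⟩ ⟨k, rfl⟩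
  simpa using chart_transition i k

/-- The blow-up is a real smooth manifold. -/
instance instIsManifoldReal : IsManifold 𝓘(ℝ, Fin n → ℂ) ∞ (Blowup n) := by
  refine isManifold_of_contDiffOn _ _ _ ?_
  rintro _ _ ⟨i, rfl⟩ ⟨k, rfl⟩
  have := ((chart_transition i k).restrict_scalars ℝ).of_le (le_top : (∞ : ℕ∞ω) ≤ ω)
  simpa using this

end Blowup

/-! ### The distribution defined by a function on the blow-up -/

/-- The real tangent space of the blow-up at `u`. -/
abbrev RTangent {n : ℕ} (u : Blowup n) : Type := TangentSpace 𝓘(ℝ, Fin n → ℂ) u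

/-- The complex structure `J_u` on the real tangent space of the blow-up: multiplication by the
imaginary unit in the preferred holomorphic chart at `u`. -/
def complexStructure {n : ℕ} (u : Blowup n) : RTangent u →ₗ[ℝ] RTangent u where
  toFun := fun v : Fin n → ℂ => Complex.I • v
  map_add' := fun v w : Fin n → ℂ => smul_add Complex.I v w
  map_smul' := fun (r : ℝ) (v : Fin n → ℂ) => smul_comm Complex.I r v

/-- The differential at `u` of a real function on the blow-up. -/
def realDifferential {n : ℕ} (f : Blowup n → ℝ) (u : Blowup n) : RTangent u →ₗ[ℝ] ℝ :=
  (mfderiv 𝓘(ℝ, Fin n → ℂ) 𝓘(ℝ, ℝ) f u).toLinearMap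

/-- `H_u = {v ∈ T_u | d f_u (v) = d f_u (J_u v) = 0}`. -/
def horizontal {n : ℕ} (f : Blowup n → ℝ) (u : Blowup n) : Submodule ℝ (RTangent u) :=
  LinearMap.ker (realDifferential f u) ⊓
    LinearMap.ker (realDifferential f u ∘ₗ complexStructure u)

/-! ### Circular domains -/

/-- The Levi form of `ρ` at `p` on the vector `w`, i.e. `∑ ∂²ρ/∂z_j∂z̄_k (p) w_j w̄_k`. -/
def leviForm {n : ℕ} (ρ : Cn n → ℝ) (p w : Cn n) : ℝ :=
  (fderiv ℝ (fderiv ℝ ρ) p w w +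
    fderiv ℝ (fderiv ℝ ρ) p (Complex.I • w) (Complex.I • w)) / 4

/-- Near each boundary point `p`, `D` is `{ρ < 0}` for a smooth `ρ` with `dρ_p ≠ 0` whose Levi form
is positive definite on the complex tangent space `{w | dρ_p (w) = dρ_p (i w) = 0}`; i.e. `D` has
smooth strongly pseudoconvex boundary. -/
def HasStronglyPseudoconvexBoundary {n : ℕ} (D : Set (Cn n)) : Prop :=
  ∀ p ∈ frontier D, ∃ (U : Set (Cn n)) (ρ : Cn n → ℝ), IsOpen U ∧ p ∈ U ∧
    ContDiffOn ℝ ∞ ρ U ∧ D ∩ U = {z ∈ U | ρ z < 0} ∧ fderiv ℝ ρ p ≠ 0 ∧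
    ∀ w : Cn n, w ≠ 0 → fderiv ℝ ρ p w = 0 → fderiv ℝ ρ p (Complex.I • w) = 0 →
      0 < leviForm ρ p w

/-- Smoothly bounded, strongly pseudoconvex, complete circular domains in `ℂⁿ`
(`Balanced` says that `ζ z ∈ D` for all `z ∈ D` and all `ζ` in the closed unit disc). -/
structure IsCircularDomain {n : ℕ} (D : Set (Cn n)) : Prop where
  isOpen : IsOpen D
  isConnected : IsConnected D
  isBounded : Bornology.IsBounded D
  balanced : Balanced ℂ D
  boundary : HasStronglyPseudoconvexBoundary D

/-- The Minkowski function `μ_D (z) = 1 / t_z`, `t_z = sup {s ∈ ℝ | s z ∈ D}`. (For bounded `D`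
containing the origin the supremum is finite unless `z = 0`; at `z = 0`, where `t_z = ∞`, the
conventions for `sSup` and division give the intended value `0`.) -/
def minkowski {n : ℕ} (D : Set (Cn n)) (z : Cn n) : ℝ := 1 / sSup {s : ℝ | (s : ℂ) • z ∈ D}

/-- The lift to the blow-up of the Minkowski function of `D`. -/
def minkowskiLift {n : ℕ} (D : Set (Cn n)) (p : Blowup n) : ℝ := minkowski D p.vec

/-- The unit ball `Bⁿ`. -/
def unitBall (n : ℕ) : Set (Cn n) := Metric.ball 0 1

/-- The properties i), ii), iii) of a diffeomorphism `φ` of the blow-up, relative to the circular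
domain `D`. -/
structure IsNormalizing {n : ℕ} (D : Set (Cn n))
    (φ : Blowup n ≃ₘ⟮𝓘(ℝ, Fin n → ℂ), 𝓘(ℝ, Fin n → ℂ)⟯ Blowup n) : Prop where
  /-- `φ` maps fibers of the bundle to fibers. -/
  fiber_preserving : ∃ ψ : CP n → CP n, ∀ p, (φ p).line = ψ p.line
  /-- `φ` is holomorphic on each fiber. -/
  holomorphic_on_fibers : ∀ (v : Cn n) (hv : v ≠ 0),
    MDifferentiable 𝓘(ℂ, ℂ) 𝓘(ℂ, Fin n → ℂ) fun ζ : ℂ => φ (Blowup.fiberMap v hv ζ)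
  /-- `φ` pulls the Minkowski function of `D` back to that of the unit ball. -/
  pullback_minkowski : ∀ p, minkowskiLift (unitBall n) p = minkowskiLift D (φ p)
  /-- Off the zero section, the differential of `φ` maps the distribution of the unit ball onto
  the distribution of `D`. -/
  map_horizontal : ∀ u : Blowup n, u.vec ≠ 0 →
    (horizontal (minkowskiLift (unitBall n)) u).map
      (mfderiv 𝓘(ℝ, Fin n → ℂ) 𝓘(ℝ, Fin n → ℂ) φ u).toLinearMap
    = horizontal (minkowskiLift D) (φ u)

end Circular

end

/-! The proof is Moser's deformation argument on ℂⁿ∖{0}. Put f₀ = |z|², f₁ = μ_D² and f_s = (1-s) f₀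
+ s f₁. It suffices to find a bijection Φ of ℂⁿ, smooth with smooth inverse off the origin,
commuting with complex scalars, such that f₁ ∘ Φ = f₀ and df₁(i dΦ v) = df₀(i v). Such a Φ maps
lines to lines and is complex linear on each, so it lifts to the blow-up. The two identities give
the pullback of the Minkowski functions and, after division by 2μ, of their differentials and
twisted differentials, hence the matching of the distributions (`isNormalizing_liftDiffeomorph`).

Every f_s satisfies f(ζz) = |ζ|² f(z). Its Levi form L_s is positive definite: for μ_D² the complex
tangent directions of the level sets are handled by strong pseudoconvexity
(`polarLevi_minkowski_pos`), the complex line through z by Euler's identity, and the two are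
Levi-orthogonal (`IsCircularQuadratic.polarLevi_pos`); positivity survives interpolation. Hence
L_s(Y_s, ·) = -d(∂_s f_s) has a unique solution, the homogeneous field `moserField`. Pairing with z
and with iz yields df_s(Y_s) = -∂_s f_s and df_s(iY_s) = 0. The first makes f_s constant along the
flow. The derivative of the second, combined with the defining equation, makes df_s(i ·) invariant
too (`fderiv_I_smul_eq`). Φ is the flow at time one, and its inverse is the flow of the
time-reversed field.

Three analytic points remain. Smoothness of μ_D comes from the implicit function theorem, since the
boundary is transversal to the rays (`defining_radial_pos`). The field need not be differentiable at
0 but is globally Lipschitz by homogeneity, so its flow lives on all of [0, 1] and never reaches 0;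
in charts the lift evaluates Φ only at nonzero vectors and is therefore smooth across the zero
section (`contMDiffOn_of_fiberMap`). Finally, the parameter of the family runs over a closed
interval, so smooth dependence of solutions is proved for convex, not necessarily open, parameter
sets (`contDiffOn_solution`). -/

noncomputable section

/-! ### Ordinary differential equations on the unit interval with parameters -/

namespace ParametricODE

open Filter
open scoped NNReal

variable {E : Type*} [NormedAddCommGroup E] [NormedSpace ℝ E]

lemma isIntegralCurveOn_glue {X : ℝ → E → E} {a b c : ℝ} {α β : ℝ → E} (hab : a ≤ b) (hbc : b ≤ c)
    (hα : IsIntegralCurveOn α X (Icc a b)) (hβ : IsIntegralCurveOn β X (Icc b c))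
    (h : α b = β b) :
    IsIntegralCurveOn (fun t => if t ≤ b then α t else β t) X (Icc a c) := by
  intro t ht
  rw [← Icc_union_Icc_eq_Icc hab hbc]
  refine HasDerivWithinAt.union ?_ ?_
  · by_cases htb : t ∈ Icc a b
    · have := hα t htb
      simp only [htb.2, if_true]
      exact this.congr (fun s hs => by simp [hs.2]) (by simp [htb.2])
    -- Outside the closed piece, differentiability within that piece is vacuous.
    · exact HasFDerivWithinAt.of_notMem_closure (by rwa [isClosed_Icc.closure_eq])
  · by_cases htb : t ∈ Icc b c
    · have key : ∀ s ∈ Icc b c, (if s ≤ b then α s else β s) = β s := by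
        intro s hs
        split_ifs with hsb
        · rw [le_antisymm hsb hs.1, h]
        · rfl
      have := hβ t htb
      simp only [key t htb]
      exact this.congr key (key t htb)
    · exact HasFDerivWithinAt.of_notMem_closure (by rwa [isClosed_Icc.closure_eq])

/-- Picard–Lindelöf on the ball of radius R around x₀, where R bounds ‖X t x₀‖: on it ‖X‖ ≤ R + KR,
and `hle` makes (R + KR)(b - a) ≤ R. The admissible length 1 / (1 + K) does not depend on x₀, which
is what allows iteration. -/
lemma exists_isIntegralCurveOn_Icc_of_mul_le [CompleteSpace E] {X : ℝ → E → E} {K : ℝ≥0} {a b : ℝ}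
    (hab : a ≤ b) (hK : ∀ t ∈ Icc a b, LipschitzWith K (X t))
    (hc : ∀ x, ContinuousOn (X · x) (Icc a b)) (hle : (1 + K) * (b - a) ≤ 1) (x₀ : E) :
    ∃ α : ℝ → E, α a = x₀ ∧ IsIntegralCurveOn α X (Icc a b) := by
  obtain ⟨M, hM⟩ := isCompact_Icc.exists_bound_of_continuousOn (hc x₀)
  set R : ℝ≥0 := Real.toNNReal M with hR
  have hMR : ∀ t ∈ Icc a b, ‖X t x₀‖ ≤ R := fun t ht =>
    (hM t ht).trans (Real.le_coe_toNNReal M)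
  have hP : IsPicardLindelof X (⟨a, left_mem_Icc.2 hab⟩ : Icc a b) x₀ R 0 (R + K * R) K :=
    { lipschitzOnWith := fun t ht => (hK t ht).lipschitzOnWith
      continuousOn := fun x _ => hc x
      norm_le := fun t ht x hx => by
        have h1 := (hK t ht).dist_le_mul x x₀
        have h2 : dist x x₀ ≤ R := hx
        rw [dist_eq_norm] at h1
        calc ‖X t x‖ = ‖X t x₀ + (X t x - X t x₀)‖ := by rw [add_sub_cancel]
          _ ≤ ‖X t x₀‖ + ‖X t x - X t x₀‖ := norm_add_le _ _
          _ ≤ R + K * R := add_le_add (hMR t ht) (h1.trans (by gcongr))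
          _ = _ := by simp
      mul_max_le := by
        simp only [sub_self, NNReal.coe_zero, sub_zero, NNReal.coe_add, NNReal.coe_mul]
        rw [max_eq_left (sub_nonneg.2 hab)]
        have := mul_le_mul_of_nonneg_left hle R.2
        calc ((R : ℝ) + K * R) * (b - a) = R * ((1 + K) * (b - a)) := by ring
          _ ≤ R := by simpa using this }
  obtain ⟨α, h0, hα⟩ := hP.exists_eq_forall_mem_Icc_hasDerivWithinAt₀
  exact ⟨α, h0, hα⟩

/-- A time-dependent vector field which is continuous in time and globally Lipschitz in space has
integral curves defined for all times in `[0, 1]`. -/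
theorem exists_isIntegralCurveOn_Icc [CompleteSpace E] {X : ℝ → E → E} {K : ℝ≥0}
    (hK : ∀ t ∈ Icc (0 : ℝ) 1, LipschitzWith K (X t))
    (hc : ∀ x, ContinuousOn (X · x) (Icc 0 1)) (x₀ : E) :
    ∃ α : ℝ → E, α 0 = x₀ ∧ IsIntegralCurveOn α X (Icc 0 1) := by
  set h : ℝ := (1 + K)⁻¹ with hh
  have hKpos : (0 : ℝ) < 1 + K := by positivity
  have hpos : 0 < h := inv_pos.2 hKpos
  -- March in steps of length h, truncating at time 1; about 1 + K steps suffice.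
  have main : ∀ N : ℕ, ∃ α : ℝ → E, α 0 = x₀ ∧ IsIntegralCurveOn α X (Icc 0 (min 1 (N * h))) := by
    intro N
    induction N with
    | zero =>
      refine ⟨fun _ => x₀, rfl, fun t ht => ?_⟩
      have : Icc (0 : ℝ) (min 1 ((0 : ℕ) * h)) = {0} := by simp
      rw [this] at ht ⊢
      rw [mem_singleton_iff.1 ht]
      exact HasFDerivWithinAt.singleton
    | succ N ih =>
      obtain ⟨α, h0, hα⟩ := ih
      set b := min 1 (N * h) with hb
      set c := min 1 ((N + 1 : ℕ) * h) with hc'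
      have hb0 : 0 ≤ b := le_min zero_le_one (by positivity)
      have hbc : b ≤ c := min_le_min_left _ (by push_cast; nlinarith)
      have hc1 : c ≤ 1 := min_le_left _ _
      have hcb : c - b ≤ h := by
        rw [hc', hb]
        push_cast
        rcases le_total 1 (N * h) with h1 | h1
        · rw [min_eq_left h1, min_eq_left (by linarith)]; linarith
        · rw [min_eq_right h1]
          linarith [min_le_right (1 : ℝ) ((N + 1) * h)]
      have hsub : Icc b c ⊆ Icc 0 1 := Icc_subset_Icc hb0 hc1
      obtain ⟨β, hβ0, hβ⟩ := exists_isIntegralCurveOn_Icc_of_mul_le hbc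
        (fun t ht => hK t (hsub ht)) (fun x => (hc x).mono hsub) (by
          calc (1 + K) * (c - b) ≤ (1 + K) * h := by gcongr
            _ = 1 := mul_inv_cancel₀ hKpos.ne') (α b)
      refine ⟨_, ?_, isIntegralCurveOn_glue hb0 hbc hα hβ hβ0.symm⟩
      simp [hb0, h0]
  obtain ⟨N, hN⟩ := exists_nat_ge (1 + K : ℝ)
  obtain ⟨α, h0, hα⟩ := main N
  rw [min_eq_left] at hα
  · exact ⟨α, h0, hα⟩
  · rw [hh, ← div_eq_mul_inv, le_div_iff₀ hKpos]
    linarith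

lemma hasDerivWithinAt_Ici_of_Icc {f : ℝ → E} {f' : E} {a b t : ℝ} (ht : t ∈ Ico a b)
    (h : HasDerivWithinAt f f' (Icc a b) t) : HasDerivWithinAt f f' (Ici t) t :=
  h.mono_of_mem_nhdsWithin (mem_of_superset (Icc_mem_nhdsGE ht.2) (Icc_subset_Icc_left ht.1))

lemma hasDerivWithinAt_Iic_of_Icc {f : ℝ → E} {f' : E} {a b t : ℝ} (ht : t ∈ Ioc a b)
    (h : HasDerivWithinAt f f' (Icc a b) t) : HasDerivWithinAt f f' (Iic t) t :=
  h.mono_of_mem_nhdsWithin (mem_of_superset (Icc_mem_nhdsLE ht.1) (Icc_subset_Icc_right ht.2))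

/-- Gronwall uniqueness both forwards and backwards from t₀. The backward half is what prevents a
nonzero solution from reaching a zero of the field. -/
lemma isIntegralCurveOn_unique {X : ℝ → E → E} {K : ℝ≥0} {a b : ℝ}
    (hK : ∀ t ∈ Icc a b, LipschitzWith K (X t)) {α β : ℝ → E}
    (hα : IsIntegralCurveOn α X (Icc a b)) (hβ : IsIntegralCurveOn β X (Icc a b))
    {t₀ : ℝ} (ht₀ : t₀ ∈ Icc a b) (h : α t₀ = β t₀) : EqOn α β (Icc a b) := by
  rw [← Icc_union_Icc_eq_Icc ht₀.1 ht₀.2]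
  have h1 : Icc a t₀ ⊆ Icc a b := Icc_subset_Icc_right ht₀.2
  have h2 : Icc t₀ b ⊆ Icc a b := Icc_subset_Icc_left ht₀.1
  refine EqOn.union ?_ ?_
  · refine ODE_solution_unique_of_mem_Icc_left (v := X) (s := fun _ => univ) (K := K)
      (fun t ht => (hK t (h1 (Ioc_subset_Icc_self ht))).lipschitzOnWith)
      (hα.continuousOn.mono h1) (fun t ht => ?_) (fun _ _ => mem_univ _)
      (hβ.continuousOn.mono h1) (fun t ht => ?_) (fun _ _ => mem_univ _) h
    · exact hasDerivWithinAt_Iic_of_Icc ⟨ht.1, ht.2.trans ht₀.2⟩ (hα t (h1 (Ioc_subset_Icc_self ht)))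
    · exact hasDerivWithinAt_Iic_of_Icc ⟨ht.1, ht.2.trans ht₀.2⟩ (hβ t (h1 (Ioc_subset_Icc_self ht)))
  · refine ODE_solution_unique_of_mem_Icc_right (v := X) (s := fun _ => univ) (K := K)
      (fun t ht => (hK t (h2 (Ico_subset_Icc_self ht))).lipschitzOnWith)
      (hα.continuousOn.mono h2) (fun t ht => ?_) (fun _ _ => mem_univ _)
      (hβ.continuousOn.mono h2) (fun t ht => ?_) (fun _ _ => mem_univ _) h
    · exact hasDerivWithinAt_Ici_of_Icc ⟨ht₀.1.trans ht.1, ht.2⟩ (hα t (h2 (Ico_subset_Icc_self ht)))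
    · exact hasDerivWithinAt_Ici_of_Icc ⟨ht₀.1.trans ht.1, ht.2⟩ (hβ t (h2 (Ico_subset_Icc_self ht)))

/-- The tube lemma relative to K × S: compactness turns local estimates near each (t, p₀) into one
neighbourhood of p₀ valid for all t. -/
lemma eventually_forall_of_forall_eventually_prod {Y Z : Type*} [TopologicalSpace Y]
    [TopologicalSpace Z] {K : Set Y} {S : Set Z} {p₀ : Z} (hK : IsCompact K) {Q : Y → Z → Prop}
    (h : ∀ t ∈ K, ∀ᶠ z in 𝓝[K ×ˢ S] (t, p₀), Q z.1 z.2) :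
    ∀ᶠ p in 𝓝[S] p₀, ∀ t ∈ K, Q t p := by
  have := hK.eventually_forall_of_forall_eventually (x₀ := p₀)
    (P := fun p t => p ∈ S → t ∈ K → Q t p) (fun t ht => by
      have h1 := eventually_nhdsWithin_iff.1 (h t ht)
      have h2 : Tendsto (Prod.swap : Z × Y → Y × Z) (𝓝 (p₀, t)) (𝓝 (t, p₀)) :=
        continuous_swap.continuousAt
      exact (h2.eventually h1).mono fun z hz h3 h4 => hz ⟨h4, h3⟩)
  rw [eventually_nhdsWithin_iff]
  exact this.mono fun p hp hpS t ht => hp t ht hpS ht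

/-- Continuous dependence on parameters. -/
theorem continuousOn_of_lipschitz {P : Type*} [TopologicalSpace P] {X : ℝ → P → E → E} {S : Set P}
    (hX : ContinuousOn (fun q : ℝ × P × E => X q.1 q.2.1 q.2.2) (Icc (0 : ℝ) 1 ×ˢ S ×ˢ univ))
    (hK : ∀ p₀ ∈ S, ∃ K : ℝ≥0, ∀ᶠ p in 𝓝[S] p₀, ∀ t ∈ Icc (0 : ℝ) 1, LipschitzWith K (X t p))
    {φ : ℝ → P → E}
    (hφ : ∀ p ∈ S, IsIntegralCurveOn (fun t => φ t p) (fun t => X t p) (Icc 0 1))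
    (h0 : ContinuousOn (φ 0) S) :
    ContinuousOn (fun q : ℝ × P => φ q.1 q.2) (Icc (0 : ℝ) 1 ×ˢ S) := by
  rintro ⟨t₀, p₀⟩ ⟨ht₀, hp₀⟩
  change t₀ ∈ Icc (0 : ℝ) 1 at ht₀
  change p₀ ∈ S at hp₀
  obtain ⟨K, hK⟩ := hK p₀ hp₀
  have hφ₀ : ContinuousOn (fun t => φ t p₀) (Icc 0 1) := (hφ p₀ hp₀).continuousOn
  have hcont : ∀ t ∈ Icc (0 : ℝ) 1, Tendsto (fun z : ℝ × P => X z.1 z.2 (φ z.1 p₀))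
      (𝓝[Icc (0 : ℝ) 1 ×ˢ S] (t, p₀)) (𝓝 (X t p₀ (φ t p₀))) := by
    intro t ht
    have : ContinuousOn (fun z : ℝ × P => X z.1 z.2 (φ z.1 p₀)) (Icc (0 : ℝ) 1 ×ˢ S) := by
      refine hX.comp (f := fun z : ℝ × P => (z.1, z.2, φ z.1 p₀)) ?_ ?_
      · exact continuousOn_fst.prodMk (continuousOn_snd.prodMk
          (hφ₀.comp continuousOn_fst fun z hz => hz.1))
      · exact fun z hz => ⟨hz.1, hz.2, mem_univ _⟩
    exact this (t, p₀) ⟨ht, hp₀⟩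
  rw [ContinuousWithinAt, Metric.tendsto_nhds]
  intro ε hε
  -- η will bound both the initial error and the defect; the Gronwall bound at time 1 is continuous
  -- in η and vanishes at η = 0.
  obtain ⟨η, hη, hηε⟩ : ∃ η > 0, gronwallBound η K η 1 < ε / 2 := by
    have h1 : Continuous fun η : ℝ => gronwallBound η K η 1 := by
      by_cases hK0 : (K : ℝ) = 0
      · simp only [hK0, gronwallBound_K0]; fun_prop
      · simp only [gronwallBound_of_K_ne_0 hK0]; fun_prop
    have h2 : gronwallBound 0 K 0 1 = 0 := by rw [gronwallBound_ε0]; simp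
    have h3 : ∀ᶠ η in 𝓝 (0 : ℝ), gronwallBound η K η 1 < ε / 2 :=
      h1.continuousAt.eventually (gt_mem_nhds (by simp only [h2]; positivity))
    obtain ⟨δ, hδ, h4⟩ := Metric.eventually_nhds_iff.1 h3
    exact ⟨δ / 2, by positivity, h4 (by rw [Real.dist_eq, sub_zero, abs_of_pos] <;> linarith)⟩
  -- The solution at p₀ is an approximate solution of the equation at p, with defect below η
  -- uniformly in time.
  have e1 : ∀ᶠ p in 𝓝[S] p₀, ∀ t ∈ Icc (0 : ℝ) 1,
      dist (X t p (φ t p₀)) (X t p₀ (φ t p₀)) < η := by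
    refine eventually_forall_of_forall_eventually_prod isCompact_Icc fun t ht => ?_
    have hA := hcont t ht
    have hB : Tendsto (fun z : ℝ × P => X z.1 p₀ (φ z.1 p₀))
        (𝓝[Icc (0 : ℝ) 1 ×ˢ S] (t, p₀)) (𝓝 (X t p₀ (φ t p₀))) := by
      have : Tendsto (fun z : ℝ × P => (z.1, p₀)) (𝓝[Icc (0 : ℝ) 1 ×ˢ S] (t, p₀))
          (𝓝[Icc (0 : ℝ) 1 ×ˢ S] (t, p₀)) := by
        refine tendsto_nhdsWithin_iff.2 ⟨?_, ?_⟩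
        · have : Continuous fun z : ℝ × P => (z.1, p₀) := by fun_prop
          exact this.continuousAt.continuousWithinAt (s := Icc (0 : ℝ) 1 ×ˢ S) (x := (t, p₀))
        · filter_upwards [self_mem_nhdsWithin] with z hz using ⟨hz.1, hp₀⟩
      exact hA.comp this
    have := hA.dist hB
    rw [dist_self] at this
    exact this.eventually (gt_mem_nhds hη)
  have e2 : ∀ᶠ p in 𝓝[S] p₀, dist (φ 0 p) (φ 0 p₀) < η :=
    (Metric.tendsto_nhds.1 (h0 p₀ hp₀)) η hη
  have e3 : ∀ᶠ p in 𝓝[S] p₀, ∀ t ∈ Icc (0 : ℝ) 1, dist (φ t p) (φ t p₀) < ε / 2 := by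
    filter_upwards [e1, e2, hK, self_mem_nhdsWithin] with p h1 h2 h3 hpS t ht
    have := dist_le_of_approx_trajectories_ODE_of_mem (v := fun t => X t p) (s := fun _ => univ)
      (K := K) (a := 0) (b := 1) (f := fun t => φ t p) (g := fun t => φ t p₀)
      (f' := fun t => X t p (φ t p)) (g' := fun t => X t p₀ (φ t p₀)) (εf := 0) (εg := η) (δ := η)
      (fun t ht => (h3 t (Ico_subset_Icc_self ht)).lipschitzOnWith)
      (hφ p hpS).continuousOn
      (fun t ht => hasDerivWithinAt_Ici_of_Icc ht (hφ p hpS t (Ico_subset_Icc_self ht)))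
      (fun t ht => by simp) (fun _ _ => mem_univ _) hφ₀
      (fun t ht => hasDerivWithinAt_Ici_of_Icc ht (hφ p₀ hp₀ t (Ico_subset_Icc_self ht)))
      (fun t ht => by rw [dist_comm]; exact (h1 t (Ico_subset_Icc_self ht)).le)
      (fun _ _ => mem_univ _) h2.le t ht
    refine (this.trans ?_).trans_lt hηε
    rw [zero_add, sub_zero]
    exact gronwallBound_mono hη.le hη.le K.2 ht.2
  have e4 : ∀ᶠ z in 𝓝[Icc (0 : ℝ) 1 ×ˢ S] (t₀, p₀), dist (φ z.1 p₀) (φ t₀ p₀) < ε / 2 := by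
    have : ContinuousOn (fun z : ℝ × P => φ z.1 p₀) (Icc (0 : ℝ) 1 ×ˢ S) :=
      hφ₀.comp continuousOn_fst fun z hz => hz.1
    exact Metric.tendsto_nhds.1 (this (t₀, p₀) ⟨ht₀, hp₀⟩) _ (by positivity)
  have e5 : ∀ᶠ z in 𝓝[Icc (0 : ℝ) 1 ×ˢ S] (t₀, p₀), ∀ t ∈ Icc (0 : ℝ) 1,
      dist (φ t z.2) (φ t p₀) < ε / 2 := by
    rw [nhdsWithin_prod_eq]
    exact tendsto_snd.eventually e3
  filter_upwards [e4, e5, self_mem_nhdsWithin] with z h4 h5 hz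
  calc dist (φ z.1 z.2) (φ t₀ p₀) ≤ dist (φ z.1 z.2) (φ z.1 p₀) + dist (φ z.1 p₀) (φ t₀ p₀) :=
        dist_triangle _ _ _
    _ < ε := by linarith [h5 z.1 hz.1]

/-! ### Differentiability in the parameters via the variational equation -/

section Derivative

variable {E : Type*} [NormedAddCommGroup E] [NormedSpace ℝ E]
variable {P : Type*} [NormedAddCommGroup P] [NormedSpace ℝ P]

/-- The right-hand side of the variational equation along the solution `φ`. -/
def variationalField (Df : ℝ → P × E → (P × E →L[ℝ] E)) (φ : ℝ → P → E) (t : ℝ) (p : P)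
    (w : P →L[ℝ] E) : P →L[ℝ] E :=
  Df t (p, φ t p) ∘L (ContinuousLinearMap.inl ℝ P E + ContinuousLinearMap.inr ℝ P E ∘L w)

lemma variationalField_apply (Df : ℝ → P × E → (P × E →L[ℝ] E)) (φ : ℝ → P → E) (t : ℝ) (p : P)
    (w : P →L[ℝ] E) (h : P) : variationalField Df φ t p w h = Df t (p, φ t p) (h, w h) := by
  simp [variationalField, ← map_add]

lemma lipschitzWith_variationalField {Df : ℝ → P × E → (P × E →L[ℝ] E)} {φ : ℝ → P → E} {t : ℝ}
    {p : P} {K : ℝ≥0} (h : ‖Df t (p, φ t p)‖ ≤ K) :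
    LipschitzWith K (variationalField Df φ t p) := by
  refine LipschitzWith.of_dist_le_mul fun v w => ?_
  rw [dist_eq_norm, dist_eq_norm]
  refine ContinuousLinearMap.opNorm_le_bound _ (by positivity) fun x => ?_
  rw [sub_apply, variationalField_apply, variationalField_apply, ← map_sub]
  calc _ ≤ ‖Df t (p, φ t p)‖ * ‖(x, v x) - (x, w x)‖ := ContinuousLinearMap.le_opNorm _ _
    _ = ‖Df t (p, φ t p)‖ * ‖(v - w) x‖ := by simp
    _ ≤ K * (‖v - w‖ * ‖x‖) := by
      gcongr
      exact ContinuousLinearMap.le_opNorm _ _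
    _ = _ := by ring

/-- Solutions of the variational equation are derivatives of the solution with respect to the
parameter. -/
theorem hasFDerivWithinAt_of_variational {f : ℝ → P × E → E}
    {Df : ℝ → P × E → (P × E →L[ℝ] E)} {S : Set P} {U : Set E} (hS : Convex ℝ S) (hU : IsOpen U)
    (hf : ∀ t ∈ Icc (0 : ℝ) 1, ∀ q ∈ S ×ˢ U, HasFDerivWithinAt (f t) (Df t q) (S ×ˢ U) q)
    (hDf : ContinuousOn (fun z : ℝ × (P × E) => Df z.1 z.2) (Icc (0 : ℝ) 1 ×ˢ (S ×ˢ U)))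
    {φ : ℝ → P → E} (hφU : ∀ t ∈ Icc (0 : ℝ) 1, ∀ p ∈ S, φ t p ∈ U)
    (hφc : ContinuousOn (fun q : ℝ × P => φ q.1 q.2) (Icc (0 : ℝ) 1 ×ˢ S))
    (hφ : ∀ p ∈ S, IsIntegralCurveOn (fun t => φ t p) (fun t x => f t (p, x)) (Icc 0 1))
    {p₀ : P} (hp₀ : p₀ ∈ S) {W : ℝ → P →L[ℝ] E} (hW0 : HasFDerivWithinAt (φ 0) (W 0) S p₀)
    (hW : IsIntegralCurveOn W (fun t => variationalField Df φ t p₀) (Icc 0 1))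
    {t : ℝ} (ht : t ∈ Icc (0 : ℝ) 1) : HasFDerivWithinAt (φ t) (W t) S p₀ := by
  have hcurve : ContinuousOn (fun t => Df t (p₀, φ t p₀)) (Icc 0 1) :=
    hDf.comp (f := fun t => (t, (p₀, φ t p₀)))
      (continuousOn_id.prodMk (continuousOn_const.prodMk (hφ p₀ hp₀).continuousOn))
      fun t ht => ⟨ht, hp₀, hφU t ht p₀ hp₀⟩
  obtain ⟨K, hK⟩ := isCompact_Icc.exists_bound_of_continuousOn hcurve
  obtain ⟨M, hM⟩ := isCompact_Icc.exists_bound_of_continuousOn hW.continuousOn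
  have hK0 : 0 ≤ K := (norm_nonneg _).trans (hK 0 (by simp))
  have hM0 : 0 ≤ M := (norm_nonneg _).trans (hM 0 (by simp))
  -- uniform differentiability along the orbit
  have unif : ∀ η > 0, ∀ᶠ p in 𝓝[S] p₀, ∀ t ∈ Icc (0 : ℝ) 1,
      ‖f t (p, φ t p) - f t (p₀, φ t p₀) - Df t (p₀, φ t p₀) ((p, φ t p) - (p₀, φ t p₀))‖
        ≤ η * ‖(p, φ t p) - (p₀, φ t p₀)‖ := by
    intro η hη
    refine eventually_forall_of_forall_eventually_prod isCompact_Icc fun t ht => ?_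
    have hq : ((p₀, φ t p₀) : P × E) ∈ S ×ˢ U := ⟨hp₀, hφU t ht p₀ hp₀⟩
    have hc := hDf (t, (p₀, φ t p₀)) ⟨ht, hq⟩
    obtain ⟨δ, hδ, hball⟩ := Metric.mem_nhdsWithin_iff.1
      (hc (Metric.ball_mem_nhds _ (half_pos hη)))
    obtain ⟨r, hr, hrU⟩ := Metric.isOpen_iff.1 hU _ hq.2
    have hφt : Tendsto (fun z : ℝ × P => φ z.1 z.2) (𝓝[Icc (0 : ℝ) 1 ×ˢ S] (t, p₀))
        (𝓝 (φ t p₀)) := hφc (t, p₀) ⟨ht, hp₀⟩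
    have hφt' : Tendsto (fun z : ℝ × P => φ z.1 p₀) (𝓝[Icc (0 : ℝ) 1 ×ˢ S] (t, p₀))
        (𝓝 (φ t p₀)) := by
      have : ContinuousOn (fun z : ℝ × P => φ z.1 p₀) (Icc (0 : ℝ) 1 ×ˢ S) :=
        ((hφ p₀ hp₀).continuousOn).comp continuousOn_fst fun z hz => hz.1
      exact this (t, p₀) ⟨ht, hp₀⟩
    have hmin : 0 < min δ r := lt_min hδ hr
    filter_upwards [hφt (Metric.ball_mem_nhds _ hmin), hφt' (Metric.ball_mem_nhds _ hmin),
      mem_nhdsWithin_of_mem_nhds (Metric.ball_mem_nhds (t, p₀) hmin), self_mem_nhdsWithin]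
      with z h1 h2 h3 hz
    have h1' : dist (φ z.1 z.2) (φ t p₀) < min δ r := h1
    have h2' : dist (φ z.1 p₀) (φ t p₀) < min δ r := h2
    have h3' : dist z (t, p₀) < min δ r := h3
    -- A convex set containing both orbit points on which Df varies by at most η, so that the mean
    -- value inequality applies.
    set C : Set (P × E) := (S ∩ Metric.ball p₀ δ) ×ˢ Metric.ball (φ t p₀) (min δ r) with hC
    have hCsub : C ⊆ S ×ˢ U := fun q hq =>
      ⟨hq.1.1, hrU (Metric.ball_subset_ball (min_le_right _ _) hq.2)⟩
    have hCconv : Convex ℝ C := (hS.inter (convex_ball _ _)).prod (convex_ball _ _)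
    have hD : ∀ q ∈ C, ‖Df z.1 q - Df t (p₀, φ t p₀)‖ ≤ η / 2 := by
      intro q hq
      have : (z.1, q) ∈ Metric.ball (t, (p₀, φ t p₀)) δ ∩ Icc (0 : ℝ) 1 ×ˢ (S ×ˢ U) := by
        refine ⟨?_, hz.1, hCsub hq⟩
        rw [Metric.mem_ball, Prod.dist_eq, Prod.dist_eq]
        refine max_lt ?_ (max_lt hq.1.2 ?_)
        · exact (le_max_left _ _).trans_lt (h3'.trans_le (min_le_left _ _))
        · exact lt_of_lt_of_le hq.2 (min_le_left _ _)
      have := hball this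
      rw [mem_preimage, Metric.mem_ball, dist_eq_norm] at this
      exact this.le
    have m1 : (z.2, φ z.1 z.2) ∈ C :=
      ⟨⟨hz.2, (le_max_right _ _).trans_lt (h3'.trans_le (min_le_left _ _))⟩, h1'⟩
    have m0 : (p₀, φ z.1 p₀) ∈ C := ⟨⟨hp₀, Metric.mem_ball_self hδ⟩, h2'⟩
    refine hCconv.norm_image_sub_le_of_norm_hasFDerivWithin_le' (f := f z.1) (f' := Df z.1)
      (fun q hq => (hf z.1 hz.1 q (hCsub hq)).mono hCsub) (fun q hq => ?_) m0 m1
    calc ‖Df z.1 q - Df z.1 (p₀, φ z.1 p₀)‖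
        = ‖(Df z.1 q - Df t (p₀, φ t p₀)) - (Df z.1 (p₀, φ z.1 p₀) - Df t (p₀, φ t p₀))‖ := by
          congr 1; abel
      _ ≤ η / 2 + η / 2 := (norm_sub_le _ _).trans (add_le_add (hD q hq) (hD _ m0))
      _ = η := by ring
  -- Gronwall
  rw [hasFDerivWithinAt_iff_isLittleO, Asymptotics.isLittleO_iff]
  intro c hc
  -- The condition η ≤ 1 lets a term η‖y‖ be absorbed into the growth rate, which becomes K + 1;
  -- this is also nonzero, as the closed form of `gronwallBound` used here requires.
  obtain ⟨η, hη, hη1, hηc⟩ : ∃ η > 0, η ≤ 1 ∧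
      gronwallBound η (K + 1) (η * (1 + M)) 1 ≤ c := by
    have h1 : Continuous fun η : ℝ => gronwallBound η (K + 1) (η * (1 + M)) 1 := by
      have : K + 1 ≠ 0 := by positivity
      simp only [gronwallBound_of_K_ne_0 this]; fun_prop
    have h2 : gronwallBound 0 (K + 1) (0 * (1 + M)) 1 = 0 := by
      rw [zero_mul, gronwallBound_ε0]; simp
    have h3 : ∀ᶠ η in 𝓝 (0 : ℝ), gronwallBound η (K + 1) (η * (1 + M)) 1 < c :=
      h1.continuousAt.eventually (gt_mem_nhds (by simp only [h2]; positivity))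
    obtain ⟨δ, hδ, h4⟩ := Metric.eventually_nhds_iff.1 h3
    have hd : 0 < min (δ / 2) 1 := by positivity
    refine ⟨min (δ / 2) 1, hd, min_le_right _ _, (h4 ?_).le⟩
    rw [Real.dist_eq, sub_zero, abs_of_pos hd]
    exact (min_le_left _ _).trans_lt (by linarith)
  have e0 := Asymptotics.isLittleO_iff.1 hW0.isLittleO hη
  filter_upwards [unif η hη, e0, self_mem_nhdsWithin] with p hu h0 hp
  have hp' := hφ p hp
  have hp0' := hφ p₀ hp₀
  have hWd : IsIntegralCurveOn (fun t => W t (p - p₀))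
      (fun t _ => Df t (p₀, φ t p₀) (p - p₀, W t (p - p₀))) (Icc 0 1) := by
    intro t ht
    have := (hW t ht).clm_apply (hasDerivWithinAt_const t (Icc (0 : ℝ) 1) (p - p₀))
    simpa [variationalField_apply] using this
  have key := norm_le_gronwallBound_of_norm_deriv_right_le (a := 0) (b := 1)
    (f := fun t => φ t p - φ t p₀ - W t (p - p₀))
    (f' := fun t => f t (p, φ t p) - f t (p₀, φ t p₀)
      - Df t (p₀, φ t p₀) (p - p₀, W t (p - p₀)))
    (δ := η * ‖p - p₀‖) (K := K + 1) (ε := η * (1 + M) * ‖p - p₀‖)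
    ((hp'.continuousOn.sub hp0'.continuousOn).sub hWd.continuousOn)
    (fun t ht => hasDerivWithinAt_Ici_of_Icc ht (((hp' t (Ico_subset_Icc_self ht)).sub
      (hp0' t (Ico_subset_Icc_self ht))).sub (hWd t (Ico_subset_Icc_self ht))))
    h0 (fun t ht => ?_) t ht
  · refine key.trans ?_
    have hlin : ∀ x, gronwallBound (η * ‖p - p₀‖) (K + 1) (η * (1 + M) * ‖p - p₀‖) x
        = gronwallBound η (K + 1) (η * (1 + M)) x * ‖p - p₀‖ := by
      intro x
      have : K + 1 ≠ 0 := by positivity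
      simp only [gronwallBound_of_K_ne_0 this]
      ring
    rw [hlin]
    refine mul_le_mul_of_nonneg_right (le_trans ?_ hηc) (norm_nonneg _)
    exact gronwallBound_mono hη.le (by positivity) (by positivity) (by linarith [ht.2])
  · have ht' := Ico_subset_Icc_self ht
    -- The error y satisfies y' = Df(0, y) + remainder, where the remainder is at most η times the
    -- increment, and the increment is at most (1 + M)‖p - p₀‖ + ‖y‖.
    set y := φ t p - φ t p₀ - W t (p - p₀) with hy
    have hdiff : (p, φ t p) - (p₀, φ t p₀) = (p - p₀, W t (p - p₀)) + (0, y) := by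
      ext <;> simp [hy]
    have hn : ‖(p, φ t p) - (p₀, φ t p₀)‖ ≤ (1 + M) * ‖p - p₀‖ + ‖y‖ := by
      rw [hdiff]
      refine (norm_add_le _ _).trans (add_le_add ?_ (by simp))
      have h1 : ‖W t (p - p₀)‖ ≤ M * ‖p - p₀‖ :=
        (ContinuousLinearMap.le_opNorm _ _).trans (by gcongr; exact hM t ht')
      have h2 : 0 ≤ M * ‖p - p₀‖ := by positivity
      have h3 := norm_nonneg (p - p₀)
      rw [Prod.norm_def]
      exact max_le (by simp only; linarith) (by simp only; linarith)
    have hsplit : f t (p, φ t p) - f t (p₀, φ t p₀) - Df t (p₀, φ t p₀) (p - p₀, W t (p - p₀))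
        = (f t (p, φ t p) - f t (p₀, φ t p₀)
          - Df t (p₀, φ t p₀) ((p, φ t p) - (p₀, φ t p₀))) + Df t (p₀, φ t p₀) (0, y) := by
      rw [hdiff, map_add]; abel
    rw [hsplit]
    have h4 : ‖Df t (p₀, φ t p₀) (0, y)‖ ≤ K * ‖y‖ := by
      refine (ContinuousLinearMap.le_opNorm _ _).trans ?_
      have : ‖((0, y) : P × E)‖ = ‖y‖ := by simp
      rw [this]
      gcongr
      exact hK t ht'
    have h5 : η * ‖(p, φ t p) - (p₀, φ t p₀)‖ ≤ η * ((1 + M) * ‖p - p₀‖ + ‖y‖) := by gcongr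
    have h6 : η * ‖y‖ ≤ 1 * ‖y‖ := by gcongr
    calc _ ≤ _ := norm_add_le _ _
      _ ≤ η * ((1 + M) * ‖p - p₀‖ + ‖y‖) + K * ‖y‖ := add_le_add ((hu t ht').trans h5) h4
      _ ≤ (K + 1) * ‖y‖ + η * (1 + M) * ‖p - p₀‖ := by linarith

/-- The derivative of the solution with respect to the parameter exists, is jointly continuous, and
satisfies the variational equation. -/
theorem exists_variational_solution [CompleteSpace E] {f : ℝ → P × E → E}
    {Df : ℝ → P × E → (P × E →L[ℝ] E)} {S : Set P} {U : Set E} (hS : Convex ℝ S) (hU : IsOpen U)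
    (hf : ∀ t ∈ Icc (0 : ℝ) 1, ∀ q ∈ S ×ˢ U, HasFDerivWithinAt (f t) (Df t q) (S ×ˢ U) q)
    (hDf : ContinuousOn (fun z : ℝ × (P × E) => Df z.1 z.2) (Icc (0 : ℝ) 1 ×ˢ (S ×ˢ U)))
    {φ : ℝ → P → E} (hφU : ∀ t ∈ Icc (0 : ℝ) 1, ∀ p ∈ S, φ t p ∈ U)
    (hφc : ContinuousOn (fun q : ℝ × P => φ q.1 q.2) (Icc (0 : ℝ) 1 ×ˢ S))
    (hφ : ∀ p ∈ S, IsIntegralCurveOn (fun t => φ t p) (fun t x => f t (p, x)) (Icc 0 1))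
    {g' : P → P →L[ℝ] E} (hg : ∀ p ∈ S, HasFDerivWithinAt (φ 0) (g' p) S p)
    (hg' : ContinuousOn g' S) :
    ∃ W : ℝ → P → P →L[ℝ] E, (∀ p, W 0 p = g' p) ∧
      (∀ p ∈ S, IsIntegralCurveOn (fun t => W t p) (fun t => variationalField Df φ t p)
        (Icc 0 1)) ∧
      ContinuousOn (fun q : ℝ × P => W q.1 q.2) (Icc (0 : ℝ) 1 ×ˢ S) ∧
      ∀ t ∈ Icc (0 : ℝ) 1, ∀ p ∈ S, HasFDerivWithinAt (φ t) (W t p) S p := by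
  have hDφ : ContinuousOn (fun z : ℝ × P => Df z.1 (z.2, φ z.1 z.2)) (Icc (0 : ℝ) 1 ×ˢ S) :=
    hDf.comp (f := fun z : ℝ × P => (z.1, (z.2, φ z.1 z.2)))
      (continuousOn_fst.prodMk (continuousOn_snd.prodMk hφc))
      fun z hz => ⟨hz.1, hz.2, hφU z.1 hz.1 z.2 hz.2⟩
  -- The variational equation is affine in w, with Lipschitz constant controlled by ‖Df‖ along the
  -- orbit; compactness of the time interval makes this locally uniform in p.
  have hbound : ∀ p₀ ∈ S, ∃ K : ℝ≥0, ∀ᶠ p in 𝓝[S] p₀, ∀ t ∈ Icc (0 : ℝ) 1,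
      LipschitzWith K (variationalField Df φ t p) := by
    intro p₀ hp₀
    have hcurve : ContinuousOn (fun t => Df t (p₀, φ t p₀)) (Icc 0 1) :=
      hDφ.comp (f := fun t => (t, p₀)) (by fun_prop) fun t ht => ⟨ht, hp₀⟩
    obtain ⟨K, hK⟩ := isCompact_Icc.exists_bound_of_continuousOn hcurve
    have hK0 : 0 ≤ K := (norm_nonneg _).trans (hK 0 (by simp))
    refine ⟨⟨K + 1, by positivity⟩, ?_⟩
    have : ∀ᶠ p in 𝓝[S] p₀, ∀ t ∈ Icc (0 : ℝ) 1, ‖Df t (p, φ t p)‖ < K + 1 := by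
      refine eventually_forall_of_forall_eventually_prod isCompact_Icc fun t ht => ?_
      have := (hDφ (t, p₀) ⟨ht, hp₀⟩).norm
      exact this.eventually (gt_mem_nhds (by have := hK t ht; simp only; linarith))
    exact this.mono fun p hp t ht => lipschitzWith_variationalField (hp t ht).le
  have hcont : ContinuousOn (fun q : ℝ × P × (P →L[ℝ] E) => variationalField Df φ q.1 q.2.1 q.2.2)
      (Icc (0 : ℝ) 1 ×ˢ S ×ˢ univ) := by
    refine ContinuousOn.clm_comp ?_ ?_
    · exact hDφ.comp (f := fun q : ℝ × P × (P →L[ℝ] E) => (q.1, q.2.1)) (by fun_prop)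
        fun q hq => ⟨hq.1, hq.2.1⟩
    · have : Continuous fun w : P →L[ℝ] E =>
          ContinuousLinearMap.inl ℝ P E + ContinuousLinearMap.inr ℝ P E ∘L w :=
        continuous_const.add (continuous_const.clm_comp continuous_id)
      exact (this.comp (continuous_snd.comp continuous_snd)).continuousOn
  have hex : ∀ p, ∃ α : ℝ → P →L[ℝ] E, α 0 = g' p ∧
      (p ∈ S → IsIntegralCurveOn α (fun t => variationalField Df φ t p) (Icc 0 1)) := by
    intro p
    by_cases hp : p ∈ S
    · obtain ⟨K, hK⟩ := hbound p hp
      have hK' := hK.self_of_nhdsWithin hp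
      obtain ⟨α, h0, hα⟩ := exists_isIntegralCurveOn_Icc hK' (fun w =>
        hcont.comp (f := fun t : ℝ => (t, p, w)) (by fun_prop) fun t ht => ⟨ht, hp, mem_univ _⟩)
        (g' p)
      exact ⟨α, h0, fun _ => hα⟩
    · exact ⟨fun _ => g' p, rfl, fun h => absurd h hp⟩
  choose α h0 hα using hex
  refine ⟨fun t p => α p t, h0, hα, ?_, ?_⟩
  · refine continuousOn_of_lipschitz hcont hbound hα ?_
    exact hg'.congr fun p _ => h0 p
  · intro t ht p hp
    exact hasFDerivWithinAt_of_variational hS hU hf hDf hφU hφc hφ hp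
      (by rw [h0]; exact hg p hp) (hα p hp) ht

end Derivative

/-! ### Smooth dependence on parameters -/

section Smooth

universe u

variable {P : Type u} [NormedAddCommGroup P] [NormedSpace ℝ P]

lemma contDiffOn_snd_partial {G E F : Type*} [NormedAddCommGroup G] [NormedSpace ℝ G]
    [NormedAddCommGroup E] [NormedSpace ℝ E] [NormedAddCommGroup F] [NormedSpace ℝ F]
    {f : G × E → F} {T : Set G} {Q : Set E} {n : WithTop ℕ∞} (hf : ContDiffOn ℝ (n + 1) f (T ×ˢ Q))
    (hT : UniqueDiffOn ℝ T) (hQ : UniqueDiffOn ℝ Q) :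
    ∃ Df : G × E → (E →L[ℝ] F), ContDiffOn ℝ n Df (T ×ˢ Q) ∧
      ∀ t ∈ T, ∀ q ∈ Q, HasFDerivWithinAt (fun x => f (t, x)) (Df (t, q)) Q q := by
  refine ⟨fun z => fderivWithin ℝ f (T ×ˢ Q) z ∘L ContinuousLinearMap.inr ℝ G E, ?_, ?_⟩
  · exact (hf.fderivWithin (hT.prod hQ) le_rfl).clm_comp contDiffOn_const
  · intro t ht q hq
    have h1 := ((hf.differentiableOn (by simp)) (t, q) ⟨ht, hq⟩).hasFDerivWithinAt
    have h2 : HasFDerivWithinAt (fun x : E => (t, x)) (ContinuousLinearMap.inr ℝ G E) Q q :=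
      (hasFDerivAt_prodMk_right t q).hasFDerivWithinAt
    exact h1.comp q h2 fun x hx => ⟨ht, hx⟩

/-- Induction on n for all equations at once. The pair (φ, W) of the solution and its parameter
derivative solves an equation of the same kind whose right-hand side has one derivative fewer, so W
is Cⁿ and φ is Cⁿ⁺¹. The state space grows to E × (P →L[ℝ] E), so P and E must share a universe. -/
theorem contDiffOn_nat_solution {S : Set P} (hS : Convex ℝ S) (hSu : UniqueDiffOn ℝ S) (n : ℕ) :
    ∀ {E : Type u} [NormedAddCommGroup E] [NormedSpace ℝ E] [CompleteSpace E]
      {f : ℝ × (P × E) → E} {U : Set E} (_ : IsOpen U)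
      (_ : ContDiffOn ℝ n f (Icc (0 : ℝ) 1 ×ˢ (S ×ˢ U)))
      {φ : ℝ → P → E} (_ : ∀ t ∈ Icc (0 : ℝ) 1, ∀ p ∈ S, φ t p ∈ U)
      (_ : ContinuousOn (fun q : ℝ × P => φ q.1 q.2) (Icc (0 : ℝ) 1 ×ˢ S))
      (_ : ∀ p ∈ S, IsIntegralCurveOn (fun t => φ t p) (fun t x => f (t, (p, x))) (Icc 0 1))
      (_ : ContDiffOn ℝ n (φ 0) S) {t : ℝ} (_ : t ∈ Icc (0 : ℝ) 1), ContDiffOn ℝ n (φ t) S := by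
  induction n with
  | zero =>
    intro E _ _ _ f U _ _ φ _ hφc _ _ t ht
    rw [Nat.cast_zero, contDiffOn_zero]
    exact hφc.comp (f := fun p => (t, p)) (by fun_prop) fun p hp => ⟨ht, hp⟩
  | succ n ih =>
    intro E _ _ _ f U hU hf φ hφU hφc hφ hφ0 t ht
    have hI : UniqueDiffOn ℝ (Icc (0 : ℝ) 1) := uniqueDiffOn_Icc zero_lt_one
    have hSU : UniqueDiffOn ℝ (S ×ˢ U) := hSu.prod hU.uniqueDiffOn
    push_cast at hf hφ0 ⊢
    obtain ⟨Df, hDf, hDf'⟩ := contDiffOn_snd_partial hf hI hSU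
    obtain ⟨-, g', hg', hg⟩ := (contDiffOn_succ_iff_hasFDerivWithinAt_of_uniqueDiffOn hSu).1 hφ0
    obtain ⟨W, hW0, hW, hWc, hWd⟩ := exists_variational_solution (f := fun t q => f (t, q))
      (Df := fun t q => Df (t, q)) hS hU hDf' hDf.continuousOn hφU hφc hφ hg hg'.continuousOn
    have hext := ih (E := E × (P →L[ℝ] E)) (U := U ×ˢ univ)
      (f := fun z => (f (z.1, (z.2.1, z.2.2.1)), Df (z.1, (z.2.1, z.2.2.1)) ∘L
        (ContinuousLinearMap.inl ℝ P E + ContinuousLinearMap.inr ℝ P E ∘L z.2.2.2)))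
      (φ := fun t p => (φ t p, W t p)) (hU.prod isOpen_univ) ?_
      (fun t ht p hp => ⟨hφU t ht p hp, mem_univ _⟩) (hφc.prodMk hWc)
      (fun p hp s hs => (hφ p hp s hs).prodMk (hW p hp s hs))
      ((hφ0.of_le (by norm_cast; omega)).prodMk (hg'.congr fun p _ => hW0 p)) ht
    · refine (contDiffOn_succ_iff_hasFDerivWithinAt_of_uniqueDiffOn hSu).2
        ⟨fun h => by simp at h, W t, hext.snd, hWd t ht⟩
    · have hpr : ContDiff ℝ n fun z : ℝ × (P × (E × (P →L[ℝ] E))) => (z.1, (z.2.1, z.2.2.1)) := by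
        fun_prop
      have hmaps : MapsTo (fun z : ℝ × (P × (E × (P →L[ℝ] E))) => (z.1, (z.2.1, z.2.2.1)))
          (Icc (0 : ℝ) 1 ×ˢ (S ×ˢ (U ×ˢ univ))) (Icc (0 : ℝ) 1 ×ˢ (S ×ˢ U)) :=
        fun z hz => ⟨hz.1, hz.2.1, hz.2.2.1⟩
      refine ContDiffOn.prodMk ?_ (ContDiffOn.clm_comp ?_ ?_)
      · exact (hf.of_le (by norm_cast; omega)).comp hpr.contDiffOn hmaps
      · exact hDf.comp hpr.contDiffOn hmaps
      · exact contDiffOn_const.add (contDiffOn_const.clm_comp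
          (contDiff_snd.comp (contDiff_snd.comp contDiff_snd)).contDiffOn)

/-- Smooth dependence of the solutions of an ordinary differential equation on parameters which
range over a convex set. -/
theorem contDiffOn_solution {S : Set P} (hS : Convex ℝ S) (hSu : UniqueDiffOn ℝ S)
    {E : Type u} [NormedAddCommGroup E] [NormedSpace ℝ E] [CompleteSpace E]
    {f : ℝ × (P × E) → E} {U : Set E} (hU : IsOpen U)
    (hf : ContDiffOn ℝ ∞ f (Icc (0 : ℝ) 1 ×ˢ (S ×ˢ U)))
    {φ : ℝ → P → E} (hφU : ∀ t ∈ Icc (0 : ℝ) 1, ∀ p ∈ S, φ t p ∈ U)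
    (hφc : ContinuousOn (fun q : ℝ × P => φ q.1 q.2) (Icc (0 : ℝ) 1 ×ˢ S))
    (hφ : ∀ p ∈ S, IsIntegralCurveOn (fun t => φ t p) (fun t x => f (t, (p, x))) (Icc 0 1))
    (h0 : ContDiffOn ℝ ∞ (φ 0) S) {t : ℝ} (ht : t ∈ Icc (0 : ℝ) 1) :
    ContDiffOn ℝ ∞ (φ t) S :=
  contDiffOn_infty.2 fun n => contDiffOn_nat_solution hS hSu n hU (contDiffOn_infty.1 hf n) hφU hφc
    hφ (contDiffOn_infty.1 h0 n) ht

end Smooth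

end ParametricODE

namespace Circular

open Filter

set_option linter.unusedSectionVars false

/-! ### Derivatives along curves -/

section SecondDerivative

variable {E F : Type*} [NormedAddCommGroup E] [NormedSpace ℝ E]
  [NormedAddCommGroup F] [NormedSpace ℝ F]

/-- The first two derivatives of a function along a curve. -/
lemma hasDerivAt_comp_curve {ρ : E → F} {γ γ' : ℝ → E} {γ'' : E} {t₀ : ℝ}
    (hρ : ContDiffAt ℝ 2 ρ (γ t₀))
    (h1 : ∀ᶠ t in 𝓝 t₀, HasDerivAt γ (γ' t) t) (h2 : HasDerivAt γ' γ'' t₀) :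
    (∀ᶠ t in 𝓝 t₀, HasDerivAt (fun s => ρ (γ s)) (fderiv ℝ ρ (γ t) (γ' t)) t) ∧
      HasDerivAt (fun t => fderiv ℝ ρ (γ t) (γ' t))
        (fderiv ℝ (fderiv ℝ ρ) (γ t₀) (γ' t₀) (γ' t₀) + fderiv ℝ ρ (γ t₀) γ'') t₀ := by
  have hγ : ContinuousAt γ t₀ := h1.self_of_nhds.continuousAt
  constructor
  · have h3 : ∀ᶠ z in 𝓝 (γ t₀), ContDiffAt ℝ 2 ρ z := hρ.eventually (by simp)
    filter_upwards [h1, hγ.eventually h3] with t ht hz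
    exact (hz.differentiableAt (by simp)).hasFDerivAt.comp_hasDerivAt t ht
  · have h3 : ContDiffAt ℝ 1 (fderiv ℝ ρ) (γ t₀) := hρ.fderiv_right (by norm_num)
    have h4 := (h3.differentiableAt (by simp)).hasFDerivAt.comp_hasDerivAt t₀ h1.self_of_nhds
    exact h4.clm_apply h2

lemma hasDerivAt_comp_line {ρ : E → F} {z w : E} (hρ : ContDiffAt ℝ 2 ρ z) :
    (∀ᶠ t in 𝓝 (0 : ℝ), HasDerivAt (fun s : ℝ => ρ (z + s • w)) (fderiv ℝ ρ (z + t • w) w) t) ∧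
      HasDerivAt (fun t : ℝ => fderiv ℝ ρ (z + t • w) w) (fderiv ℝ (fderiv ℝ ρ) z w w) 0 := by
  have h1 : ∀ t : ℝ, HasDerivAt (fun s : ℝ => z + s • w) w t := fun t => by
    simpa using ((hasDerivAt_id t).smul_const w).const_add z
  have := hasDerivAt_comp_curve (γ := fun s : ℝ => z + s • w) (γ' := fun _ => w) (γ'' := 0)
    (t₀ := 0) (by simpa using hρ) (Eventually.of_forall h1) (hasDerivAt_const _ _)
  simpa using this

end SecondDerivative

/-! ### Levi forms of functions with f(ζz) = |ζ|² f(z) -/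

section Hermitian

variable {E : Type*} [NormedAddCommGroup E] [NormedSpace ℝ E] [NormedSpace ℂ E]
  [IsScalarTower ℝ ℂ E]

/-- Multiplication by the imaginary unit. -/
def mulI (E : Type*) [NormedAddCommGroup E] [NormedSpace ℝ E] [NormedSpace ℂ E]
    [IsScalarTower ℝ ℂ E] : E →L[ℝ] E :=
  (ContinuousLinearMap.lsmul ℝ ℂ Complex.I : E →L[ℝ] E)

@[simp] lemma mulI_apply (v : E) : mulI E v = Complex.I • v := rfl

/-- The `J`-invariant part (twice) of a bilinear form. -/
def hermitianPart (B : E →L[ℝ] E →L[ℝ] ℝ) : E →L[ℝ] E →L[ℝ] ℝ :=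
  B + ((ContinuousLinearMap.compL ℝ E E ℝ).flip (mulI E)) ∘L B ∘L mulI E

lemma contDiff_hermitianPart {n : WithTop ℕ∞} :
    ContDiff ℝ n (hermitianPart : (E →L[ℝ] E →L[ℝ] ℝ) → _) :=
  contDiff_id.add (contDiff_const.clm_comp (contDiff_id.clm_comp contDiff_const))

lemma I_smul_I_smul (v : E) : Complex.I • Complex.I • v = -v := by
  rw [smul_smul, Complex.I_mul_I, neg_one_smul]

lemma real_smul_eq (r : ℝ) (v : E) : r • v = (r : ℂ) • v := (algebraMap_smul ℂ r v).symm

/-- Four times the real part of the polarized Levi form. -/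
def polarLevi (f : E → ℝ) (z : E) : E →L[ℝ] E →L[ℝ] ℝ :=
  hermitianPart (fderiv ℝ (fderiv ℝ f) z)

lemma polarLevi_apply (f : E → ℝ) (z v w : E) : polarLevi f z v w =
    fderiv ℝ (fderiv ℝ f) z v w +
      fderiv ℝ (fderiv ℝ f) z (Complex.I • v) (Complex.I • w) := rfl

/-- Functions which are smooth away from the origin and satisfy `f (ζ z) = |ζ|² f z`. -/
structure IsCircularQuadratic (f : E → ℝ) : Prop where
  contDiffAt : ∀ z ≠ 0, ContDiffAt ℝ ∞ f z
  apply_smul : ∀ (ζ : ℂ) (z : E), f (ζ • z) = ‖ζ‖ ^ 2 * f z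

namespace IsCircularQuadratic

variable {f g : E → ℝ} (hf : IsCircularQuadratic f) {z : E}
include hf

lemma contDiffAt_two (hz : z ≠ 0) : ContDiffAt ℝ 2 f z :=
  contDiffAt_infty.1 (hf.contDiffAt z hz) 2

lemma hasFDerivAt (hz : z ≠ 0) : HasFDerivAt f (fderiv ℝ f z) z :=
  ((hf.contDiffAt z hz).differentiableAt (by simp)).hasFDerivAt

lemma hasFDerivAt_fderiv (hz : z ≠ 0) :
    HasFDerivAt (fderiv ℝ f) (fderiv ℝ (fderiv ℝ f) z) z :=
  (((hf.contDiffAt_two hz).fderiv_right (m := 1) (by norm_num)).differentiableAt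
    (by simp)).hasFDerivAt

lemma fderiv_smul (ζ : ℂ) (hζ : ζ ≠ 0) (hz : z ≠ 0) (w : E) :
    fderiv ℝ f (ζ • z) (ζ • w) = ‖ζ‖ ^ 2 * fderiv ℝ f z w := by
  have h1 : HasFDerivAt (fun z : E => ζ • z) (ContinuousLinearMap.lsmul ℝ ℂ ζ : E →L[ℝ] E) z :=
    (ContinuousLinearMap.lsmul ℝ ℂ ζ : E →L[ℝ] E).hasFDerivAt
  have h2 := (hf.hasFDerivAt (smul_ne_zero hζ hz)).comp z h1
  have h3 := (hf.hasFDerivAt hz).const_mul (‖ζ‖ ^ 2)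
  have h4 : (f ∘ fun z => ζ • z) = fun z => ‖ζ‖ ^ 2 * f z := by
    ext z; exact hf.apply_smul ζ z
  rw [h4] at h2
  exact congrArg (fun L : E →L[ℝ] ℝ => L w) (h2.unique h3)

lemma fderiv_fderiv_smul (ζ : ℂ) (hζ : ζ ≠ 0) (hz : z ≠ 0) (v w : E) :
    fderiv ℝ (fderiv ℝ f) (ζ • z) (ζ • v) (ζ • w) = ‖ζ‖ ^ 2 * fderiv ℝ (fderiv ℝ f) z v w := by
  have h1 : HasFDerivAt (fun z : E => ζ • z) (ContinuousLinearMap.lsmul ℝ ℂ ζ : E →L[ℝ] E) z :=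
    (ContinuousLinearMap.lsmul ℝ ℂ ζ : E →L[ℝ] E).hasFDerivAt
  have h2 := ((hf.hasFDerivAt_fderiv (smul_ne_zero hζ hz)).comp z h1).clm_apply
    (hasFDerivAt_const (ζ • w) z)
  have h3 := ((hf.hasFDerivAt_fderiv hz).clm_apply (hasFDerivAt_const w z)).const_mul (‖ζ‖ ^ 2)
  have h4 : (fun y => (fderiv ℝ f ∘ fun z => ζ • z) y (ζ • w)) =ᶠ[𝓝 z]
      fun y => ‖ζ‖ ^ 2 * fderiv ℝ f y w := by
    filter_upwards [isOpen_ne.mem_nhds hz] with y hy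
    exact hf.fderiv_smul ζ hζ hy w
  have := congrArg (fun L : E →L[ℝ] ℝ => L v) ((h3.congr_of_eventuallyEq h4).unique h2)
  simpa using this.symm

lemma polarLevi_smul (ζ : ℂ) (hζ : ζ ≠ 0) (hz : z ≠ 0) (v w : E) :
    polarLevi f (ζ • z) (ζ • v) (ζ • w) = ‖ζ‖ ^ 2 * polarLevi f z v w := by
  rw [polarLevi_apply, polarLevi_apply, smul_comm Complex.I ζ v, smul_comm Complex.I ζ w,
    hf.fderiv_fderiv_smul ζ hζ hz, hf.fderiv_fderiv_smul ζ hζ hz]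
  ring

omit hf in
lemma hasDerivAt_normSq_one_add (θ : ℂ) :
    HasDerivAt (fun t : ℝ => ‖1 + (t : ℂ) * θ‖ ^ 2) (2 * θ.re) 0 := by
  have h : (fun t : ℝ => ‖1 + (t : ℂ) * θ‖ ^ 2)
      = fun t : ℝ => (1 + t * θ.re) ^ 2 + (t * θ.im) ^ 2 := by
    ext t
    rw [Complex.sq_norm, Complex.normSq_apply]
    simp
    ring
  rw [h]
  have h1 : HasDerivAt (fun t : ℝ => (1 + t * θ.re)) θ.re 0 := by
    simpa using ((hasDerivAt_id (0 : ℝ)).mul_const θ.re).const_add 1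
  have h2 : HasDerivAt (fun t : ℝ => t * θ.im) θ.im 0 := by
    simpa using (hasDerivAt_id (0 : ℝ)).mul_const θ.im
  have := (h1.fun_pow 2).fun_add (h2.fun_pow 2)
  simpa using this

omit hf in
lemma hasDerivAt_one_add_smul (θ : ℂ) (z : E) :
    HasDerivAt (fun t : ℝ => (1 + (t : ℂ) * θ) • z) (θ • z) 0 := by
  have h : (fun t : ℝ => (1 + (t : ℂ) * θ) • z) = fun t : ℝ => z + t • (θ • z) := by
    ext t; rw [add_smul, one_smul, mul_smul, real_smul_eq]
  rw [h]
  simpa using ((hasDerivAt_id (0 : ℝ)).smul_const (θ • z)).const_add z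

omit hf in
lemma eventually_one_add_ne_zero (θ : ℂ) : ∀ᶠ t : ℝ in 𝓝 0, 1 + (t : ℂ) * θ ≠ 0 := by
  have : Continuous fun t : ℝ => 1 + (t : ℂ) * θ := by fun_prop
  exact this.continuousAt.eventually_ne (by simp)

/-- Euler's identity. -/
lemma fderiv_apply_smul_self (θ : ℂ) (hz : z ≠ 0) : fderiv ℝ f z (θ • z) = 2 * θ.re * f z := by
  have h1 : HasDerivAt (fun t : ℝ => f ((1 + (t : ℂ) * θ) • z)) (fderiv ℝ f z (θ • z)) 0 := by
    refine HasFDerivAt.comp_hasDerivAt (0 : ℝ) ?_ (hasDerivAt_one_add_smul θ z)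
    simpa using hf.hasFDerivAt hz
  have h2 := (hasDerivAt_normSq_one_add θ).mul_const (f z)
  simp only [hf.apply_smul] at h1
  exact h1.unique h2

/-- Euler's identity for the differential. -/
lemma fderiv_fderiv_smul_self (θ : ℂ) (hz : z ≠ 0) (w : E) :
    fderiv ℝ (fderiv ℝ f) z (θ • z) w = 2 * θ.re * fderiv ℝ f z w - fderiv ℝ f z (θ • w) := by
  have h1 : HasDerivAt (fun t : ℝ => fderiv ℝ f ((1 + (t : ℂ) * θ) • z) ((1 + (t : ℂ) * θ) • w))
      (fderiv ℝ (fderiv ℝ f) z (θ • z) w + fderiv ℝ f z (θ • w)) 0 := by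
    have h := (HasFDerivAt.comp_hasDerivAt (0 : ℝ) (l := fderiv ℝ f) (l' := fderiv ℝ (fderiv ℝ f) z)
      (by simpa using hf.hasFDerivAt_fderiv hz) (hasDerivAt_one_add_smul θ z)).clm_apply
        (hasDerivAt_one_add_smul θ w)
    simpa using h
  have h2 := (hasDerivAt_normSq_one_add θ).mul_const (fderiv ℝ f z w)
  have h3 : (fun t : ℝ => fderiv ℝ f ((1 + (t : ℂ) * θ) • z) ((1 + (t : ℂ) * θ) • w)) =ᶠ[𝓝 0]
      fun t : ℝ => ‖1 + (t : ℂ) * θ‖ ^ 2 * fderiv ℝ f z w := by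
    filter_upwards [eventually_one_add_ne_zero θ] with t ht
    exact hf.fderiv_smul _ ht hz w
  have := (h1.congr_of_eventuallyEq h3.symm).unique h2
  linarith

/-- Euler's identity for the differential, taken with θ = 1 and θ = i, makes each of the two terms
of the Levi form equal to df(w). Through this lemma and the next, pairing the Moser equation with z
and iz gives first-order information. -/
lemma polarLevi_self (hz : z ≠ 0) (w : E) : polarLevi f z z w = 2 * fderiv ℝ f z w := by
  have h1 := hf.fderiv_fderiv_smul_self 1 hz w
  have h2 := hf.fderiv_fderiv_smul_self Complex.I hz (Complex.I • w)
  rw [I_smul_I_smul] at h2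
  simp only [one_smul, Complex.one_re, Complex.I_re, map_neg] at h1 h2
  rw [polarLevi_apply, h1, h2]
  ring

lemma polarLevi_I_smul_self (hz : z ≠ 0) (w : E) :
    polarLevi f z (Complex.I • z) w = -2 * fderiv ℝ f z (Complex.I • w) := by
  have h1 := hf.fderiv_fderiv_smul_self 1 hz (Complex.I • w)
  have h2 := hf.fderiv_fderiv_smul_self Complex.I hz w
  simp only [one_smul, Complex.one_re, Complex.I_re] at h1 h2
  rw [polarLevi_apply, I_smul_I_smul, h2, map_neg, neg_apply, h1]
  ring

lemma polarLevi_symm (hz : z ≠ 0) (v w : E) : polarLevi f z v w = polarLevi f z w v := by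
  have h : IsSymmSndFDerivAt ℝ f z :=
    (hf.contDiffAt_two hz).isSymmSndFDerivAt (by simp)
  rw [polarLevi_apply, polarLevi_apply, h v w, h (Complex.I • v)]

/-- Positivity of the Levi form on the complex tangent spaces of the level sets implies positivity
on all vectors. -/
lemma polarLevi_pos (hpos : 0 < f z) (hz : z ≠ 0)
    (h : ∀ w ≠ 0, fderiv ℝ f z w = 0 → fderiv ℝ f z (Complex.I • w) = 0 → 0 < polarLevi f z w w)
    {v : E} (hv : v ≠ 0) : 0 < polarLevi f z v v := by
  -- Split v = u + w with u in the complex line of z and w complex tangent: a and b are chosen so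
  -- that u and v agree under df and df(i ·).
  set a := fderiv ℝ f z v / (2 * f z) with ha
  set b := -fderiv ℝ f z (Complex.I • v) / (2 * f z) with hb
  set u := a • z + b • (Complex.I • z) with hu
  set w := v - u with hw
  have d1 : fderiv ℝ f z z = 2 * f z := by simpa using hf.fderiv_apply_smul_self 1 hz
  have d2 : fderiv ℝ f z (Complex.I • z) = 0 := by simpa using hf.fderiv_apply_smul_self Complex.I hz
  have hIu : Complex.I • u = a • (Complex.I • z) - b • z := by
    rw [hu, smul_add, smul_comm Complex.I a, smul_comm Complex.I b, I_smul_I_smul, smul_neg,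
      sub_eq_add_neg]
  have du : fderiv ℝ f z u = fderiv ℝ f z v := by
    rw [hu, map_add, map_smul, map_smul, d1, d2, ha]
    simp only [smul_eq_mul]
    field_simp
    ring
  have dIu : fderiv ℝ f z (Complex.I • u) = fderiv ℝ f z (Complex.I • v) := by
    rw [hIu, map_sub, (fderiv ℝ f z).map_smul a, (fderiv ℝ f z).map_smul b, d1, d2, hb]
    simp only [smul_eq_mul]
    field_simp
    ring
  have dw : fderiv ℝ f z w = 0 := by rw [hw, map_sub, du, sub_self]
  have dIw : fderiv ℝ f z (Complex.I • w) = 0 := by rw [hw, smul_sub, map_sub, dIu, sub_self]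
  -- The Levi form against u sees only df and df(i ·), so u is orthogonal to w, and u contributes
  -- 4f(a² + b²).
  have Au : ∀ x, polarLevi f z u x = a * (2 * fderiv ℝ f z x) - b * (2 * fderiv ℝ f z (Complex.I • x)) := by
    intro x
    rw [hu, map_add, map_smul, map_smul, add_apply, smul_apply, smul_apply, hf.polarLevi_self hz,
      hf.polarLevi_I_smul_self hz]
    simp only [smul_eq_mul]
    ring
  have hvw : v = u + w := by rw [hw]; abel
  have hAuw : polarLevi f z u w = 0 := by rw [Au, dw, dIw]; ring
  have hAuu : polarLevi f z u u = 4 * f z * (a ^ 2 + b ^ 2) := by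
    rw [Au, du, dIu, show fderiv ℝ f z v = a * (2 * f z) by rw [ha]; field_simp,
      show fderiv ℝ f z (Complex.I • v) = -b * (2 * f z) by rw [hb]; field_simp]
    ring
  have hexp : polarLevi f z v v = 4 * f z * (a ^ 2 + b ^ 2) + polarLevi f z w w := by
    have hsum : ∀ x y : E, polarLevi f z (x + y) (x + y) = polarLevi f z x x + polarLevi f z x y
        + (polarLevi f z y x + polarLevi f z y y) := fun x y => by
      rw [map_add, map_add, add_apply, add_apply]; ring
    rw [hvw, hsum, hf.polarLevi_symm hz w u, hAuw, hAuu]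
    ring
  rw [hexp]
  by_cases hw0 : w = 0
  · have : a ≠ 0 ∨ b ≠ 0 := by
      by_contra! hab
      apply hv
      rw [hvw, hw0, hu, hab.1, hab.2]
      simp
    have hab : 0 < a ^ 2 + b ^ 2 := by
      rcases this with h | h <;> positivity
    rw [hw0]
    simp only [map_zero, add_zero]
    positivity
  · have := h w hw0 dw dIw
    positivity

end IsCircularQuadratic

end Hermitian

/-! ### Minkowski functions of circular domains -/

section Minkowski

variable {n : ℕ} {D : Set (Cn n)}

namespace IsCircularDomain

variable (hD : IsCircularDomain D)
include hD

lemma zero_mem : (0 : Cn n) ∈ D := hD.balanced.zero_mem hD.isConnected.nonempty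

lemma bddAbove_radii {z : Cn n} (hz : z ≠ 0) : BddAbove {s : ℝ | (s : ℂ) • z ∈ D} := by
  obtain ⟨R, hR⟩ := hD.isBounded.subset_closedBall 0
  refine ⟨R / ‖z‖, fun s hs => ?_⟩
  have h1 : ‖(s : ℂ) • z‖ ≤ R := by simpa using hR hs
  rw [norm_smul, Complex.norm_real] at h1
  rw [le_div_iff₀ (norm_pos_iff.2 hz)]
  exact (mul_le_mul_of_nonneg_right (le_abs_self s) (norm_nonneg _)).trans h1

lemma isOpen_radii (z : Cn n) : IsOpen {s : ℝ | (s : ℂ) • z ∈ D} :=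
  hD.isOpen.preimage (f := fun s : ℝ => (s : ℂ) • z) (by fun_prop)

lemma exists_gt_radius (z : Cn n) {s : ℝ} (hs : (s : ℂ) • z ∈ D) :
    ∃ s' > s, (s' : ℂ) • z ∈ D := by
  obtain ⟨ε, hε, h⟩ := Metric.isOpen_iff.1 (hD.isOpen_radii z) s hs
  have hmem : s + ε / 2 ∈ Metric.ball s ε := by
    rw [Metric.mem_ball, Real.dist_eq, add_sub_cancel_left, abs_of_pos] <;> linarith
  exact ⟨s + ε / 2, by linarith, h hmem⟩

lemma sSup_radii_pos {z : Cn n} (hz : z ≠ 0) : 0 < sSup {s : ℝ | (s : ℂ) • z ∈ D} := by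
  obtain ⟨s, hs, h⟩ := hD.exists_gt_radius z (s := 0) (by simpa using hD.zero_mem)
  exact hs.trans_le (le_csSup (hD.bddAbove_radii hz) h)

/-- Balancedness makes the set of radii a symmetric interval; openness excludes its end points. -/
lemma mem_radii_iff {z : Cn n} (hz : z ≠ 0) (s : ℝ) :
    (s : ℂ) • z ∈ D ↔ |s| < sSup {s : ℝ | (s : ℂ) • z ∈ D} := by
  have habs : (s : ℂ) • z ∈ D ↔ ((|s| : ℝ) : ℂ) • z ∈ D :=
    hD.balanced.smul_mem_iff (by simp)
  constructor
  · intro h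
    obtain ⟨s', hs', h'⟩ := hD.exists_gt_radius z (habs.1 h)
    exact hs'.trans_le (le_csSup (hD.bddAbove_radii hz) h')
  · intro h
    have hne : {s : ℝ | (s : ℂ) • z ∈ D}.Nonempty := ⟨0, by simpa using hD.zero_mem⟩
    obtain ⟨s', hs', hlt⟩ := exists_lt_of_lt_csSup hne h
    have h0 : 0 < s' := (abs_nonneg s).trans_lt hlt
    have : ((s / s' : ℝ) : ℂ) • (s' : ℂ) • z ∈ D := by
      refine hD.balanced.smul_mem ?_ hs'
      rw [Complex.norm_real, Real.norm_eq_abs, abs_div, abs_of_pos h0]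
      exact (div_le_one h0).2 hlt.le
    rwa [smul_smul, ← Complex.ofReal_mul, div_mul_cancel₀ _ h0.ne'] at this

end IsCircularDomain

/-- At the origin the set of radii is all of ℝ or empty; `sSup` is 0 in both cases, and 1 / 0 = 0.
-/
lemma minkowski_zero (D : Set (Cn n)) : minkowski D 0 = 0 := by
  rw [minkowski]
  simp only [smul_zero]
  by_cases h : (0 : Cn n) ∈ D
  · simp [h]
  · simp [h]

namespace IsCircularDomain

variable (hD : IsCircularDomain D)
include hD

lemma minkowski_pos {z : Cn n} (hz : z ≠ 0) : 0 < minkowski D z :=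
  one_div_pos.2 (hD.sSup_radii_pos hz)

lemma minkowski_nonneg (z : Cn n) : 0 ≤ minkowski D z := by
  by_cases hz : z = 0
  · rw [hz, minkowski_zero]
  · exact (hD.minkowski_pos hz).le

lemma smul_mem_iff (z : Cn n) (ζ : ℂ) : ζ • z ∈ D ↔ ‖ζ‖ * minkowski D z < 1 := by
  by_cases hz : z = 0
  · simp [hz, minkowski_zero, hD.zero_mem]
  · have h1 : ζ • z ∈ D ↔ ((‖ζ‖ : ℝ) : ℂ) • z ∈ D := hD.balanced.smul_mem_iff (by simp)
    rw [h1, hD.mem_radii_iff hz, minkowski, mul_one_div, div_lt_one (hD.sSup_radii_pos hz),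
      abs_of_nonneg (norm_nonneg _)]

lemma mem_iff (z : Cn n) : z ∈ D ↔ minkowski D z < 1 := by
  simpa using hD.smul_mem_iff z 1

lemma minkowski_smul (ζ : ℂ) (z : Cn n) : minkowski D (ζ • z) = ‖ζ‖ * minkowski D z := by
  have key : ∀ s : ℝ, 0 ≤ s → (s * minkowski D (ζ • z) < 1 ↔ s * (‖ζ‖ * minkowski D z) < 1) := by
    intro s hs
    have h1 := hD.smul_mem_iff (ζ • z) (s : ℂ)
    have h2 := hD.smul_mem_iff z ((s : ℂ) * ζ)
    rw [smul_smul] at h1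
    rw [norm_mul] at h2
    rw [Complex.norm_real, Real.norm_eq_abs, abs_of_nonneg hs] at h1 h2
    rw [← mul_assoc]
    exact h1.symm.trans h2
  -- A nonnegative number is determined by its threshold: if b < a, then s = 1/a separates the two
  -- conditions.
  have hle : ∀ a b : ℝ, 0 ≤ a → 0 ≤ b → (∀ s : ℝ, 0 ≤ s → (s * a < 1 ↔ s * b < 1)) → a ≤ b := by
    intro a b ha hb h
    by_contra! hlt
    have hpos : 0 < a := hb.trans_lt hlt
    have := (h a⁻¹ (by positivity)).2 (by rw [inv_mul_lt_iff₀ hpos]; linarith)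
    rw [inv_mul_cancel₀ hpos.ne'] at this
    exact lt_irrefl _ this
  have n1 := hD.minkowski_nonneg (ζ • z)
  have n2 := mul_nonneg (norm_nonneg ζ) (hD.minkowski_nonneg z)
  exact le_antisymm (hle _ _ n1 n2 key) (hle _ _ n2 n1 fun s hs => (key s hs).symm)

lemma minkowski_real_smul {r : ℝ} (hr : 0 ≤ r) (z : Cn n) :
    minkowski D (r • z) = r * minkowski D z := by
  rw [real_smul_eq, hD.minkowski_smul, Complex.norm_real, Real.norm_eq_abs, abs_of_nonneg hr]

lemma one_le_of_mem_frontier {p : Cn n} (hp : p ∈ frontier D) : 1 ≤ minkowski D p := by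
  rw [hD.isOpen.frontier_eq] at hp
  exact not_lt.1 fun h => hp.2 ((hD.mem_iff p).2 h)

lemma smul_mem_frontier {p : Cn n} (hp : p ∈ frontier D) {ζ : ℂ} (hζ : ‖ζ‖ = 1) :
    ζ • p ∈ frontier D := by
  rw [hD.isOpen.frontier_eq] at hp ⊢
  refine ⟨hD.balanced.closure.smul_mem hζ.le hp.1, fun h => hp.2 ?_⟩
  rw [hD.mem_iff] at h ⊢
  rwa [hD.minkowski_smul, hζ, one_mul] at h

end IsCircularDomain

/-! ### Local defining functions and transversality to the rays -/

section DefiningFunction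

variable {U : Set (Cn n)} {ρ : Cn n → ℝ} (hU : IsOpen U) (hρ : ContDiffOn ℝ ∞ ρ U)
  (hDU : D ∩ U = {z ∈ U | ρ z < 0})
include hU hρ hDU

lemma defining_nonpos_of_mem_closure {z : Cn n} (hz : z ∈ closure D) (hzU : z ∈ U) : ρ z ≤ 0 := by
  by_contra! h
  have hc : ContinuousAt ρ z := hρ.continuousOn.continuousAt (hU.mem_nhds hzU)
  obtain ⟨y, ⟨hy1, hy2⟩, hyD⟩ := mem_closure_iff_nhds.1 hz _
    (inter_mem (hU.mem_nhds hzU) (hc.eventually (lt_mem_nhds h)))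
  have : y ∈ D ∩ U := ⟨hyD, hy1⟩
  rw [hDU] at this
  exact lt_asymm this.2 hy2

lemma defining_eq_zero_of_mem_frontier (hD : IsOpen D) {z : Cn n} (hz : z ∈ frontier D)
    (hzU : z ∈ U) : ρ z = 0 := by
  rw [hD.frontier_eq] at hz
  refine le_antisymm (defining_nonpos_of_mem_closure hU hρ hDU hz.1 hzU) ?_
  by_contra! h
  have : z ∈ D ∩ U := by rw [hDU]; exact ⟨hzU, h⟩
  exact hz.2 this.1

lemma defining_contDiffAt {z : Cn n} (hzU : z ∈ U) : ContDiffAt ℝ ∞ ρ z :=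
  hρ.contDiffAt (hU.mem_nhds hzU)

lemma defining_contDiffAt_two {z : Cn n} (hzU : z ∈ U) : ContDiffAt ℝ 2 ρ z :=
  contDiffAt_infty.1 (defining_contDiffAt hU hρ hDU hzU) 2

/-- The derivatives of a defining function along the circle through a boundary point. -/
lemma defining_deriv_circle (hD : IsCircularDomain D) {p : Cn n} (hp : p ∈ frontier D)
    (hpU : p ∈ U) : fderiv ℝ ρ p (Complex.I • p) = 0 ∧
      fderiv ℝ (fderiv ℝ ρ) p (Complex.I • p) (Complex.I • p) = fderiv ℝ ρ p p := by
  have hexp : ∀ t : ℝ, HasDerivAt (fun t : ℝ => Complex.exp (t * Complex.I))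
      (Complex.exp (t * Complex.I) * Complex.I) t := by
    intro t
    have h1 : HasDerivAt (fun t : ℝ => (t : ℂ) * Complex.I) Complex.I t := by
      simpa using (Complex.ofRealCLM.hasDerivAt (x := t)).mul_const Complex.I
    exact h1.cexp
  have h1 : ∀ t : ℝ, HasDerivAt (fun t : ℝ => Complex.exp (t * Complex.I) • p)
      ((Complex.exp (t * Complex.I) * Complex.I) • p) t := fun t => (hexp t).smul_const p
  have h2 : HasDerivAt (fun t : ℝ => (Complex.exp (t * Complex.I) * Complex.I) • p) (-p) 0 := by
    have := ((hexp 0).mul_const Complex.I).smul_const p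
    simpa [mul_assoc] using this
  have hp0 : Complex.exp (((0 : ℝ) : ℂ) * Complex.I) • p = p := by simp
  obtain ⟨h3, h4⟩ := hasDerivAt_comp_curve (ρ := ρ)
    (γ := fun t : ℝ => Complex.exp (t * Complex.I) • p) (t₀ := 0)
    (by rw [hp0]; exact defining_contDiffAt_two hU hρ hDU hpU) (Eventually.of_forall h1) h2
  have hcont : Continuous fun t : ℝ => Complex.exp (t * Complex.I) • p := by fun_prop
  -- The boundary is invariant under rotations, so ρ vanishes along the circle near p, and with it
  -- the first two derivatives; the acceleration -p of the circle produces the term dρ(p).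
  have hzero : ∀ᶠ t : ℝ in 𝓝 0, ρ (Complex.exp (t * Complex.I) • p) = 0 := by
    have : ∀ᶠ t : ℝ in 𝓝 0, Complex.exp (t * Complex.I) • p ∈ U :=
      hcont.continuousAt.eventually (hU.mem_nhds (by simpa using hpU))
    filter_upwards [this] with t ht
    exact defining_eq_zero_of_mem_frontier hU hρ hDU hD.isOpen
      (hD.smul_mem_frontier hp (Complex.norm_exp_ofReal_mul_I t)) ht
  have hzero' : ∀ᶠ t : ℝ in 𝓝 0, fderiv ℝ ρ (Complex.exp (t * Complex.I) • p)
      ((Complex.exp (t * Complex.I) * Complex.I) • p) = 0 := by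
    filter_upwards [h3, hzero.eventually_nhds] with t ht hz
    exact ht.unique ((hasDerivAt_const t (0 : ℝ)).congr_of_eventuallyEq hz)
  have e1 := hzero'.self_of_nhds
  have e2 := h4.unique ((hasDerivAt_const (0 : ℝ) (0 : ℝ)).congr_of_eventuallyEq hzero')
  simp only [Complex.ofReal_zero, zero_mul, Complex.exp_zero, one_smul, one_mul, map_neg] at e1 e2
  exact ⟨e1, by linarith⟩

/-- A strongly pseudoconvex boundary of a circular domain is transversal to the rays. -/
lemma defining_radial_pos (hD : IsCircularDomain D) {p : Cn n} (hp : p ∈ frontier D) (hpU : p ∈ U)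
    (hlevi : ∀ w : Cn n, w ≠ 0 → fderiv ℝ ρ p w = 0 → fderiv ℝ ρ p (Complex.I • w) = 0 →
      0 < leviForm ρ p w) : 0 < fderiv ℝ ρ p p := by
  obtain ⟨c1, c2⟩ := defining_deriv_circle hU hρ hDU hD hp hpU
  have hp0 : p ≠ 0 := by
    rintro rfl
    have := hD.one_le_of_mem_frontier hp
    rw [minkowski_zero] at this
    linarith
  have hcl : p ∈ closure D := frontier_subset_closure hp
  obtain ⟨h3, h4⟩ := hasDerivAt_comp_line (w := p) (defining_contDiffAt_two hU hρ hDU hpU)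
  -- The closure of D is balanced, so points slightly inside p on its ray stay in the closure.
  have hneg : ∀ᶠ t : ℝ in 𝓝[<] 0, ρ (p + t • p) ≤ 0 := by
    have hcont : Continuous fun t : ℝ => p + t • p := by fun_prop
    have hUe : ∀ᶠ t : ℝ in 𝓝 0, p + t • p ∈ U :=
      hcont.continuousAt.eventually (hU.mem_nhds (by simpa using hpU))
    have h1 : ∀ᶠ t : ℝ in 𝓝 0, -1 < t := lt_mem_nhds (by norm_num)
    filter_upwards [nhdsWithin_le_nhds hUe, nhdsWithin_le_nhds h1, self_mem_nhdsWithin]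
      with t ht h1 h2
    refine defining_nonpos_of_mem_closure hU hρ hDU ?_ ht
    have : p + t • p = ((1 + t : ℝ) : ℂ) • p := by rw [← real_smul_eq, add_smul, one_smul]
    rw [this]
    refine hD.balanced.closure.smul_mem ?_ hcl
    rw [Complex.norm_real, Real.norm_eq_abs, abs_le]
    have h2' : t < 0 := h2
    constructor <;> linarith
  have hρ0 : ρ p = 0 := defining_eq_zero_of_mem_frontier hU hρ hDU hD.isOpen hp hpU
  -- If the radial derivative vanished, p would itself be complex tangent. The circle identity would
  -- then give ρ''(ip, ip) = 0, so Levi positivity would force ρ''(p, p) > 0 and ρ would be positive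
  -- just inside p.
  have hne : fderiv ℝ ρ p p ≠ 0 := by
    intro h0
    have hpos : 0 < fderiv ℝ (fderiv ℝ ρ) p p p := by
      have := hlevi p hp0 h0 c1
      rw [leviForm, c2, h0] at this
      linarith
    -- With this choice, subtracting c t² leaves the second derivative 4c - 2c = 2c > 0.
    set c := fderiv ℝ (fderiv ℝ ρ) p p p / 4 with hc
    -- the function `ρ (p + t p) - c t ^ 2` has a local minimum at `0`
    have g1 : ∀ᶠ t in 𝓝 (0 : ℝ), HasDerivAt (fun s : ℝ => ρ (p + s • p) - c * s ^ 2)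
        (fderiv ℝ ρ (p + t • p) p - c * (2 * t)) t := by
      filter_upwards [h3] with t ht
      have := ht.fun_sub ((hasDerivAt_pow 2 t).const_mul c)
      simpa using this
    have g2 : HasDerivAt (fun t : ℝ => fderiv ℝ ρ (p + t • p) p - c * (2 * t)) (2 * c) 0 := by
      have := h4.sub (((hasDerivAt_id (0 : ℝ)).const_mul 2).const_mul c)
      refine this.congr_deriv ?_
      rw [hc]; ring
    have g3 : deriv (fun s : ℝ => ρ (p + s • p) - c * s ^ 2) =ᶠ[𝓝 0]
        fun t : ℝ => fderiv ℝ ρ (p + t • p) p - c * (2 * t) := by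
      filter_upwards [g1] with t ht using ht.deriv
    have hmin := isLocalMin_of_deriv_deriv_pos (f := fun s : ℝ => ρ (p + s • p) - c * s ^ 2)
      (x₀ := 0) (by rw [g3.deriv_eq, g2.deriv]; positivity)
      (by rw [g3.self_of_nhds]; simp [h0]) g1.self_of_nhds.continuousAt
    have hmin' : ∀ᶠ t : ℝ in 𝓝[<] 0, 0 ≤ ρ (p + t • p) - c * t ^ 2 := by
      filter_upwards [nhdsWithin_le_nhds hmin] with t ht
      simpa [hρ0] using ht
    obtain ⟨t, ht1, ht2, ht3⟩ := (hneg.and (hmin'.and self_mem_nhdsWithin)).exists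
    have ht3' : t ≠ 0 := ne_of_lt ht3
    have : 0 < c * t ^ 2 := by positivity
    linarith
  refine lt_of_le_of_ne ?_ hne.symm
  by_contra! hlt
  have hd : HasDerivAt (fun s : ℝ => ρ (p + s • p)) (fderiv ℝ ρ p p) 0 := by
    simpa using h3.self_of_nhds
  have hslope := hasDerivAt_iff_tendsto_slope.1 hd
  have hev := (hslope.mono_left (nhdsWithin_mono 0 (fun t (ht : t < 0) => ne_of_lt ht))).eventually
    (gt_mem_nhds hlt)
  obtain ⟨t, ht1, ht2, ht3⟩ := (hneg.and (hev.and self_mem_nhdsWithin)).exists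
  rw [slope_def_field] at ht2
  simp only [zero_smul, add_zero, hρ0, sub_zero] at ht2
  have : 0 ≤ ρ (p + t • p) / t := div_nonneg_of_nonpos ht1 (le_of_lt ht3)
  linarith

end DefiningFunction

namespace IsCircularDomain

variable (hD : IsCircularDomain D)
include hD

/-- If the value exceeded 1, the points of the ray just inside p would lie in the closure but not in
D. Then ρ would vanish on a whole radial segment, against its positive radial derivative. -/
lemma minkowski_eq_one_of_mem_frontier {p : Cn n} (hp : p ∈ frontier D) : minkowski D p = 1 := by
  refine le_antisymm ?_ (hD.one_le_of_mem_frontier hp)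
  by_contra! hlt
  obtain ⟨U, ρ, hU, hpU, hρ, hDU, -, hlevi⟩ := hD.boundary p hp
  have hpos := defining_radial_pos hU hρ hDU hD hp hpU hlevi
  have hcl : p ∈ closure D := frontier_subset_closure hp
  obtain ⟨h3, -⟩ := hasDerivAt_comp_line (w := p) (defining_contDiffAt_two hU hρ hDU hpU)
  have hd : HasDerivAt (fun s : ℝ => ρ (p + s • p)) (fderiv ℝ ρ p p) 0 := by
    simpa using h3.self_of_nhds
  have hzero : ∀ᶠ t : ℝ in 𝓝[<] 0, ρ (p + t • p) = 0 := by
    have hcont : Continuous fun t : ℝ => p + t • p := by fun_prop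
    have hUe : ∀ᶠ t : ℝ in 𝓝 0, p + t • p ∈ U :=
      hcont.continuousAt.eventually (hU.mem_nhds (by simpa using hpU))
    have h1 : ∀ᶠ t : ℝ in 𝓝 0, -1 < t := lt_mem_nhds (by norm_num)
    have h2 : ∀ᶠ t : ℝ in 𝓝 0, 1 < (1 + t) * minkowski D p := by
      have : Continuous fun t : ℝ => (1 + t) * minkowski D p := by fun_prop
      exact this.continuousAt.eventually (lt_mem_nhds (by simpa using hlt))
    filter_upwards [nhdsWithin_le_nhds hUe, nhdsWithin_le_nhds h1, nhdsWithin_le_nhds h2,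
      self_mem_nhdsWithin] with t ht h1 h2 h4
    have h4' : t < 0 := h4
    have heq : p + t • p = (1 + t) • p := by rw [add_smul, one_smul]
    refine defining_eq_zero_of_mem_frontier hU hρ hDU hD.isOpen ?_ ht
    rw [hD.isOpen.frontier_eq]
    refine ⟨?_, ?_⟩
    · rw [heq, real_smul_eq]
      refine hD.balanced.closure.smul_mem ?_ hcl
      rw [Complex.norm_real, Real.norm_eq_abs, abs_le]
      constructor <;> linarith
    · rw [hD.mem_iff, heq, hD.minkowski_real_smul (by linarith)]
      exact not_lt.2 h2.le
  have hρ0 : ρ (p + (0 : ℝ) • p) = 0 := by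
    simpa using defining_eq_zero_of_mem_frontier hU hρ hDU hD.isOpen hp hpU
  have h0 : HasDerivWithinAt (fun s : ℝ => ρ (p + s • p)) 0 (Iio 0) 0 :=
    (hasDerivWithinAt_const (0 : ℝ) (Iio 0) (0 : ℝ)).congr_of_eventuallyEq hzero hρ0
  have := (uniqueDiffWithinAt_Iio (0 : ℝ)).eq_deriv _ hd.hasDerivWithinAt h0
  linarith

lemma mem_frontier_iff (p : Cn n) : p ∈ frontier D ↔ minkowski D p = 1 := by
  refine ⟨hD.minkowski_eq_one_of_mem_frontier, fun h => ?_⟩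
  rw [hD.isOpen.frontier_eq]
  refine ⟨?_, fun h' => ((hD.mem_iff p).1 h').ne h⟩
  have hcont : Continuous fun t : ℝ => t • p := by fun_prop
  have h1 : Tendsto (fun t : ℝ => t • p) (𝓝[<] 1) (𝓝 p) := by
    have := (hcont.tendsto 1).mono_left (nhdsWithin_le_nhds (s := Iio 1))
    simpa using this
  refine mem_closure_of_tendsto h1 ?_
  have h2 : ∀ᶠ t : ℝ in 𝓝 1, 0 < t := lt_mem_nhds (by norm_num)
  filter_upwards [nhdsWithin_le_nhds h2, self_mem_nhdsWithin] with t h2 h3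
  rw [hD.mem_iff, hD.minkowski_real_smul h2.le, h, mul_one]
  exact h3

lemma closure_eq : closure D = {z | minkowski D z ≤ 1} := by
  rw [closure_eq_self_union_frontier]
  ext z
  rw [mem_union, hD.mem_iff, hD.mem_frontier_iff, ← le_iff_lt_or_eq]
  rfl

/-- By homogeneity, the positive sublevel and superlevel sets are rescalings of D and of the
complement of its closure; the latter uses that the frontier is exactly the level set 1. -/
lemma continuous_minkowski : Continuous (minkowski D) := by
  have key : ∀ c : ℝ, 0 < c → ∀ z, minkowski D (c⁻¹ • z) = minkowski D z / c := fun c hc z => by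
    rw [hD.minkowski_real_smul (by positivity), div_eq_inv_mul]
  rw [continuous_iff_continuousAt]
  intro z₀
  rw [ContinuousAt, tendsto_order]
  constructor
  · intro a ha
    rcases lt_or_ge a 0 with h | h
    · exact Eventually.of_forall fun z => h.trans_le (hD.minkowski_nonneg z)
    · obtain ⟨b, hb1, hb2⟩ := exists_between ha
      have hb0 : 0 < b := h.trans_lt hb1
      have hopen : IsOpen {z : Cn n | b < minkowski D z} := by
        have : {z : Cn n | b < minkowski D z} = (fun z => b⁻¹ • z) ⁻¹' (closure D)ᶜ := by
          ext z
          rw [hD.closure_eq, mem_preimage, mem_compl_iff, mem_ofPred_eq, mem_ofPred_eq, key b hb0,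
            not_le, one_lt_div hb0]
        rw [this]
        exact isClosed_closure.isOpen_compl.preimage (by fun_prop)
      filter_upwards [hopen.mem_nhds hb2] with z hz using hb1.trans hz
  · intro b hb
    have hb0 : 0 < b := (hD.minkowski_nonneg z₀).trans_lt hb
    have hopen : IsOpen {z : Cn n | minkowski D z < b} := by
      have : {z : Cn n | minkowski D z < b} = (fun z => b⁻¹ • z) ⁻¹' D := by
        ext z
        rw [mem_preimage, hD.mem_iff, key b hb0, div_lt_one hb0]
        rfl
      rw [this]
      exact hD.isOpen.preimage (by fun_prop)
    exact hopen.mem_nhds hb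

end IsCircularDomain

end Minkowski

/-! ### Smoothness of the Minkowski function and positivity of the Levi form of its square -/

namespace IsCircularDomain

variable {n : ℕ} {D : Set (Cn n)} (hD : IsCircularDomain D)
include hD

lemma inv_minkowski_smul_mem_frontier {z : Cn n} (hz : z ≠ 0) :
    (minkowski D z)⁻¹ • z ∈ frontier D := by
  have h := hD.minkowski_pos hz
  rw [hD.mem_frontier_iff, hD.minkowski_real_smul (by positivity), inv_mul_cancel₀ h.ne']

/-- Near z the number s = 1/μ(y) solves ρ(s y) = 0, and the s-derivative is nonzero by
transversality to the rays. Continuity of μ identifies this solution with the branch of the implicit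
function theorem. -/
lemma contDiffAt_inv_minkowski {z : Cn n} (hz : z ≠ 0) :
    ContDiffAt ℝ ∞ (fun y => (minkowski D y)⁻¹) z := by
  have hμ := hD.minkowski_pos hz
  set k := (minkowski D z)⁻¹ with hk
  have hk0 : 0 < k := inv_pos.2 hμ
  have hp := hD.inv_minkowski_smul_mem_frontier hz
  rw [← hk] at hp
  obtain ⟨U, ρ, hU, hpU, hρ, hDU, -, hlevi⟩ := hD.boundary _ hp
  have hpos := defining_radial_pos hU hρ hDU hD hp hpU hlevi
  have hF : ContDiffAt ℝ ∞ (fun v : Cn n × ℝ => ρ (v.2 • v.1)) (z, k) := by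
    refine ContDiffAt.comp (g := ρ) (f := fun v : Cn n × ℝ => v.2 • v.1) (z, k)
      (defining_contDiffAt hU hρ hDU hpU) ?_
    exact contDiffAt_snd.smul contDiffAt_fst
  have hinv : (fderiv ℝ (fun v : Cn n × ℝ => ρ (v.2 • v.1)) (z, k) ∘L
      .inr ℝ (Cn n) ℝ).IsInvertible := by
    have h1 : HasFDerivAt (fun v : Cn n × ℝ => ρ (v.2 • v.1)) _ (z, k) :=
      (hF.differentiableAt (by simp)).hasFDerivAt
    have h2 : HasFDerivAt (fun s : ℝ => ((z, s) : Cn n × ℝ)) (.inr ℝ (Cn n) ℝ) k :=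
      hasFDerivAt_prodMk_right z k
    have h3 := (h1.comp k h2).hasDerivAt
    have h4 : HasDerivAt (fun s : ℝ => ρ (s • z)) (fderiv ℝ ρ (k • z) z) k := by
      refine HasFDerivAt.comp_hasDerivAt k
        ((defining_contDiffAt hU hρ hDU hpU).differentiableAt (by simp)).hasFDerivAt ?_
      simpa using (hasDerivAt_id k).smul_const z
    have h5 := h3.unique h4
    rw [map_smul, smul_eq_mul] at hpos
    have hne : fderiv ℝ ρ (k • z) z ≠ 0 := (pos_of_mul_pos_right hpos hk0.le).ne'
    refine ⟨(LinearEquiv.smulOfNeZero ℝ ℝ _ hne).toContinuousLinearEquiv, ?_⟩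
    ext
    rw [h5]
    simp
  have hev := hF.eventually_apply_eq_iff_implicitFunction (by simp) hinv
  have hsm := hF.contDiffAt_implicitFunction (by simp) hinv
  have hcont : ContinuousAt (fun y => (minkowski D y)⁻¹) z :=
    (hD.continuous_minkowski.continuousAt).inv₀ hμ.ne'
  refine hsm.congr_of_eventuallyEq ?_
  have h1 : Tendsto (fun y => (y, (minkowski D y)⁻¹)) (𝓝 z) (𝓝 (z, k)) :=
    continuousAt_id.prodMk hcont
  have hsmul : Tendsto (fun y => (minkowski D y)⁻¹ • y) (𝓝 z) (𝓝 (k • z)) :=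
    hcont.smul continuousAt_id
  filter_upwards [h1.eventually hev, isOpen_ne.mem_nhds hz, hsmul.eventually (hU.mem_nhds hpU)]
    with y hy hy0 hyU
  refine (hy.1 ?_).symm
  have e1 := defining_eq_zero_of_mem_frontier hU hρ hDU hD.isOpen
    (hD.inv_minkowski_smul_mem_frontier hy0) hyU
  have e2 := defining_eq_zero_of_mem_frontier hU hρ hDU hD.isOpen hp hpU
  exact e1.trans e2.symm

lemma contDiffAt_minkowski {z : Cn n} (hz : z ≠ 0) : ContDiffAt ℝ ∞ (minkowski D) z := by
  have := (hD.contDiffAt_inv_minkowski hz).inv (inv_pos.2 (hD.minkowski_pos hz)).ne'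
  refine this.congr_of_eventuallyEq (Eventually.of_forall fun y => ?_)
  simp

lemma isCircularQuadratic : IsCircularQuadratic fun z => minkowski D z ^ 2 where
  contDiffAt _ hz := (hD.contDiffAt_minkowski hz).pow 2
  apply_smul ζ z := by rw [hD.minkowski_smul, mul_pow]

/-- The Levi form of the square of the Minkowski function is positive definite. -/
lemma polarLevi_minkowski_pos {z : Cn n} (hz : z ≠ 0) {v : Cn n} (hv : v ≠ 0) :
    0 < polarLevi (fun z => minkowski D z ^ 2) z v v := by
  have hμ := hD.minkowski_pos hz
  refine hD.isCircularQuadratic.polarLevi_pos (by positivity) hz (fun w hw hw1 hw2 => ?_) hv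
  set k := (minkowski D z)⁻¹ with hk
  have hk0 : 0 < k := inv_pos.2 hμ
  have hp := hD.inv_minkowski_smul_mem_frontier hz
  rw [← hk] at hp
  obtain ⟨U, ρ, hU, hpU, hρ, hDU, -, hlevi⟩ := hD.boundary _ hp
  have hpos := defining_radial_pos hU hρ hDU hD hp hpU hlevi
  rw [map_smul, smul_eq_mul] at hpos
  have hpos' : 0 < fderiv ℝ ρ (k • z) z := pos_of_mul_pos_right hpos hk0.le
  have hκ : ContDiffAt ℝ 2 (fun y => (minkowski D y)⁻¹) z :=
    contDiffAt_infty.1 (hD.contDiffAt_inv_minkowski hz) 2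
  have hf : ContDiffAt ℝ 2 (fun z => minkowski D z ^ 2) z := hD.isCircularQuadratic.contDiffAt_two hz
  -- second derivatives along a tangential line
  have key : ∀ w : Cn n, fderiv ℝ (fun z => minkowski D z ^ 2) z w = 0 →
      fderiv ℝ ρ (k • z) w = 0 ∧
      fderiv ℝ (fderiv ℝ (fun z => minkowski D z ^ 2)) z w w * fderiv ℝ ρ (k • z) z
        = 2 * k⁻¹ * fderiv ℝ (fderiv ℝ ρ) (k • z) w w := by
    intro w hw
    have hline : ∀ t : ℝ, HasDerivAt (fun s : ℝ => z + s • w) w t := fun t => by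
      simpa using ((hasDerivAt_id t).smul_const w).const_add z
    have hlc : Continuous fun s : ℝ => z + s • w := by fun_prop
    obtain ⟨f1, f2⟩ := hasDerivAt_comp_line (w := w) hf
    obtain ⟨κ1, κ2⟩ := hasDerivAt_comp_line (w := w) hκ
    -- Write κ = 1/μ; a and c are its first two derivatives along the line. Both μ² = κ⁻² and the
    -- boundary curve κ(z + tw)(z + tw), on which ρ = 0, are expressed through κ.
    set a : ℝ → ℝ := fun t => fderiv ℝ (fun y => (minkowski D y)⁻¹) (z + t • w) w with ha
    set c := fderiv ℝ (fderiv ℝ (fun y => (minkowski D y)⁻¹)) z w w with hc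
    have hz0 : z + (0 : ℝ) • w = z := by simp
    have hne : ∀ᶠ t : ℝ in 𝓝 0, z + t • w ≠ 0 :=
      hlc.continuousAt.eventually_ne (by simpa using hz)
    -- `minkowski ^ 2` as a function of the inverse
    have hinv : ContDiffAt ℝ 2 (fun x : ℝ => (x ^ 2)⁻¹) k :=
      (contDiffAt_id.pow 2).inv (by positivity)
    obtain ⟨g1, g2⟩ := hasDerivAt_comp_curve (ρ := fun x : ℝ => (x ^ 2)⁻¹)
      (γ := fun t : ℝ => (minkowski D (z + t • w))⁻¹) (t₀ := 0) (by simpa using hinv) κ1 κ2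
    have hd : ∀ x : ℝ, fderiv ℝ (fun x : ℝ => (x ^ 2)⁻¹) k x = - 2 * (k ^ 3)⁻¹ * x := by
      intro x
      have h1 := (hasDerivAt_pow 2 k).fun_inv (by positivity)
      rw [h1.hasFDerivAt.fderiv]
      simp only [ContinuousLinearMap.toSpanSingleton_apply, smul_eq_mul]
      field_simp
      simp
      ring
    have hfg : (fun t : ℝ => minkowski D (z + t • w) ^ 2)
        = fun t : ℝ => (((minkowski D (z + t • w))⁻¹) ^ 2)⁻¹ := by
      ext t; rw [inv_pow, inv_inv]
    have hderiv : ∀ᶠ t in 𝓝 (0 : ℝ), fderiv ℝ (fun z => minkowski D z ^ 2) (z + t • w) w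
        = fderiv ℝ (fun x : ℝ => (x ^ 2)⁻¹) ((minkowski D (z + t • w))⁻¹) (a t) := by
      filter_upwards [f1, g1] with t ht1 ht2
      rw [hfg] at ht1
      exact ht1.unique ht2
    have hk' : (minkowski D (z + (0 : ℝ) • w))⁻¹ = k := by rw [hz0]
    -- Tangency of w to the level set kills the first-order terms, so that both second derivatives
    -- become multiples of c.
    have ha0 : a 0 = 0 := by
      have := hderiv.self_of_nhds
      rw [hz0, hw, hd] at this
      have h3 : (k ^ 3)⁻¹ ≠ 0 := by positivity
      have : (k ^ 3)⁻¹ * a 0 = 0 := by linarith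
      exact (mul_eq_zero.1 this).resolve_left h3
    have hf2 : fderiv ℝ (fderiv ℝ (fun z => minkowski D z ^ 2)) z w w = -2 * (k ^ 3)⁻¹ * c := by
      have := f2.unique (g2.congr_of_eventuallyEq hderiv)
      rw [this, hk']
      change fderiv ℝ (fderiv ℝ fun x : ℝ => (x ^ 2)⁻¹) k (a 0) (a 0) + _ = _
      rw [ha0, map_zero, zero_add, hd]
    -- the boundary curve
    have γ1 : ∀ᶠ t in 𝓝 (0 : ℝ), HasDerivAt
        (fun t : ℝ => (minkowski D (z + t • w))⁻¹ • (z + t • w))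
        ((minkowski D (z + t • w))⁻¹ • w + a t • (z + t • w)) t := by
      filter_upwards [κ1] with t ht using ht.smul (hline t)
    have γ2 : HasDerivAt (fun t : ℝ => (minkowski D (z + t • w))⁻¹ • w + a t • (z + t • w))
        (c • z) 0 := by
      have := (κ1.self_of_nhds.smul_const w).fun_add (κ2.fun_smul (hline 0))
      refine this.congr_deriv ?_
      change a 0 • w + (a 0 • w + c • (z + (0 : ℝ) • w)) = c • z
      rw [ha0, hz0]; simp
    obtain ⟨r1, r2⟩ := hasDerivAt_comp_curve (ρ := ρ)
      (γ := fun t : ℝ => (minkowski D (z + t • w))⁻¹ • (z + t • w)) (t₀ := 0)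
      (by simpa using defining_contDiffAt_two hU hρ hDU hpU) γ1 γ2
    have hcont : ContinuousAt (fun t : ℝ => (minkowski D (z + t • w))⁻¹ • (z + t • w)) 0 :=
      γ1.self_of_nhds.continuousAt
    have hzero : ∀ᶠ t : ℝ in 𝓝 0, ρ ((minkowski D (z + t • w))⁻¹ • (z + t • w)) = 0 := by
      filter_upwards [hcont.eventually (hU.mem_nhds (by simpa using hpU)), hne] with t ht ht0
      exact defining_eq_zero_of_mem_frontier hU hρ hDU hD.isOpen
        (hD.inv_minkowski_smul_mem_frontier ht0) ht
    have hzero' : ∀ᶠ t : ℝ in 𝓝 0, fderiv ℝ ρ ((minkowski D (z + t • w))⁻¹ • (z + t • w))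
        ((minkowski D (z + t • w))⁻¹ • w + a t • (z + t • w)) = 0 := by
      filter_upwards [r1, hzero.eventually_nhds] with t ht hz
      exact ht.unique ((hasDerivAt_const t (0 : ℝ)).congr_of_eventuallyEq hz)
    have e1 := hzero'.self_of_nhds
    have e2 := r2.unique ((hasDerivAt_const (0 : ℝ) (0 : ℝ)).congr_of_eventuallyEq hzero')
    rw [hk', ha0, hz0, zero_smul, add_zero] at e1 e2
    simp only [map_smul, smul_eq_mul, smul_apply] at e1 e2
    refine ⟨(mul_eq_zero.1 e1).resolve_left hk0.ne', ?_⟩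
    rw [hf2]
    field_simp
    linarith
  -- Adding the identities for w and iw shows that the two Levi forms agree on w up to a positive
  -- factor.
  obtain ⟨a1, a2⟩ := key w hw1
  obtain ⟨b1, b2⟩ := key _ hw2
  have hl := hlevi w hw a1 b1
  rw [leviForm] at hl
  have hsum : polarLevi (fun z => minkowski D z ^ 2) z w w * fderiv ℝ ρ (k • z) z
      = 2 * k⁻¹ * (fderiv ℝ (fderiv ℝ ρ) (k • z) w w +
        fderiv ℝ (fderiv ℝ ρ) (k • z) (Complex.I • w) (Complex.I • w)) := by
    rw [polarLevi_apply]
    linarith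
  have hpos2 : 0 < polarLevi (fun z => minkowski D z ^ 2) z w w * fderiv ℝ ρ (k • z) z := by
    rw [hsum]
    have : 0 < fderiv ℝ (fderiv ℝ ρ) (k • z) w w +
        fderiv ℝ (fderiv ℝ ρ) (k • z) (Complex.I • w) (Complex.I • w) := by linarith
    positivity
  exact pos_of_mul_pos_left hpos2 hpos'.le

end IsCircularDomain

end Circular

/-- The unit interval. -/
local notation "𝕀" => Icc (0 : ℝ) 1

namespace Circular

open Filter ParametricODE
open scoped NNReal

set_option linter.unusedSectionVars false

/-! ### Flows of homogeneous vector fields -/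

section HomogeneousFlow

variable {E : Type} [NormedAddCommGroup E] [NormedSpace ℝ E] [NormedSpace ℂ E]
  [IsScalarTower ℝ ℂ E]

lemma fderiv_homogeneous {h : E → E} (hh : ∀ (r : ℝ) (z : E), h (r • z) = r • h z) {z : E}
    (hd : DifferentiableAt ℝ h z) {r : ℝ} (hr : r ≠ 0) : fderiv ℝ h (r • z) = fderiv ℝ h z := by
  have h1 : h = fun y => r • h (r⁻¹ • y) := by
    ext y; rw [← hh, smul_inv_smul₀ hr]
  have h2 : HasFDerivAt (fun y : E => r⁻¹ • y) (r⁻¹ • ContinuousLinearMap.id ℝ E) (r • z) :=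
    (hasFDerivAt_id (r • z)).const_smul r⁻¹
  have h3 : HasFDerivAt h (fderiv ℝ h z) (r⁻¹ • r • z) := by
    rw [inv_smul_smul₀ hr]; exact hd.hasFDerivAt
  have h4 := (h3.comp (r • z) h2).const_smul r
  have h5 : HasFDerivAt h _ (r • z) := h4.congr_of_eventuallyEq (Eventually.of_forall fun y => by
    rw [h1]; simp [hh, smul_inv_smul₀ hr])
  rw [h5.fderiv]
  ext v
  simp [smul_inv_smul₀ hr]

/-- On segments missing 0 this is the mean value inequality. On segments through 0, Euler's identity
h(z) = dh_z(z) bounds each end by C‖z‖, and ‖x‖ + ‖y‖ = ‖x - y‖. No differentiability at 0 is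
needed. -/
lemma norm_sub_le_of_homogeneous {h : E → E} (hh : ∀ (r : ℝ) (z : E), h (r • z) = r • h z) {C : ℝ}
    (hd : ∀ z ≠ 0, DifferentiableAt ℝ h z) (hC : ∀ z ≠ 0, ‖fderiv ℝ h z‖ ≤ C) (x y : E) :
    ‖h x - h y‖ ≤ C * ‖x - y‖ := by
  have h0 : h 0 = 0 := by simpa using hh 0 0
  have hbound : ∀ z, ‖h z‖ ≤ C * ‖z‖ := by
    intro z
    by_cases hz : z = 0
    · simp [hz, h0]
    · have h1 : HasDerivAt (fun r : ℝ => h (r • z)) (fderiv ℝ h z z) 1 := by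
        refine HasFDerivAt.comp_hasDerivAt (1 : ℝ) (l := h) (f := fun r : ℝ => r • z) ?_ ?_
        · rw [one_smul]; exact (hd z hz).hasFDerivAt
        · simpa using (hasDerivAt_id (1 : ℝ)).smul_const z
      have h2 : HasDerivAt (fun r : ℝ => h (r • z)) (h z) 1 := by
        simp only [hh]
        simpa using (hasDerivAt_id (1 : ℝ)).smul_const (h z)
      rw [h2.unique h1]
      exact (ContinuousLinearMap.le_opNorm _ _).trans (by gcongr; exact hC z hz)
  by_cases hseg : (0 : E) ∈ segment ℝ x y
  · have h1 := dist_add_dist_of_mem_segment hseg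
    rw [dist_zero_right, dist_zero_left, dist_eq_norm] at h1
    calc ‖h x - h y‖ ≤ ‖h x‖ + ‖h y‖ := norm_sub_le _ _
      _ ≤ C * ‖x‖ + C * ‖y‖ := add_le_add (hbound x) (hbound y)
      _ = C * ‖x - y‖ := by rw [← h1]; ring
  · have hne : ∀ z ∈ segment ℝ x y, z ≠ 0 := fun z hz h => hseg (h ▸ hz)
    have := (convex_segment x y).norm_image_sub_le_of_norm_hasFDerivWithin_le (f := h)
      (fun z hz => (hd z (hne z hz)).hasFDerivAt.hasFDerivWithinAt) (fun z hz => hC z (hne z hz))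
      (right_mem_segment ℝ x y) (left_mem_segment ℝ x y)
    exact this

/-- A smooth family, parametrized by `τ ∈ [0, 1]`, of time-dependent vector fields on `E ∖ {0}`
which are homogeneous under multiplication by complex numbers. -/
structure IsHomogeneousField (Y : ℝ → ℝ → E → E) : Prop where
  contDiffOn : ContDiffOn ℝ ∞ (fun q : (ℝ × ℝ) × E => Y q.1.1 q.1.2 q.2)
    ((𝕀 ×ˢ 𝕀) ×ˢ {z : E | z ≠ 0})
  apply_smul : ∀ s ∈ 𝕀, ∀ τ ∈ 𝕀, ∀ (ζ : ℂ) (z : E), Y s τ (ζ • z) = ζ • Y s τ z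

/-- The field whose integral curves are the time-reversed integral curves of `Y`. -/
def reverseField (Y : ℝ → ℝ → E → E) (s τ : ℝ) (z : E) : E := -Y (1 - s) τ z

lemma one_sub_mem_Icc {s : ℝ} (hs : s ∈ 𝕀) : 1 - s ∈ 𝕀 := ⟨by linarith [hs.2], by linarith [hs.1]⟩

lemma isIntegralCurveOn_reverse {Y : ℝ → E → E} {γ : ℝ → E} (h : IsIntegralCurveOn γ Y 𝕀) :
    IsIntegralCurveOn (fun s => γ (1 - s)) (fun s x => -Y (1 - s) x) 𝕀 := by
  intro s hs
  have h1 : HasDerivWithinAt (fun s : ℝ => 1 - s) (-1) 𝕀 s := by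
    simpa using ((hasDerivAt_id s).const_sub 1).hasDerivWithinAt
  have := (h (1 - s) (one_sub_mem_Icc hs)).scomp s h1 fun t ht => one_sub_mem_Icc ht
  rw [neg_one_smul] at this
  exact this

namespace IsHomogeneousField

variable {Y : ℝ → ℝ → E → E} (hY : IsHomogeneousField Y)
include hY

lemma real_smul {s τ : ℝ} (hs : s ∈ 𝕀) (hτ : τ ∈ 𝕀) (r : ℝ) (z : E) :
    Y s τ (r • z) = r • Y s τ z := by
  rw [real_smul_eq, real_smul_eq, hY.apply_smul s hs τ hτ]

lemma apply_zero {s τ : ℝ} (hs : s ∈ 𝕀) (hτ : τ ∈ 𝕀) : Y s τ 0 = 0 := by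
  simpa using hY.apply_smul s hs τ hτ 0 0

lemma reverse : IsHomogeneousField (reverseField Y) where
  contDiffOn := by
    have h1 : ContDiff ℝ ∞ fun q : (ℝ × ℝ) × E => (((1 - q.1.1, q.1.2), q.2) : (ℝ × ℝ) × E) := by
      fun_prop
    exact (hY.contDiffOn.comp h1.contDiffOn
      fun q hq => ⟨⟨one_sub_mem_Icc hq.1.1, hq.1.2⟩, hq.2⟩).neg
  apply_smul s hs τ hτ ζ z := by
    simp only [reverseField]
    rw [hY.apply_smul _ (one_sub_mem_Icc hs) τ hτ, smul_neg]

lemma exists_partial : ∃ DY : (ℝ × ℝ) × E → E →L[ℝ] E,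
    ContinuousOn DY ((𝕀 ×ˢ 𝕀) ×ˢ {z : E | z ≠ 0}) ∧
      ∀ s ∈ 𝕀, ∀ τ ∈ 𝕀, ∀ z ≠ 0, HasFDerivAt (Y s τ) (DY ((s, τ), z)) z := by
  have hI : UniqueDiffOn ℝ 𝕀 := uniqueDiffOn_Icc zero_lt_one
  have hO : IsOpen {z : E | z ≠ 0} := isOpen_ne
  obtain ⟨DY, h1, h2⟩ := contDiffOn_snd_partial (n := 0)
    (by simpa using contDiffOn_infty.1 hY.contDiffOn 1) (hI.prod hI) hO.uniqueDiffOn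
  exact ⟨DY, h1.continuousOn, fun s hs τ hτ z hz =>
    (h2 (s, τ) ⟨hs, hτ⟩ z hz).hasFDerivAt (hO.mem_nhds hz)⟩

/-- The spatial derivative is homogeneous of degree 0, so its supremum over the compact product of
the two time intervals and the unit sphere bounds it everywhere off 0. -/
lemma exists_lipschitz [FiniteDimensional ℝ E] :
    ∃ K : ℝ≥0, ∀ s ∈ 𝕀, ∀ τ ∈ 𝕀, LipschitzWith K (Y s τ) := by
  obtain ⟨DY, h1, h2⟩ := hY.exists_partial
  have : ProperSpace E := FiniteDimensional.proper ℝ E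
  have hcomp : IsCompact ((𝕀 ×ˢ 𝕀) ×ˢ Metric.sphere (0 : E) 1) :=
    (isCompact_Icc.prod isCompact_Icc).prod (isCompact_sphere 0 1)
  obtain ⟨C, hC⟩ := hcomp.exists_bound_of_continuousOn
    (h1.mono (prod_mono_right fun z hz => Metric.ne_of_mem_sphere hz one_ne_zero))
  refine ⟨C.toNNReal, fun s hs τ hτ => LipschitzWith.of_dist_le_mul fun x y => ?_⟩
  rw [dist_eq_norm, dist_eq_norm]
  refine norm_sub_le_of_homogeneous (hY.real_smul hs hτ)
    (fun z hz => (h2 s hs τ hτ z hz).differentiableAt) (fun z hz => ?_) x y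
  have hz' : 0 < ‖z‖ := norm_pos_iff.2 hz
  rw [← fderiv_homogeneous (hY.real_smul hs hτ) (h2 s hs τ hτ z hz).differentiableAt
    (inv_ne_zero hz'.ne')]
  have hmem : ‖z‖⁻¹ • z ∈ Metric.sphere (0 : E) 1 := by
    rw [mem_sphere_zero_iff_norm, norm_smul, norm_inv, norm_norm, inv_mul_cancel₀ hz'.ne']
  have hne : ‖z‖⁻¹ • z ≠ 0 := Metric.ne_of_mem_sphere hmem one_ne_zero
  rw [(h2 s hs τ hτ _ hne).fderiv]
  exact (hC ((s, τ), ‖z‖⁻¹ • z) ⟨⟨hs, hτ⟩, hmem⟩).trans (Real.le_coe_toNNReal C)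

lemma continuousOn_univ [FiniteDimensional ℝ E] :
    ContinuousOn (fun q : (ℝ × ℝ) × E => Y q.1.1 q.1.2 q.2) ((𝕀 ×ˢ 𝕀) ×ˢ univ) := by
  obtain ⟨K, hK⟩ := hY.exists_lipschitz
  rintro ⟨⟨s, τ⟩, z⟩ ⟨hst, -⟩
  by_cases hz : z = 0
  · subst hz
    rw [ContinuousWithinAt, hY.apply_zero hst.1 hst.2]
    refine squeeze_zero_norm' (a := fun q => K * ‖q.2‖) ?_ ?_
    · filter_upwards [self_mem_nhdsWithin] with q hq
      have := (hK q.1.1 hq.1.1 q.1.2 hq.1.2).dist_le_mul q.2 0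
      rwa [hY.apply_zero hq.1.1 hq.1.2, dist_zero_right, dist_zero_right] at this
    · have : Continuous fun q : (ℝ × ℝ) × E => K * ‖q.2‖ := by fun_prop
      have := (this.tendsto ((s, τ), 0)).mono_left
        (nhdsWithin_le_nhds (s := (𝕀 ×ˢ 𝕀) ×ˢ univ))
      simpa using this
  · have h1 := hY.contDiffOn.continuousOn ((s, τ), z) ⟨hst, hz⟩
    refine h1.mono_of_mem_nhdsWithin ?_
    have : {q : (ℝ × ℝ) × E | q.2 ≠ 0} ∈ 𝓝 ((s, τ), z) :=
      (isOpen_ne.preimage continuous_snd).mem_nhds hz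
    filter_upwards [self_mem_nhdsWithin, mem_nhdsWithin_of_mem_nhds this] with q h1 h2
      using ⟨h1.1, h2⟩

/-- Integral curves of a homogeneous field through nonzero vectors never reach zero. -/
lemma ne_zero_of_isIntegralCurveOn [FiniteDimensional ℝ E] {τ : ℝ} (hτ : τ ∈ 𝕀) {γ : ℝ → E}
    (hγ : IsIntegralCurveOn γ (fun s => Y s τ) 𝕀) (h0 : γ 0 ≠ 0) {s : ℝ} (hs : s ∈ 𝕀) :
    γ s ≠ 0 := by
  obtain ⟨K, hK⟩ := hY.exists_lipschitz
  intro h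
  have hzero : IsIntegralCurveOn (fun _ => (0 : E)) (fun s => Y s τ) 𝕀 := by
    intro t ht
    simp only [hY.apply_zero ht hτ]
    exact hasDerivWithinAt_const _ _ _
  exact h0 (isIntegralCurveOn_unique (fun s hs => hK s hs τ hτ) hγ hzero hs h
    (left_mem_Icc.2 zero_le_one))

/-- The flow of a homogeneous field. -/
theorem exists_flow [FiniteDimensional ℝ E] : ∃ Φ : ℝ → ℝ → E → E, (∀ τ z, Φ 0 τ z = z) ∧
    (∀ τ ∈ 𝕀, ∀ z, IsIntegralCurveOn (fun s => Φ s τ z) (fun s => Y s τ) 𝕀) ∧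
    (∀ s ∈ 𝕀, ∀ τ ∈ 𝕀, ∀ (ζ : ℂ) z, Φ s τ (ζ • z) = ζ • Φ s τ z) ∧
    (∀ s ∈ 𝕀, ∀ τ ∈ 𝕀, ∀ z ≠ 0, Φ s τ z ≠ 0) ∧
    ∀ s ∈ 𝕀, ContDiffOn ℝ ∞ (fun q : ℝ × E => Φ s q.1 q.2) (𝕀 ×ˢ {z : E | z ≠ 0}) := by
  obtain ⟨K, hK⟩ := hY.exists_lipschitz
  have : CompleteSpace E := FiniteDimensional.complete ℝ E
  have hcont := hY.continuousOn_univ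
  have hex : ∀ (τ : ℝ) (z : E), ∃ α : ℝ → E, α 0 = z ∧
      (τ ∈ 𝕀 → IsIntegralCurveOn α (fun s => Y s τ) 𝕀) := by
    intro τ z
    by_cases hτ : τ ∈ 𝕀
    · obtain ⟨α, h0, hα⟩ := exists_isIntegralCurveOn_Icc (fun s hs => hK s hs τ hτ)
        (fun x => hcont.comp (f := fun s : ℝ => ((s, τ), x)) (by fun_prop)
          fun s hs => ⟨⟨hs, hτ⟩, mem_univ _⟩) z
      exact ⟨α, h0, fun _ => hα⟩
    · exact ⟨fun _ => z, rfl, fun h => absurd h hτ⟩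
  choose α h0 hα using hex
  have hne : ∀ s ∈ 𝕀, ∀ τ ∈ 𝕀, ∀ z ≠ 0, α τ z s ≠ 0 := fun s hs τ hτ z hz =>
    hY.ne_zero_of_isIntegralCurveOn hτ (hα τ z hτ) (by rwa [h0]) hs
  refine ⟨fun s τ z => α τ z s, h0, fun τ hτ z => hα τ z hτ, ?_, hne, ?_⟩
  · intro s hs τ hτ ζ z
    -- A complex multiple of an integral curve is again one, so uniqueness makes the flow
    -- homogeneous.
    have h1 : IsIntegralCurveOn (fun s => ζ • α τ z s) (fun s => Y s τ) 𝕀 := by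
      intro t ht
      simp only [hY.apply_smul t ht τ hτ]
      exact (hα τ z hτ t ht).const_smul ζ
    exact isIntegralCurveOn_unique (fun s hs => hK s hs τ hτ) (hα τ (ζ • z) hτ) h1
      (left_mem_Icc.2 zero_le_one) (by simp only [h0]) hs
  · rintro s hs ⟨τ₀, z₀⟩ ⟨hτ₀, hz₀⟩
    have hz₀' : 0 < ‖z₀‖ := norm_pos_iff.2 hz₀
    -- Smooth dependence is available over convex sets; E ∖ {0} is not convex, but this ball is and
    -- misses 0.
    set B := Metric.ball z₀ ‖z₀‖ with hB
    have hB0 : ∀ z ∈ B, z ≠ 0 := by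
      rintro z hz rfl
      rw [hB, Metric.mem_ball, dist_zero_left] at hz
      exact lt_irrefl _ hz
    have hI : UniqueDiffOn ℝ 𝕀 := uniqueDiffOn_Icc zero_lt_one
    have hφc : ContinuousOn (fun q : ℝ × (ℝ × E) => α q.2.1 q.2.2 q.1) (𝕀 ×ˢ (𝕀 ×ˢ B)) := by
      refine continuousOn_of_lipschitz (X := fun s (p : ℝ × E) => Y s p.1)
        (φ := fun s (p : ℝ × E) => α p.1 p.2 s) ?_ ?_ (fun p hp => hα p.1 p.2 hp.1) ?_
      · exact hcont.comp (f := fun q : ℝ × (ℝ × E) × E => ((q.1, q.2.1.1), q.2.2)) (by fun_prop)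
          fun q hq => ⟨⟨hq.1, hq.2.1.1⟩, mem_univ _⟩
      · refine fun p _ => ⟨K, ?_⟩
        filter_upwards [self_mem_nhdsWithin] with p hp s hs using hK s hs p.1 hp.1
      · simp only [h0]; exact continuousOn_snd
    have key := contDiffOn_solution (P := ℝ × E) (S := 𝕀 ×ˢ B) (U := {z : E | z ≠ 0})
      (f := fun q => Y q.1 q.2.1.1 q.2.2) (φ := fun s p => α p.1 p.2 s)
      ((convex_Icc 0 1).prod (convex_ball _ _)) (hI.prod Metric.isOpen_ball.uniqueDiffOn) isOpen_ne
      (by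
        have h1 : ContDiff ℝ ∞ fun q : ℝ × ((ℝ × E) × E) => ((q.1, q.2.1.1), q.2.2) := by fun_prop
        exact hY.contDiffOn.comp h1.contDiffOn fun q hq => ⟨⟨hq.1, hq.2.1.1⟩, hq.2.2⟩)
      (fun s hs p hp => hne s hs p.1 hp.1 p.2 (hB0 p.2 hp.2)) hφc
      (fun p hp => hα p.1 p.2 hp.1) (by simp only [h0]; exact contDiffOn_snd) hs
    refine (key (τ₀, z₀) ⟨hτ₀, Metric.mem_ball_self hz₀'⟩).mono_of_mem_nhdsWithin ?_
    have : {q : ℝ × E | q.2 ∈ B} ∈ 𝓝 (τ₀, z₀) :=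
      (Metric.isOpen_ball.preimage continuous_snd).mem_nhds (Metric.mem_ball_self hz₀')
    filter_upwards [self_mem_nhdsWithin, mem_nhdsWithin_of_mem_nhds this] with q h1 h2
      using ⟨h1.1, h2⟩

/-- The variational equation for the flow of a homogeneous field. -/
theorem hasFDerivAt_flow [FiniteDimensional ℝ E] {Φ : ℝ → ℝ → E → E} (h0 : ∀ τ z, Φ 0 τ z = z)
    (hΦ : ∀ τ ∈ 𝕀, ∀ z, IsIntegralCurveOn (fun s => Φ s τ z) (fun s => Y s τ) 𝕀)
    {τ : ℝ} (hτ : τ ∈ 𝕀) {z : E} (hz : z ≠ 0) (h : E) :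
    ∃ W : ℝ → E, W 0 = h ∧ (∀ s ∈ 𝕀, W s = fderiv ℝ (Φ s τ) z h) ∧
      (∀ s ∈ 𝕀, DifferentiableAt ℝ (Φ s τ) z) ∧
      ∀ s ∈ 𝕀, HasDerivWithinAt W (fderiv ℝ (Y s τ) (Φ s τ z) (W s)) 𝕀 s := by
  obtain ⟨K, hK⟩ := hY.exists_lipschitz
  have : CompleteSpace E := FiniteDimensional.complete ℝ E
  obtain ⟨DY, hDY, hDY'⟩ := hY.exists_partial
  have hcont := hY.continuousOn_univ
  have hne : ∀ s ∈ 𝕀, ∀ τ ∈ 𝕀, ∀ z ≠ 0, Φ s τ z ≠ 0 := fun s hs τ hτ z hz =>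
    hY.ne_zero_of_isIntegralCurveOn hτ (hΦ τ hτ z) (by rwa [h0]) hs
  have hz' : 0 < ‖z‖ := norm_pos_iff.2 hz
  set B := Metric.ball z ‖z‖ with hB
  have hzB : z ∈ B := Metric.mem_ball_self hz'
  have hB0 : ∀ z ∈ B, z ≠ 0 := by
    rintro z hz rfl
    rw [hB, Metric.mem_ball, dist_zero_left] at hz
    exact lt_irrefl _ hz
  have hφc : ContinuousOn (fun q : ℝ × E => Φ q.1 τ q.2) (𝕀 ×ˢ B) := by
    refine continuousOn_of_lipschitz (X := fun s (_ : E) => Y s τ)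
      (φ := fun s p => Φ s τ p) ?_ (fun p _ => ⟨K, ?_⟩) (fun p hp => hΦ τ hτ p) ?_
    · exact hcont.comp (f := fun q : ℝ × E × E => ((q.1, τ), q.2.2)) (by fun_prop)
        fun q hq => ⟨⟨hq.1, hτ⟩, mem_univ _⟩
    · exact Eventually.of_forall fun p s hs => hK s hs τ hτ
    · simp only [h0]; exact continuousOn_id
  obtain ⟨W, hW0, hW, -, hWd⟩ := exists_variational_solution (P := E) (S := B)
    (U := {z : E | z ≠ 0}) (f := fun s q => Y s τ q.2)
    (Df := fun s q => DY ((s, τ), q.2) ∘L ContinuousLinearMap.snd ℝ E E)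
    (φ := fun s p => Φ s τ p) (g' := fun _ => ContinuousLinearMap.id ℝ E)
    (convex_ball _ _) isOpen_ne
    (fun s hs q hq => ((hDY' s hs τ hτ q.2 hq.2).comp q hasFDerivAt_snd).hasFDerivWithinAt)
    (by
      refine ContinuousOn.clm_comp ?_ continuousOn_const
      exact hDY.comp (f := fun q : ℝ × (E × E) => ((q.1, τ), q.2.2)) (by fun_prop)
        fun q hq => ⟨⟨hq.1, hτ⟩, hq.2.2⟩)
    (fun s hs p hp => hne s hs τ hτ p (hB0 p hp)) hφc (fun p hp => hΦ τ hτ p)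
    (fun p _ => by simp only [h0]; exact hasFDerivWithinAt_id p B) continuousOn_const
  have hWd' : ∀ s ∈ 𝕀, HasFDerivAt (Φ s τ) (W s z) z := fun s hs =>
    (hWd s hs z hzB).hasFDerivAt (Metric.isOpen_ball.mem_nhds hzB)
  refine ⟨fun s => W s z h, by simp only [hW0]; rfl, fun s hs => by rw [(hWd' s hs).fderiv],
    fun s hs => (hWd' s hs).differentiableAt, fun s hs => ?_⟩
  have := (hW z hzB s hs).clm_apply (hasDerivWithinAt_const s 𝕀 h)
  rw [(hDY' s hs τ hτ _ (hne s hs τ hτ z hz)).fderiv]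
  simpa [variationalField_apply] using this

/-- The flow of the reversed field inverts the flow. -/
lemma reverse_flow_flow [FiniteDimensional ℝ E] {Φ Ψ : ℝ → ℝ → E → E} (h0 : ∀ τ z, Φ 0 τ z = z)
    (hΦ : ∀ τ ∈ 𝕀, ∀ z, IsIntegralCurveOn (fun s => Φ s τ z) (fun s => Y s τ) 𝕀)
    (h0' : ∀ τ z, Ψ 0 τ z = z)
    (hΨ : ∀ τ ∈ 𝕀, ∀ z, IsIntegralCurveOn (fun s => Ψ s τ z) (fun s => reverseField Y s τ) 𝕀)
    {τ : ℝ} (hτ : τ ∈ 𝕀) (z : E) : Ψ 1 τ (Φ 1 τ z) = z := by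
  obtain ⟨K, hK⟩ := hY.reverse.exists_lipschitz
  have h1 : IsIntegralCurveOn (fun s => Φ (1 - s) τ z) (fun s => reverseField Y s τ) 𝕀 :=
    isIntegralCurveOn_reverse (hΦ τ hτ z)
  have := isIntegralCurveOn_unique (fun s hs => hK s hs τ hτ) (hΨ τ hτ (Φ 1 τ z)) h1
    (left_mem_Icc.2 zero_le_one) (by simp only [h0', sub_zero]) (right_mem_Icc.2 zero_le_one)
  simpa [h0] using this

end IsHomogeneousField

lemma reverseField_reverseField (Y : ℝ → ℝ → E → E) : reverseField (reverseField Y) = Y := by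
  ext s τ z
  simp [reverseField]

end HomogeneousFlow

/-! ### The Moser vector field -/

section Moser

lemma contDiffOn_partial_fderiv {G E F : Type*} [NormedAddCommGroup G] [NormedSpace ℝ G]
    [NormedAddCommGroup E] [NormedSpace ℝ E] [NormedAddCommGroup F] [NormedSpace ℝ F]
    {f : G → E → F} {T : Set G} {O : Set E}
    (hf : ContDiffOn ℝ ∞ (fun q : G × E => f q.1 q.2) (T ×ˢ O))
    (hT : UniqueDiffOn ℝ T) (hO : IsOpen O) :
    ContDiffOn ℝ ∞ (fun q : G × E => fderiv ℝ (f q.1) q.2) (T ×ˢ O) := by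
  obtain ⟨Df, h1, h2⟩ := contDiffOn_snd_partial (n := ∞) (by simpa using hf) hT hO.uniqueDiffOn
  refine h1.congr fun q hq => ?_
  exact ((h2 q.1 hq.1 q.2 hq.2).hasFDerivAt (hO.mem_nhds hq.2)).fderiv

lemma contDiffOn_smul_add_smul {X V : Type*} [NormedAddCommGroup X] [NormedSpace ℝ X]
    [NormedAddCommGroup V] [NormedSpace ℝ V] {a b : X → ℝ} {f g : X → V} {S : Set X}
    {n : WithTop ℕ∞} (ha : ContDiffOn ℝ n a S) (hb : ContDiffOn ℝ n b S)
    (hf : ContDiffOn ℝ n f S) (hg : ContDiffOn ℝ n g S) :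
    ContDiffOn ℝ n (fun q => a q • f q + b q • g q) S :=
  (ha.smul hf).add (hb.smul hg)

variable {E : Type} [NormedAddCommGroup E] [NormedSpace ℝ E] [NormedSpace ℂ E]
  [IsScalarTower ℝ ℂ E]

/-- Circular quadratic functions with positive definite Levi form. -/
structure IsPositiveQuadratic (f : E → ℝ) : Prop extends IsCircularQuadratic f where
  polarLevi_self_pos : ∀ z ≠ 0, ∀ v ≠ 0, 0 < polarLevi f z v v

/-- The affine path from `f₀` to `f₁`. -/
def interpolate (f₀ f₁ : E → ℝ) (s : ℝ) (z : E) : ℝ := (1 - s) * f₀ z + s * f₁ z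

section Interpolate

variable {f₀ f₁ : E → ℝ} (h₀ : IsPositiveQuadratic f₀) (h₁ : IsPositiveQuadratic f₁)
include h₀ h₁

lemma hasFDerivAt_interpolate (s : ℝ) {z : E} (hz : z ≠ 0) :
    HasFDerivAt (interpolate f₀ f₁ s) ((1 - s) • fderiv ℝ f₀ z + s • fderiv ℝ f₁ z) z :=
  ((h₀.hasFDerivAt hz).const_mul (1 - s)).add ((h₁.hasFDerivAt hz).const_mul s)

lemma fderiv_interpolate (s : ℝ) {z : E} (hz : z ≠ 0) :
    fderiv ℝ (interpolate f₀ f₁ s) z = (1 - s) • fderiv ℝ f₀ z + s • fderiv ℝ f₁ z :=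
  (hasFDerivAt_interpolate h₀ h₁ s hz).fderiv

lemma fderiv_fderiv_interpolate (s : ℝ) {z : E} (hz : z ≠ 0) :
    fderiv ℝ (fderiv ℝ (interpolate f₀ f₁ s)) z
      = (1 - s) • fderiv ℝ (fderiv ℝ f₀) z + s • fderiv ℝ (fderiv ℝ f₁) z := by
  have h1 := ((h₀.hasFDerivAt_fderiv hz).const_smul (1 - s)).add
    ((h₁.hasFDerivAt_fderiv hz).const_smul s)
  refine (h1.congr_of_eventuallyEq ?_).fderiv
  filter_upwards [isOpen_ne.mem_nhds hz] with y hy using fderiv_interpolate h₀ h₁ s hy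

lemma polarLevi_interpolate (s : ℝ) {z : E} (hz : z ≠ 0) :
    polarLevi (interpolate f₀ f₁ s) z = (1 - s) • polarLevi f₀ z + s • polarLevi f₁ z := by
  ext v w
  simp only [polarLevi_apply, fderiv_fderiv_interpolate h₀ h₁ s hz, add_apply, smul_apply,
    smul_eq_mul]
  ring

lemma isPositiveQuadratic_interpolate {s : ℝ} (hs : s ∈ 𝕀) :
    IsPositiveQuadratic (interpolate f₀ f₁ s) where
  contDiffAt z hz := (contDiffAt_const.mul (h₀.contDiffAt z hz)).add
    (contDiffAt_const.mul (h₁.contDiffAt z hz))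
  apply_smul ζ z := by simp only [interpolate, h₀.apply_smul, h₁.apply_smul]; ring
  polarLevi_self_pos z hz v hv := by
    rw [polarLevi_interpolate h₀ h₁ s hz]
    simp only [add_apply, smul_apply, smul_eq_mul]
    have e0 := h₀.polarLevi_self_pos z hz v hv
    have e1 := h₁.polarLevi_self_pos z hz v hv
    rcases hs.1.eq_or_lt with h | h
    · rw [← h]; simpa using e0
    · have := hs.2
      have : 0 ≤ (1 - s) * polarLevi f₀ z v v := mul_nonneg (by linarith) e0.le
      positivity

end Interpolate

variable [FiniteDimensional ℝ E]

/-- Positive definiteness gives injectivity into the dual space, which has the same finite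
dimension. -/
lemma IsPositiveQuadratic.isInvertible {f : E → ℝ} (hf : IsPositiveQuadratic f) {z : E}
    (hz : z ≠ 0) : (polarLevi f z).IsInvertible := by
  have hinj : Function.Injective (polarLevi f z : E →ₗ[ℝ] (E →L[ℝ] ℝ)) := by
    refine (injective_iff_map_eq_zero _).2 fun v hv => ?_
    by_contra hne
    have h1 := hf.polarLevi_self_pos z hz v hne
    have h2 : polarLevi f z v = 0 := hv
    rw [h2] at h1
    simp at h1
  have hdim : Module.finrank ℝ E = Module.finrank ℝ (E →L[ℝ] ℝ) := by
    rw [← (LinearMap.toContinuousLinearMap : (E →ₗ[ℝ] ℝ) ≃ₗ[ℝ] (E →L[ℝ] ℝ)).finrank_eq]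
    exact (Subspace.dual_finrank_eq (K := ℝ) (V := E)).symm
  refine ⟨(LinearMap.linearEquivOfInjective _ hinj hdim).toContinuousLinearEquiv, ?_⟩
  ext v w
  rfl

open Classical in
/-- The vector field of the Moser isotopy from `f₀` to `F τ`. -/
def moserField (f₀ : E → ℝ) (F : ℝ → E → ℝ) (s τ : ℝ) (z : E) : E :=
  if z = 0 then 0 else
    -(polarLevi (interpolate f₀ (F τ) s) z).inverse (fderiv ℝ (F τ) z - fderiv ℝ f₀ z)

section Field

variable {f₀ : E → ℝ} {F : ℝ → E → ℝ} (h₀ : IsPositiveQuadratic f₀)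
  (hF : ∀ τ ∈ 𝕀, IsPositiveQuadratic (F τ))
include h₀ hF

/-- This is the Moser equation: the right-hand side is minus the differential of the s-derivative of
the interpolation. -/
lemma polarLevi_moserField {s τ : ℝ} (hs : s ∈ 𝕀) (hτ : τ ∈ 𝕀) {z : E} (hz : z ≠ 0) (w : E) :
    polarLevi (interpolate f₀ (F τ) s) z (moserField f₀ F s τ z) w
      = fderiv ℝ f₀ z w - fderiv ℝ (F τ) z w := by
  have hinv := (isPositiveQuadratic_interpolate h₀ (hF τ hτ) hs).isInvertible hz
  rw [moserField, if_neg hz, map_neg]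
  obtain ⟨e, he⟩ := hinv
  rw [← he, ContinuousLinearMap.inverse_equiv]
  simp

lemma moserField_eq_of_polarLevi {s τ : ℝ} (hs : s ∈ 𝕀) (hτ : τ ∈ 𝕀) {z : E} (hz : z ≠ 0) {x : E}
    (hx : ∀ w, polarLevi (interpolate f₀ (F τ) s) z x w = fderiv ℝ f₀ z w - fderiv ℝ (F τ) z w) :
    moserField f₀ F s τ z = x := by
  have hpos := isPositiveQuadratic_interpolate h₀ (hF τ hτ) hs
  by_contra hne
  have h1 := hpos.polarLevi_self_pos z hz _ (sub_ne_zero.2 hne)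
  rw [(polarLevi (interpolate f₀ (F τ) s) z).map_sub, sub_apply,
    polarLevi_moserField h₀ hF hs hτ hz, hx, sub_self] at h1
  exact lt_irrefl _ h1

/-- Both sides of the Moser equation scale by |ζ|² when base point and vectors are multiplied by ζ,
and its solution is unique. The value 0 at the origin settles the degenerate cases. -/
lemma moserField_smul {s τ : ℝ} (hs : s ∈ 𝕀) (hτ : τ ∈ 𝕀) (ζ : ℂ) (z : E) :
    moserField f₀ F s τ (ζ • z) = ζ • moserField f₀ F s τ z := by
  by_cases hz : z = 0
  · simp [hz, moserField]
  by_cases hζ : ζ = 0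
  · simp [hζ, moserField]
  refine moserField_eq_of_polarLevi h₀ hF hs hτ (smul_ne_zero hζ hz) fun w => ?_
  have hw : w = ζ • ζ⁻¹ • w := (smul_inv_smul₀ hζ w).symm
  rw [hw, (isPositiveQuadratic_interpolate h₀ (hF τ hτ) hs).polarLevi_smul ζ hζ hz,
    h₀.fderiv_smul ζ hζ hz, (hF τ hτ).fderiv_smul ζ hζ hz, polarLevi_moserField h₀ hF hs hτ hz]
  ring

/-- The Moser equation tested on z, where the Levi form reduces to 2 df and Euler's identity gives
df(z) = 2f. -/
lemma fderiv_interpolate_moserField {s τ : ℝ} (hs : s ∈ 𝕀) (hτ : τ ∈ 𝕀) {z : E} (hz : z ≠ 0) :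
    fderiv ℝ (interpolate f₀ (F τ) s) z (moserField f₀ F s τ z) = f₀ z - F τ z := by
  have hpos := isPositiveQuadratic_interpolate h₀ (hF τ hτ) hs
  have h1 := polarLevi_moserField h₀ hF hs hτ hz z
  have e0 := h₀.fderiv_apply_smul_self 1 hz
  have e1 := (hF τ hτ).fderiv_apply_smul_self 1 hz
  rw [one_smul, Complex.one_re] at e0 e1
  rw [hpos.polarLevi_symm hz, hpos.polarLevi_self hz, e0, e1] at h1
  linarith

/-- The Moser equation tested on iz, where the right-hand side vanishes by invariance under
rotations. -/
lemma fderiv_interpolate_I_smul_moserField {s τ : ℝ} (hs : s ∈ 𝕀) (hτ : τ ∈ 𝕀) {z : E}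
    (hz : z ≠ 0) :
    fderiv ℝ (interpolate f₀ (F τ) s) z (Complex.I • moserField f₀ F s τ z) = 0 := by
  have hpos := isPositiveQuadratic_interpolate h₀ (hF τ hτ) hs
  have h1 := polarLevi_moserField h₀ hF hs hτ hz (Complex.I • z)
  have e0 := h₀.fderiv_apply_smul_self Complex.I hz
  have e1 := (hF τ hτ).fderiv_apply_smul_self Complex.I hz
  rw [Complex.I_re] at e0 e1
  rw [hpos.polarLevi_symm hz, hpos.polarLevi_I_smul_self hz, e0, e1] at h1
  linarith

variable (hFs : ContDiffOn ℝ ∞ (fun q : ℝ × E => F q.1 q.2) (𝕀 ×ˢ {z : E | z ≠ 0}))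
include hFs

lemma contDiffOn_polarLevi_of_family :
    ContDiffOn ℝ ∞ (fun q : ℝ × E => polarLevi (F q.1) q.2) (𝕀 ×ˢ {z : E | z ≠ 0}) := by
  have hI : UniqueDiffOn ℝ 𝕀 := uniqueDiffOn_Icc zero_lt_one
  exact contDiff_hermitianPart.comp_contDiffOn
    (contDiffOn_partial_fderiv (f := fun τ => fderiv ℝ (F τ))
      (contDiffOn_partial_fderiv hFs hI isOpen_ne) hI isOpen_ne)

theorem isHomogeneousField_moserField : IsHomogeneousField (moserField f₀ F) where
  apply_smul s hs τ hτ ζ z := moserField_smul h₀ hF hs hτ ζ z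
  contDiffOn := by
    have hI : UniqueDiffOn ℝ 𝕀 := uniqueDiffOn_Icc zero_lt_one
    have h₀s : ContDiffOn ℝ ∞ (fun q : ℝ × E => f₀ q.2) (𝕀 ×ˢ {z : E | z ≠ 0}) :=
      fun q hq => ((h₀.contDiffAt q.2 hq.2).comp q contDiffAt_snd).contDiffWithinAt
    have hpr : ContDiff ℝ ∞ fun q : (ℝ × ℝ) × E => (q.1.2, q.2) := by fun_prop
    have hmaps : MapsTo (fun q : (ℝ × ℝ) × E => (q.1.2, q.2)) ((𝕀 ×ˢ 𝕀) ×ˢ {z : E | z ≠ 0})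
        (𝕀 ×ˢ {z : E | z ≠ 0}) := fun q hq => ⟨hq.1.2, hq.2⟩
    have d1 := (contDiffOn_partial_fderiv hFs hI isOpen_ne).comp hpr.contDiffOn hmaps
    have d0 := (contDiffOn_partial_fderiv (f := fun _ => f₀) h₀s hI isOpen_ne).comp
      hpr.contDiffOn hmaps
    have l1 := (contDiffOn_polarLevi_of_family h₀ hF hFs).comp hpr.contDiffOn hmaps
    have l0 := (contDiffOn_polarLevi_of_family (F := fun _ => f₀) h₀ (fun _ _ => h₀) h₀s).comp
      hpr.contDiffOn hmaps
    have hs : ContDiff ℝ ∞ fun q : (ℝ × ℝ) × E => q.1.1 := by fun_prop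
    have l : ContDiffOn ℝ ∞ (fun q : (ℝ × ℝ) × E => polarLevi (interpolate f₀ (F q.1.2) q.1.1) q.2)
        ((𝕀 ×ˢ 𝕀) ×ˢ {z : E | z ≠ 0}) := by
      refine (contDiffOn_smul_add_smul ((contDiff_const (c := (1 : ℝ))).sub hs).contDiffOn
        hs.contDiffOn l0 l1).congr ?_
      exact fun q hq => polarLevi_interpolate h₀ (hF _ hq.1.2) q.1.1 hq.2
    have li : ContDiffOn ℝ ∞
        (fun q : (ℝ × ℝ) × E => (polarLevi (interpolate f₀ (F q.1.2) q.1.1) q.2).inverse)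
        ((𝕀 ×ˢ 𝕀) ×ˢ {z : E | z ≠ 0}) := fun q hq => by
      have : CompleteSpace E := FiniteDimensional.complete ℝ E
      exact ((isPositiveQuadratic_interpolate h₀ (hF _ hq.1.2) hq.1.1).isInvertible
        hq.2).contDiffAt_map_inverse.comp_contDiffWithinAt q (l q hq)
    refine (li.clm_apply (d1.sub d0)).neg.congr fun q hq => ?_
    rw [moserField, if_neg hq.2]
    rfl

end Field

end Moser

/-! ### The Moser flow and its invariants -/

section MoserFlow

variable {E : Type} [NormedAddCommGroup E] [NormedSpace ℝ E] [NormedSpace ℂ E]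
  [IsScalarTower ℝ ℂ E]

/-- A smooth family of diffeomorphisms of `E ∖ {0}`, with their inverses, which commute with the
multiplication by complex numbers. -/
structure IsHomogeneousDiffeo (Φ Ψ : ℝ → E → E) : Prop where
  contDiffOn : ContDiffOn ℝ ∞ (fun q : ℝ × E => Φ q.1 q.2) (𝕀 ×ˢ {z : E | z ≠ 0})
  contDiffOn_inv : ContDiffOn ℝ ∞ (fun q : ℝ × E => Ψ q.1 q.2) (𝕀 ×ˢ {z : E | z ≠ 0})
  apply_smul : ∀ τ ∈ 𝕀, ∀ (ζ : ℂ) (z : E), Φ τ (ζ • z) = ζ • Φ τ z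
  inv_smul : ∀ τ ∈ 𝕀, ∀ (ζ : ℂ) (z : E), Ψ τ (ζ • z) = ζ • Ψ τ z
  left_inv : ∀ τ ∈ 𝕀, ∀ z, Ψ τ (Φ τ z) = z
  right_inv : ∀ τ ∈ 𝕀, ∀ z, Φ τ (Ψ τ z) = z

namespace IsHomogeneousDiffeo

variable {Φ Ψ : ℝ → E → E} (h : IsHomogeneousDiffeo Φ Ψ)
include h

lemma symm : IsHomogeneousDiffeo Ψ Φ :=
  ⟨h.contDiffOn_inv, h.contDiffOn, h.inv_smul, h.apply_smul, h.right_inv, h.left_inv⟩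

lemma apply_zero {τ : ℝ} (hτ : τ ∈ 𝕀) : Φ τ 0 = 0 := by
  simpa using h.apply_smul τ hτ 0 0

lemma apply_ne_zero {τ : ℝ} (hτ : τ ∈ 𝕀) {z : E} (hz : z ≠ 0) : Φ τ z ≠ 0 := fun h0 => hz (by
  rw [← h.left_inv τ hτ z, h0, h.symm.apply_zero hτ])

lemma differentiableAt {τ : ℝ} (hτ : τ ∈ 𝕀) {z : E} (hz : z ≠ 0) :
    DifferentiableAt ℝ (Φ τ) z := by
  have h1 : ContDiffOn ℝ ∞ (Φ τ) {z : E | z ≠ 0} :=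
    h.contDiffOn.comp (f := fun z : E => (τ, z)) (by fun_prop) fun z hz => ⟨hτ, hz⟩
  exact (h1.contDiffAt (isOpen_ne.mem_nhds hz)).differentiableAt (by simp)

end IsHomogeneousDiffeo

variable [FiniteDimensional ℝ E]

section

variable {f₀ : E → ℝ} {F : ℝ → E → ℝ} (h₀ : IsPositiveQuadratic f₀)
  (hF : ∀ τ ∈ 𝕀, IsPositiveQuadratic (F τ))
  (hFs : ContDiffOn ℝ ∞ (fun q : ℝ × E => F q.1 q.2) (𝕀 ×ˢ {z : E | z ≠ 0}))
include h₀ hF hFs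

/-- The interpolated functions are constant along the Moser flow. -/
lemma eq_of_isIntegralCurveOn_moserField {τ : ℝ} (hτ : τ ∈ 𝕀) {γ : ℝ → E}
    (hγ : IsIntegralCurveOn γ (fun s => moserField f₀ F s τ) 𝕀) (hγ0 : γ 0 ≠ 0) :
    F τ (γ 1) = f₀ (γ 0) := by
  have hY := isHomogeneousField_moserField h₀ hF hFs
  have hne : ∀ s ∈ 𝕀, γ s ≠ 0 := fun s hs => hY.ne_zero_of_isIntegralCurveOn hτ hγ hγ0 hs
  have hderiv : ∀ s ∈ 𝕀, HasDerivWithinAt (fun s => (1 - s) * f₀ (γ s) + s * F τ (γ s)) 0 𝕀 s := by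
    intro s hs
    have a1 : HasDerivWithinAt (fun s => f₀ (γ s)) _ 𝕀 s :=
      (h₀.hasFDerivAt (hne s hs)).comp_hasDerivWithinAt s (hγ s hs)
    have a2 : HasDerivWithinAt (fun s => F τ (γ s)) _ 𝕀 s :=
      ((hF τ hτ).hasFDerivAt (hne s hs)).comp_hasDerivWithinAt s (hγ s hs)
    have b1 : HasDerivWithinAt (fun s : ℝ => 1 - s) (-1) 𝕀 s := by
      simpa using ((hasDerivAt_id s).const_sub 1).hasDerivWithinAt
    have b2 : HasDerivWithinAt (fun s : ℝ => s) 1 𝕀 s := hasDerivWithinAt_id s _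
    refine ((b1.fun_mul a1).fun_add (b2.fun_mul a2)).congr_deriv ?_
    -- The derivative of f_s along γ is ∂_s f_s + df_s(Y_s), which this identity makes zero.
    have key := fderiv_interpolate_moserField h₀ hF hs hτ (hne s hs)
    rw [fderiv_interpolate h₀ (hF τ hτ) s (hne s hs)] at key
    simp only [add_apply, smul_apply, smul_eq_mul] at key
    linear_combination key
  have := constant_of_has_deriv_right_zero (fun s hs => (hderiv s hs).continuousWithinAt)
    (fun s hs => hasDerivWithinAt_Ici_of_Icc hs (hderiv s (Ico_subset_Icc_self hs))) 1
    (right_mem_Icc.2 zero_le_one)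
  simpa using this

/-- The derivative of the identity `d f (i Y) = 0`. -/
lemma fderiv_fderiv_interpolate_moserField {s τ : ℝ} (hs : s ∈ 𝕀) (hτ : τ ∈ 𝕀) {z : E} (hz : z ≠ 0)
    (w : E) :
    (1 - s) * (fderiv ℝ (fderiv ℝ f₀) z w (Complex.I • moserField f₀ F s τ z)
        + fderiv ℝ f₀ z (Complex.I • fderiv ℝ (moserField f₀ F s τ) z w))
      + s * (fderiv ℝ (fderiv ℝ (F τ)) z w (Complex.I • moserField f₀ F s τ z)
        + fderiv ℝ (F τ) z (Complex.I • fderiv ℝ (moserField f₀ F s τ) z w)) = 0 := by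
  obtain ⟨DY, -, hDY⟩ := (isHomogeneousField_moserField h₀ hF hFs).exists_partial
  have hd := (hDY s hs τ hτ z hz).differentiableAt.hasFDerivAt
  have hId : HasFDerivAt (fun y => Complex.I • moserField f₀ F s τ y)
      (mulI E ∘L fderiv ℝ (moserField f₀ F s τ) z) z := (mulI E).hasFDerivAt.comp z hd
  have e0 := ((h₀.hasFDerivAt_fderiv hz).clm_apply hId).const_mul (1 - s)
  have e1 := (((hF τ hτ).hasFDerivAt_fderiv hz).clm_apply hId).const_mul s
  have e2 := e0.fun_add e1
  have e3 : (fun y => (1 - s) * fderiv ℝ f₀ y (Complex.I • moserField f₀ F s τ y)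
      + s * fderiv ℝ (F τ) y (Complex.I • moserField f₀ F s τ y)) =ᶠ[𝓝 z] fun _ => 0 := by
    filter_upwards [isOpen_ne.mem_nhds hz] with y hy
    have key := fderiv_interpolate_I_smul_moserField h₀ hF hs hτ hy
    rw [fderiv_interpolate h₀ (hF τ hτ) s hy] at key
    simpa only [add_apply, smul_apply, smul_eq_mul] using key
  have e4 := congrArg (fun L : E →L[ℝ] ℝ => L w)
    (e2.unique ((hasFDerivAt_const (0 : ℝ) z).congr_of_eventuallyEq e3))
  simp at e4
  linear_combination e4

/-- The Moser flow preserves the twisted differentials `d f (i ·)`. -/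
lemma fderiv_I_smul_eq {τ : ℝ} (hτ : τ ∈ 𝕀) {γ W : ℝ → E}
    (hγ : IsIntegralCurveOn γ (fun s => moserField f₀ F s τ) 𝕀) (hγ0 : γ 0 ≠ 0)
    (hW : ∀ s ∈ 𝕀, HasDerivWithinAt W (fderiv ℝ (moserField f₀ F s τ) (γ s) (W s)) 𝕀 s) :
    fderiv ℝ (F τ) (γ 1) (Complex.I • W 1) = fderiv ℝ f₀ (γ 0) (Complex.I • W 0) := by
  have hY := isHomogeneousField_moserField h₀ hF hFs
  have hne : ∀ s ∈ 𝕀, γ s ≠ 0 := fun s hs => hY.ne_zero_of_isIntegralCurveOn hτ hγ hγ0 hs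
  have hderiv : ∀ s ∈ 𝕀, HasDerivWithinAt (fun s => (1 - s) * fderiv ℝ f₀ (γ s) (Complex.I • W s)
      + s * fderiv ℝ (F τ) (γ s) (Complex.I • W s)) 0 𝕀 s := by
    intro s hs
    have hz := hne s hs
    have hIW : HasDerivWithinAt (fun s => Complex.I • W s) _ 𝕀 s := (hW s hs).const_smul Complex.I
    have a1 := (((h₀.hasFDerivAt_fderiv hz).comp_hasDerivWithinAt s (hγ s hs))).clm_apply hIW
    have a2 := ((((hF τ hτ).hasFDerivAt_fderiv hz).comp_hasDerivWithinAt s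
      (hγ s hs))).clm_apply hIW
    have b1 : HasDerivWithinAt (fun s : ℝ => 1 - s) (-1) 𝕀 s := by
      simpa using ((hasDerivAt_id s).const_sub 1).hasDerivWithinAt
    have b2 : HasDerivWithinAt (fun s : ℝ => s) 1 𝕀 s := hasDerivWithinAt_id s _
    refine ((b1.fun_mul a1).fun_add (b2.fun_mul a2)).congr_deriv ?_
    -- The derivative to be killed is d(∂_s f)(iW) + f''(Y, iW) + df(i dY(W)). By `k1` the last term
    -- is -f''(W, iY); by symmetry the two Hessian terms form the Levi form of Y and iW, which `k2`
    -- equates with -d(∂_s f)(iW).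
    have k1 := fderiv_fderiv_interpolate_moserField h₀ hF hFs hs hτ hz (W s)
    have k2 := polarLevi_moserField h₀ hF hs hτ hz (Complex.I • W s)
    rw [polarLevi_interpolate h₀ (hF τ hτ) s hz] at k2
    simp only [add_apply, smul_apply, smul_eq_mul, polarLevi_apply, I_smul_I_smul, map_neg] at k2
    have s1 : IsSymmSndFDerivAt ℝ f₀ (γ s) :=
      (h₀.contDiffAt_two hz).isSymmSndFDerivAt (by simp)
    have s2 : IsSymmSndFDerivAt ℝ (F τ) (γ s) :=
      ((hF τ hτ).contDiffAt_two hz).isSymmSndFDerivAt (by simp)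
    rw [s1 (W s), s2 (W s)] at k1
    simp only [Function.comp]
    linear_combination k1 + k2
  have := constant_of_has_deriv_right_zero (fun s hs => (hderiv s hs).continuousWithinAt)
    (fun s hs => hasDerivWithinAt_Ici_of_Icc hs (hderiv s (Ico_subset_Icc_self hs))) 1
    (right_mem_Icc.2 zero_le_one)
  simpa using this

/-- **Moser's argument** for circular quadratic functions. -/
theorem exists_homogeneousDiffeo : ∃ Φ Ψ : ℝ → E → E, IsHomogeneousDiffeo Φ Ψ ∧
    (∀ τ ∈ 𝕀, ∀ z, F τ (Φ τ z) = f₀ z) ∧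
    ∀ τ ∈ 𝕀, ∀ z ≠ 0, ∀ v, fderiv ℝ (F τ) (Φ τ z) (Complex.I • fderiv ℝ (Φ τ) z v)
      = fderiv ℝ f₀ z (Complex.I • v) := by
  have hY := isHomogeneousField_moserField h₀ hF hFs
  obtain ⟨Φ, h1, h2, h3, h4, h5⟩ := hY.exists_flow
  obtain ⟨Ψ, g1, g2, g3, g4, g5⟩ := hY.reverse.exists_flow
  have m1 : (1 : ℝ) ∈ 𝕀 := right_mem_Icc.2 zero_le_one
  -- The inverse is the time-one flow of the reversed field, so its joint smoothness in (τ, z) comes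
  -- from the same theorem.
  refine ⟨Φ 1, Ψ 1, ⟨h5 1 m1, g5 1 m1, h3 1 m1, g3 1 m1, ?_, ?_⟩, ?_, ?_⟩
  · exact fun τ hτ z => hY.reverse_flow_flow h1 h2 g1 g2 hτ z
  · exact fun τ hτ z => hY.reverse.reverse_flow_flow g1 g2 h1
      (by rwa [reverseField_reverseField]) hτ z
  · intro τ hτ z
    by_cases hz : z = 0
    · have e0 : f₀ 0 = 0 := by simpa using h₀.apply_smul 0 0
      have e1 : F τ 0 = 0 := by simpa using (hF τ hτ).apply_smul 0 0
      have e2 : Φ 1 τ 0 = 0 := by simpa using h3 1 m1 τ hτ 0 0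
      rw [hz, e2, e0, e1]
    · have := eq_of_isIntegralCurveOn_moserField h₀ hF hFs hτ (h2 τ hτ z) (by rwa [h1])
      simpa only [h1] using this
  · intro τ hτ z hz v
    obtain ⟨W, w0, w1, -, w2⟩ := hY.hasFDerivAt_flow h1 h2 hτ hz v
    have := fderiv_I_smul_eq h₀ hF hFs hτ (h2 τ hτ z) (by rwa [h1]) w2
    rwa [w1 1 m1, w0, h1] at this

end

end MoserFlow

end Circular

namespace Circular

/-! ### The unit ball -/

lemma minkowski_unitBall (n : ℕ) (z : Cn n) : minkowski (unitBall n) z = ‖z‖ := by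
  by_cases hz : z = 0
  · rw [hz, minkowski_zero, norm_zero]
  · have hz' : 0 < ‖z‖ := norm_pos_iff.2 hz
    have : {s : ℝ | (s : ℂ) • z ∈ unitBall n} = Ioo (-‖z‖⁻¹) ‖z‖⁻¹ := by
      ext s
      rw [mem_ofPred_eq, unitBall, mem_ball_zero_iff, norm_smul, Complex.norm_real, Real.norm_eq_abs,
        ← lt_inv_mul_iff₀' hz', mul_one, mem_Ioo, abs_lt]
    rw [minkowski, this, csSup_Ioo (by linarith [inv_pos.2 hz']), one_div, inv_inv]

lemma fderiv_fderiv_norm_sq (n : ℕ) (z w : Cn n) :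
    fderiv ℝ (fderiv ℝ fun z : Cn n => ‖z‖ ^ 2) z w w = 2 * ‖w‖ ^ 2 := by
  obtain ⟨h1, h2⟩ := hasDerivAt_comp_line (ρ := fun z : Cn n => ‖z‖ ^ 2) (z := z) (w := w)
    (contDiff_norm_sq ℂ).contDiffAt
  let : InnerProductSpace ℝ (Cn n) := InnerProductSpace.rclikeToReal ℂ (Cn n)
  have h3 : ∀ t : ℝ, HasDerivAt (fun s : ℝ => ‖z + s • w‖ ^ 2)
      (2 * inner ℝ z w + 2 * ‖w‖ ^ 2 * t) t := by
    intro t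
    have : (fun s : ℝ => ‖z + s • w‖ ^ 2)
        = fun s => ‖z‖ ^ 2 + 2 * inner ℝ z w * s + ‖w‖ ^ 2 * s ^ 2 := by
      ext s
      rw [norm_add_sq_real, inner_smul_right, norm_smul, mul_pow, Real.norm_eq_abs, sq_abs]
      ring
    rw [this]
    convert! (((hasDerivAt_id t).const_mul (2 * inner ℝ z w)).const_add (‖z‖ ^ 2)).add
      (((hasDerivAt_id t).pow 2).const_mul (‖w‖ ^ 2)) using 1
    simp
    ring
  have h4 : (fun t : ℝ => fderiv ℝ (fun z : Cn n => ‖z‖ ^ 2) (z + t • w) w) =ᶠ[𝓝 0]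
      fun t => 2 * inner ℝ z w + 2 * ‖w‖ ^ 2 * t :=
    h1.mono fun t ht => ht.unique (h3 t)
  have h5 : HasDerivAt (fun t : ℝ => 2 * inner ℝ z w + 2 * ‖w‖ ^ 2 * t) (2 * ‖w‖ ^ 2) 0 := by
    simpa using ((hasDerivAt_id (0 : ℝ)).const_mul (2 * ‖w‖ ^ 2)).const_add (2 * inner ℝ z w)
  exact (h2.congr_of_eventuallyEq h4.symm).unique h5

lemma isPositiveQuadratic_norm_sq (n : ℕ) : IsPositiveQuadratic fun z : Cn n => ‖z‖ ^ 2 where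
  contDiffAt _ _ := (contDiff_norm_sq ℂ).contDiffAt
  apply_smul ζ z := by rw [norm_smul, mul_pow]
  polarLevi_self_pos z _ v hv := by
    rw [polarLevi_apply, fderiv_fderiv_norm_sq, fderiv_fderiv_norm_sq]
    have := norm_pos_iff.2 hv
    positivity

lemma IsCircularDomain.isPositiveQuadratic {n : ℕ} {D : Set (Cn n)} (hD : IsCircularDomain D) :
    IsPositiveQuadratic fun z => minkowski D z ^ 2 where
  toIsCircularQuadratic := hD.isCircularQuadratic
  polarLevi_self_pos _ hz _ hv := hD.polarLevi_minkowski_pos hz hv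

end Circular

namespace Circular

/-! ### Lifting homogeneous maps to the blow-up -/

namespace Blowup

variable {n : ℕ}

lemma exists_eq_fiberMap (p : Blowup n) : ∃ ζ, p = fiberMap p.line.rep p.line.rep_nonzero ζ := by
  obtain ⟨⟨L, z⟩, hz⟩ := p
  have hz' := hz
  rw [Projectivization.submodule_eq, Submodule.mem_span_singleton] at hz'
  obtain ⟨ζ, hζ⟩ := hz'
  exact ⟨ζ, Subtype.ext (Prod.ext L.mk_rep.symm hζ.symm)⟩

lemma fiberMap_congr {v w : Cn n} (hv : v ≠ 0) (hw : w ≠ 0) (h : v = w) (ζ : ℂ) :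
    fiberMap v hv ζ = fiberMap w hw ζ := by
  subst h; rfl

lemma fiberMap_mem_source {v : Cn n} (hv : v ≠ 0) {k : Fin n} (hk : v k ≠ 0) (ζ : ℂ) :
    fiberMap v hv ζ ∈ (chart k).source :=
  (rep_mk_ne_zero_iff k v hv).2 hk

lemma chart_fiberMap {v : Cn n} (hv : v ≠ 0) (k : Fin n) (ζ : ℂ) :
    chart k (fiberMap v hv ζ) = Function.update (fun j => v j / v k) k (ζ * v k) := by
  change Function.update (fun j => ratio k j (Projectivization.mk ℂ v hv)) k ((ζ • v) k) = _
  simp only [ratio_mk]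
  rfl

lemma fiberMap_eq_chart_symm {v : Cn n} (hv : v ≠ 0) {k : Fin n} (hk : v k ≠ 0) (ζ : ℂ) :
    fiberMap v hv ζ = (chart k).symm (Function.update (fun j => v j / v k) k (ζ * v k)) := by
  rw [← chart_fiberMap hv, (chart k).left_inv (fiberMap_mem_source hv hk ζ)]

lemma eq_fiberMap_chart {p : Blowup n} {i : Fin n} (hp : p ∈ (chart i).source) :
    p = fiberMap (affVec i (chart i p)) (affVec_ne_zero i _) (chart i p i) :=
  ((chart i).left_inv hp).symm

lemma exists_mem_chart_source (p : Blowup n) : ∃ i, p ∈ (chart i).source :=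
  exists_rep_ne_zero p.line

lemma chart_mem_maximalAtlas (i : Fin n) :
    chart i ∈ IsManifold.maximalAtlas 𝓘(ℝ, Fin n → ℂ) ∞ (Blowup n) :=
  IsManifold.subset_maximalAtlas (mem_range_self i)

lemma chart_mem_maximalAtlas_complex (i : Fin n) :
    chart i ∈ IsManifold.maximalAtlas 𝓘(ℂ, Fin n → ℂ) ω (Blowup n) :=
  IsManifold.subset_maximalAtlas (mem_range_self i)

lemma exists_apply_ne_zero {v : Cn n} (hv : v ≠ 0) : ∃ k, v k ≠ 0 := by
  by_contra! h
  exact hv (by ext i; simpa using h i)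

lemma contDiff_affVec (i : Fin n) : ContDiff ℂ ω (affVec i : (Fin n → ℂ) → Cn n) := by
  rw [contDiff_piLp]
  intro j
  by_cases hj : j = i
  · subst hj
    simp only [affVec_self]
    exact contDiff_const
  · simp only [affVec_of_ne hj]
    exact contDiff_apply ℂ ℂ j

lemma mdifferentiable_fiberMap (v : Cn n) (hv : v ≠ 0) :
    MDifferentiable 𝓘(ℂ, ℂ) 𝓘(ℂ, Fin n → ℂ) (fiberMap v hv) := by
  obtain ⟨k, hk⟩ := exists_apply_ne_zero hv
  have : fiberMap v hv = (chart k).symm ∘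
      fun ζ : ℂ => Function.update (fun j => v j / v k) k (ζ * v k) := by
    ext1 ζ
    exact fiberMap_eq_chart_symm hv hk ζ
  rw [this]
  intro ζ
  refine MDifferentiableAt.comp ζ (I' := 𝓘(ℂ, Fin n → ℂ)) ((contMDiffAt_symm_of_mem_maximalAtlas
    (chart_mem_maximalAtlas_complex k) (mem_univ _)).mdifferentiableAt (by simp)) ?_
  refine DifferentiableAt.mdifferentiableAt ?_
  rw [differentiableAt_pi]
  intro j
  by_cases hj : j = k
  · subst hj
    simp only [Function.update_self]
    fun_prop
  · simp only [Function.update_of_ne hj]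
    fun_prop

/-- The lift of a homogeneous map to the blow-up. -/
def lift (Φ : Cn n → Cn n) (h0 : ∀ z ≠ 0, Φ z ≠ 0) (hs : ∀ (ζ : ℂ) z, Φ (ζ • z) = ζ • Φ z)
    (p : Blowup n) : Blowup n :=
  ⟨(Projectivization.mk ℂ (Φ p.line.rep) (h0 _ p.line.rep_nonzero), Φ p.vec), by
    obtain ⟨ζ, hζ⟩ := exists_eq_fiberMap p
    have : p.vec = ζ • p.line.rep := congrArg vec hζ
    rw [Projectivization.submodule_mk, this, hs]
    exact Submodule.smul_mem _ _ (Submodule.mem_span_singleton_self _)⟩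

lemma lift_fiberMap {Φ : Cn n → Cn n} (h0 : ∀ z ≠ 0, Φ z ≠ 0)
    (hs : ∀ (ζ : ℂ) z, Φ (ζ • z) = ζ • Φ z) (v : Cn n) (hv : v ≠ 0) (ζ : ℂ) :
    lift Φ h0 hs (fiberMap v hv ζ) = fiberMap (Φ v) (h0 v hv) ζ := by
  refine Subtype.ext (Prod.ext ?_ (hs ζ v))
  obtain ⟨a, ha⟩ := Projectivization.exists_smul_eq_mk_rep ℂ v hv
  refine (Projectivization.mk_eq_mk_iff' _ _ _ _ _).2 ⟨a, ?_⟩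
  change (a : ℂ) • Φ v = Φ (Projectivization.mk ℂ v hv).rep
  rw [← ha, ← hs]
  rfl

/-- The lift to the blow-up of a smooth family of homogeneous maps is smooth. -/
theorem contMDiffOn_of_fiberMap {Φ Ψ : ℝ → Cn n → Cn n} (h : IsHomogeneousDiffeo Φ Ψ)
    {f : ℝ → Blowup n → Blowup n}
    (hf : ∀ τ (hτ : τ ∈ Icc (0 : ℝ) 1) v hv ζ,
      f τ (fiberMap v hv ζ) = fiberMap (Φ τ v) (h.apply_ne_zero hτ hv) ζ) :
    ContMDiffOn (𝓘(ℝ, ℝ).prod 𝓘(ℝ, Fin n → ℂ)) 𝓘(ℝ, Fin n → ℂ) ∞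
      (fun q : ℝ × Blowup n => f q.1 q.2) (Icc (0 : ℝ) 1 ×ˢ univ) := by
  rintro ⟨τ₀, p₀⟩ ⟨hτ₀, -⟩
  change τ₀ ∈ Icc (0 : ℝ) 1 at hτ₀
  obtain ⟨i, hi⟩ := exists_mem_chart_source p₀
  obtain ⟨k, hk⟩ := exists_apply_ne_zero
    (h.apply_ne_zero hτ₀ (affVec_ne_zero i (chart i p₀)))
  set U : ℝ × (Fin n → ℂ) → Cn n := fun q => Φ q.1 (affVec i q.2) with hU
  have hUs : ContDiffOn ℝ ∞ U (Icc (0 : ℝ) 1 ×ˢ univ) :=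
    h.contDiffOn.comp (f := fun q : ℝ × (Fin n → ℂ) => (q.1, affVec i q.2))
      (contDiff_fst.prodMk ((((contDiff_affVec i).restrict_scalars ℝ).of_le le_top).comp
        contDiff_snd)).contDiffOn fun q hq => ⟨hq.1, affVec_ne_zero i q.2⟩
  set c : ℝ × Blowup n → ℝ × (Fin n → ℂ) := fun q => (q.1, chart i q.2) with hc
  have hcs : ContMDiffWithinAt (𝓘(ℝ, ℝ).prod 𝓘(ℝ, Fin n → ℂ)) 𝓘(ℝ, ℝ × (Fin n → ℂ)) ∞ c
      (Icc (0 : ℝ) 1 ×ˢ univ) (τ₀, p₀) := by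
    refine ContMDiffWithinAt.prodMk_space contMDiffWithinAt_fst ?_
    exact (contMDiffAt_of_mem_maximalAtlas (chart_mem_maximalAtlas i) hi).comp_contMDiffWithinAt
      (τ₀, p₀) contMDiffWithinAt_snd
  have hUj : ∀ j, ContDiffWithinAt ℝ ∞ (fun q => U q j) (Icc (0 : ℝ) 1 ×ˢ univ) (c (τ₀, p₀)) :=
    fun j => (contDiffWithinAt_piLp (p := 2)).1 (hUs (c (τ₀, p₀)) ⟨hτ₀, mem_univ _⟩) j
  -- The lift in the charts i and k: affine coordinates of Φ(v) together with ζ Φ(v)_k. The fibre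
  -- coordinate ζ enters only as a factor and Φ only at the nonzero vector v, so the zero section is
  -- not singular.
  set G : ℝ × (Fin n → ℂ) → Fin n → ℂ :=
    fun q => Function.update (fun j => U q j / U q k) k (q.2 i * U q k) with hG
  have hGs : ContDiffWithinAt ℝ ∞ G (Icc (0 : ℝ) 1 ×ˢ univ) (c (τ₀, p₀)) := by
    rw [contDiffWithinAt_pi]
    intro j
    by_cases hj : j = k
    · subst hj
      simp only [hG, Function.update_self]
      exact (((contDiff_apply ℝ ℂ i).comp contDiff_snd).contDiffWithinAt).mul (hUj j)
    · simp only [hG, Function.update_of_ne hj, div_eq_mul_inv]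
      exact (hUj j).mul ((hUj k).inv hk)
  have hcomp : ContMDiffWithinAt (𝓘(ℝ, ℝ).prod 𝓘(ℝ, Fin n → ℂ)) 𝓘(ℝ, Fin n → ℂ) ∞
      ((chart k).symm ∘ G ∘ c) (Icc (0 : ℝ) 1 ×ˢ univ) (τ₀, p₀) := by
    refine ContMDiffAt.comp_contMDiffWithinAt (I' := 𝓘(ℝ, Fin n → ℂ)) (τ₀, p₀)
      (contMDiffAt_symm_of_mem_maximalAtlas (chart_mem_maximalAtlas k) (mem_univ _)) ?_
    exact ContMDiffWithinAt.comp (τ₀, p₀) hGs.contMDiffWithinAt hcs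
      fun q hq => ⟨hq.1, mem_univ _⟩
  refine hcomp.congr_of_eventuallyEq_of_mem ?_ ⟨hτ₀, mem_univ _⟩
  have e1 : ∀ᶠ q in 𝓝[Icc (0 : ℝ) 1 ×ˢ univ] (τ₀, p₀), q.2 ∈ (chart i).source :=
    nhdsWithin_le_nhds (continuous_snd.continuousAt ((chart i).open_source.mem_nhds hi))
  have e2 : ∀ᶠ q in 𝓝[Icc (0 : ℝ) 1 ×ˢ univ] (τ₀, p₀), U (c q) k ≠ 0 := by
    have : ContinuousWithinAt (fun q => U (c q) k) (Icc (0 : ℝ) 1 ×ˢ univ) (τ₀, p₀) :=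
      ContinuousWithinAt.comp (g := fun q => U q k) (hUj k).continuousWithinAt
        hcs.continuousWithinAt fun q hq => ⟨hq.1, mem_univ _⟩
    exact this.eventually_ne hk
  filter_upwards [e1, e2, self_mem_nhdsWithin] with q h1 h2 h3
  conv_lhs => rw [eq_fiberMap_chart h1]
  rw [hf q.1 h3.1, fiberMap_eq_chart_symm _ h2]
  rfl

/-- The lift to the blow-up of a member of a family of homogeneous maps. -/
def liftFamily {Φ Ψ : ℝ → Cn n → Cn n} (h : IsHomogeneousDiffeo Φ Ψ) {τ : ℝ}
    (hτ : τ ∈ Icc (0 : ℝ) 1) : Blowup n → Blowup n :=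
  lift (Φ τ) (fun _ => h.apply_ne_zero hτ) (h.apply_smul τ hτ)

lemma contMDiff_liftFamily {Φ Ψ : ℝ → Cn n → Cn n} (h : IsHomogeneousDiffeo Φ Ψ) {τ : ℝ}
    (hτ : τ ∈ Icc (0 : ℝ) 1) :
    ContMDiff 𝓘(ℝ, Fin n → ℂ) 𝓘(ℝ, Fin n → ℂ) ∞ (liftFamily h hτ : Blowup n → Blowup n) := by
  classical
  have h1 := contMDiffOn_of_fiberMap h
    (f := fun t => if ht : t ∈ Icc (0 : ℝ) 1 then liftFamily h ht else id)
    (fun t ht v hv ζ => by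
      rw [dif_pos ht]
      exact lift_fiberMap _ _ v hv ζ)
  have h2 : ContMDiff 𝓘(ℝ, Fin n → ℂ) (𝓘(ℝ, ℝ).prod 𝓘(ℝ, Fin n → ℂ)) ∞
      (fun p : Blowup n => (τ, p)) := contMDiff_const.prodMk contMDiff_id
  have h3 := h1.comp_contMDiff h2 fun p => ⟨hτ, mem_univ _⟩
  convert h3 using 1
  ext1 p
  simp only [Function.comp_apply, dif_pos hτ]

lemma liftFamily_symm_liftFamily {Φ Ψ : ℝ → Cn n → Cn n} (h : IsHomogeneousDiffeo Φ Ψ) {τ : ℝ}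
    (hτ : τ ∈ Icc (0 : ℝ) 1) (p : Blowup n) : liftFamily h.symm hτ (liftFamily h hτ p) = p := by
  obtain ⟨ζ, hζ⟩ := exists_eq_fiberMap p
  rw [hζ, liftFamily, liftFamily, lift_fiberMap, lift_fiberMap]
  exact fiberMap_congr _ _ (h.left_inv τ hτ _) ζ

/-- The lift to the blow-up of a member of a family of homogeneous diffeomorphisms. -/
def liftDiffeomorph {Φ Ψ : ℝ → Cn n → Cn n} (h : IsHomogeneousDiffeo Φ Ψ) {τ : ℝ}
    (hτ : τ ∈ Icc (0 : ℝ) 1) :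
    Blowup n ≃ₘ⟮𝓘(ℝ, Fin n → ℂ), 𝓘(ℝ, Fin n → ℂ)⟯ Blowup n where
  toFun := liftFamily h hτ
  invFun := liftFamily h.symm hτ
  left_inv := liftFamily_symm_liftFamily h hτ
  right_inv := liftFamily_symm_liftFamily h.symm hτ
  contMDiff_toFun := contMDiff_liftFamily h hτ
  contMDiff_invFun := contMDiff_liftFamily h.symm hτ

section

variable {Φ Ψ : ℝ → Cn n → Cn n} (h : IsHomogeneousDiffeo Φ Ψ) {τ : ℝ} (hτ : τ ∈ Icc (0 : ℝ) 1)

lemma liftDiffeomorph_fiberMap (v : Cn n) (hv : v ≠ 0) (ζ : ℂ) :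
    liftDiffeomorph h hτ (fiberMap v hv ζ) = fiberMap (Φ τ v) (h.apply_ne_zero hτ hv) ζ :=
  lift_fiberMap (fun _ => h.apply_ne_zero hτ) (h.apply_smul τ hτ) v hv ζ

lemma vec_liftDiffeomorph (p : Blowup n) : (liftDiffeomorph h hτ p).vec = Φ τ p.vec := rfl

end

end Blowup

end Circular

namespace Circular

/-! ### The differential of the blow-down map -/

namespace Blowup

variable {n : ℕ}

lemma differentiable_smul_affVec (i : Fin n) :
    Differentiable ℂ fun w : Fin n → ℂ => w i • affVec i w :=
  (differentiable_apply i).smul ((contDiff_affVec i).differentiable (by simp))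

/-- The blow-down is holomorphic in the preferred chart, the one in which `complexStructure` is
multiplication by i. Complex linearity of A therefore turns J into multiplication by i on ℂⁿ. -/
lemma hasMFDerivAt_vec (u : Blowup n) : ∃ A : (Fin n → ℂ) →L[ℂ] Cn n,
    HasMFDerivAt 𝓘(ℝ, Fin n → ℂ) 𝓘(ℝ, Cn n) vec u (A.restrictScalars ℝ) := by
  obtain ⟨i, hi⟩ : chartAt (Fin n → ℂ) u ∈ range chart := chart_mem_atlas _ u
  refine ⟨fderiv ℂ (fun w : Fin n → ℂ => w i • affVec i w) (chart i u), ?_, ?_⟩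
  · exact (continuous_snd.comp continuous_subtype_val).continuousAt
  · have : writtenInExtChartAt 𝓘(ℝ, Fin n → ℂ) 𝓘(ℝ, Cn n) u (vec : Blowup n → Cn n)
        = fun w : Fin n → ℂ => w i • affVec i w := by
      ext1 w
      simp only [writtenInExtChartAt, mfld_simps]
      rw [← hi]
      rfl
    rw [this]
    simp only [mfld_simps]
    rw [← hi]
    exact ((differentiable_smul_affVec i _).hasFDerivAt.restrictScalars ℝ).hasFDerivWithinAt

end Blowup

/-! ### Transport of the distributions and conclusion -/

variable {n : ℕ}

open Blowup

lemma realDifferential_minkowskiLift {D : Set (Cn n)} {u : Blowup n} {μ' : Cn n →L[ℝ] ℝ}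
    (hμ : HasFDerivAt (minkowski D) μ' u.vec) {A : (Fin n → ℂ) →L[ℂ] Cn n}
    (hA : HasMFDerivAt 𝓘(ℝ, Fin n → ℂ) 𝓘(ℝ, Cn n) vec u (A.restrictScalars ℝ)) (w : Fin n → ℂ) :
    realDifferential (minkowskiLift D) u w = μ' (A w) := by
  have h1 : HasMFDerivAt 𝓘(ℝ, Fin n → ℂ) 𝓘(ℝ, ℝ) (minkowskiLift D) u
      (μ'.comp (A.restrictScalars ℝ)) :=
    HasMFDerivAt.comp u hμ.hasMFDerivAt hA
  change mfderiv 𝓘(ℝ, Fin n → ℂ) 𝓘(ℝ, ℝ) (minkowskiLift D) u w = _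
  rw [h1.mfderiv]
  rfl

lemma mem_horizontal_minkowskiLift {D : Set (Cn n)} {u : Blowup n} {μ' : Cn n →L[ℝ] ℝ}
    (hμ : HasFDerivAt (minkowski D) μ' u.vec) {A : (Fin n → ℂ) →L[ℂ] Cn n}
    (hA : HasMFDerivAt 𝓘(ℝ, Fin n → ℂ) 𝓘(ℝ, Cn n) vec u (A.restrictScalars ℝ)) (w : Fin n → ℂ) :
    w ∈ horizontal (minkowskiLift D) u ↔ μ' (A w) = 0 ∧ μ' (Complex.I • A w) = 0 := by
  have h1 := realDifferential_minkowskiLift hμ hA w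
  have h2 := realDifferential_minkowskiLift hμ hA (Complex.I • w)
  rw [map_smul] at h2
  rw [← h1, ← h2]
  rfl

/-- The horizontal spaces are preimages, under the differential of the blow-down, of subspaces of
ℂⁿ. Everything is thus checked on ℂⁿ, without inverting the blow-down; only dφ has to be onto. -/
theorem isNormalizing_liftDiffeomorph {D : Set (Cn n)} (hD : IsCircularDomain D)
    {Φ Ψ : ℝ → Cn n → Cn n} (h : IsHomogeneousDiffeo Φ Ψ) {τ : ℝ} (hτ : τ ∈ Icc (0 : ℝ) 1)
    (hμ : ∀ z, minkowski D (Φ τ z) ^ 2 = ‖z‖ ^ 2)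
    (hdμ : ∀ z ≠ 0, ∀ v, fderiv ℝ (fun z => minkowski D z ^ 2) (Φ τ z)
      (Complex.I • fderiv ℝ (Φ τ) z v) = fderiv ℝ (fun z => ‖z‖ ^ 2) z (Complex.I • v)) :
    IsNormalizing D (liftDiffeomorph h hτ) := by
  have hμ' : ∀ z, minkowski D (Φ τ z) = ‖z‖ := fun z =>
    (sq_eq_sq₀ (hD.minkowski_nonneg _) (norm_nonneg _)).1 (hμ z)
  have hball : minkowski (unitBall n) = fun z => ‖z‖ := funext (minkowski_unitBall n)
  refine ⟨⟨fun L => Projectivization.mk ℂ (Φ τ L.rep) (h.apply_ne_zero hτ L.rep_nonzero),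
    fun p => rfl⟩, fun v hv => ?_, fun p => ?_, fun u hu => ?_⟩
  · simp only [liftDiffeomorph_fiberMap]
    exact mdifferentiable_fiberMap _ _
  · rw [minkowskiLift, minkowskiLift, vec_liftDiffeomorph, hμ', minkowski_unitBall]
  · set φ := liftDiffeomorph h hτ with hφ
    have hz : Φ τ u.vec ≠ 0 := h.apply_ne_zero hτ hu
    obtain ⟨A, hA⟩ := hasMFDerivAt_vec u
    obtain ⟨B, hB⟩ := hasMFDerivAt_vec (φ u)
    have hΦ := (h.differentiableAt hτ hu).hasFDerivAt
    have hφd : HasMFDerivAt 𝓘(ℝ, Fin n → ℂ) 𝓘(ℝ, Fin n → ℂ) φ u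
        (mfderiv 𝓘(ℝ, Fin n → ℂ) 𝓘(ℝ, Fin n → ℂ) φ u) :=
      (φ.contMDiff.mdifferentiableAt (by simp)).hasMFDerivAt
    have hcomm : ∀ w : Fin n → ℂ, B (mfderiv 𝓘(ℝ, Fin n → ℂ) 𝓘(ℝ, Fin n → ℂ) φ u w)
        = fderiv ℝ (Φ τ) u.vec (A w) := by
      have h1 := HasMFDerivAt.comp u hB hφd
      have h2 := HasMFDerivAt.comp u hΦ.hasMFDerivAt hA
      intro w
      exact congrArg (fun T : (Fin n → ℂ) →L[ℝ] Cn n => T w) (hasMFDerivAt_unique h1 h2)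
    have hD1 : HasFDerivAt (minkowski D) (fderiv ℝ (minkowski D) (Φ τ u.vec)) (φ u).vec :=
      ((hD.contDiffAt_minkowski hz).differentiableAt (by simp)).hasFDerivAt
    have hB1 : HasFDerivAt (minkowski (unitBall n)) (fderiv ℝ (fun z : Cn n => ‖z‖) u.vec)
        u.vec := by
      rw [hball]
      exact ((contDiffAt_norm ℂ hu (n := 1)).differentiableAt (by simp)).hasFDerivAt
    set β := fderiv ℝ (minkowski D) (Φ τ u.vec)
    set α := fderiv ℝ (fun z : Cn n => ‖z‖) u.vec
    have e1 : ∀ v, β (fderiv ℝ (Φ τ) u.vec v) = α v := by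
      have h1 := hD1.comp u.vec hΦ
      have h2 : minkowski D ∘ Φ τ = minkowski (unitBall n) := by
        ext z
        rw [Function.comp_apply, hμ', minkowski_unitBall]
      rw [h2] at h1
      intro v
      exact congrArg (fun T : Cn n →L[ℝ] ℝ => T v) (h1.unique hB1)
    -- The hypothesis concerns squares; the factors 2μ and 2‖z‖ from d(μ²) = 2μ dμ are equal and
    -- nonzero, so they cancel.
    have e2 : ∀ v, β (Complex.I • fderiv ℝ (Φ τ) u.vec v) = α (Complex.I • v) := by
      intro v
      have h1 := hdμ u.vec hu v
      have h2 : HasFDerivAt (fun z => minkowski D z ^ 2) _ (Φ τ u.vec) := HasFDerivAt.pow hD1 2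
      have h3 : HasFDerivAt (fun z : Cn n => ‖z‖ ^ 2) _ u.vec :=
        HasFDerivAt.pow (by simpa only [hball] using hB1) 2
      rw [h2.fderiv, h3.fderiv] at h1
      have hu' : ‖u.vec‖ ≠ 0 := norm_ne_zero_iff.2 hu
      have h4 : minkowski D (φ u).vec = ‖u.vec‖ := hμ' u.vec
      simpa [h4, hu'] using h1
    have key : ∀ w : Fin n → ℂ, (mfderiv 𝓘(ℝ, Fin n → ℂ) 𝓘(ℝ, Fin n → ℂ) φ u w) ∈
        horizontal (minkowskiLift D) (φ u) ↔ w ∈ horizontal (minkowskiLift (unitBall n)) u := by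
      intro w
      rw [mem_horizontal_minkowskiLift hB1 hA, ← e1, ← e2, ← hcomm]
      exact mem_horizontal_minkowskiLift hD1 hB _
    ext w
    constructor
    · rintro ⟨w, hw, rfl⟩
      exact (key w).2 hw
    · intro hw
      obtain ⟨w', rfl⟩ := (φ.mfderivToContinuousLinearEquiv (by simp) u).surjective w
      exact ⟨w', (key w').1 hw, rfl⟩

end Circular

end

theorem lemma4p5 (n : ℕ) :
    (∀ D : Set (Circular.Cn n), Circular.IsCircularDomain D →
      ∃ φ : Circular.Blowup n ≃ₘ⟮𝓘(ℝ, Fin n → ℂ), 𝓘(ℝ, Fin n → ℂ)⟯ Circular.Blowup n,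
        Circular.IsNormalizing D φ) ∧
    (∀ D : ℝ → Set (Circular.Cn n),
      (∀ t ∈ Set.Icc (0 : ℝ) 1, Circular.IsCircularDomain (D t)) →
      ContDiffOn ℝ ∞ (fun q : ℝ × Circular.Cn n => Circular.minkowski (D q.1) q.2)
        (Set.Icc (0 : ℝ) 1 ×ˢ {z : Circular.Cn n | z ≠ 0}) →
      ∃ φ : ℝ → Circular.Blowup n ≃ₘ⟮𝓘(ℝ, Fin n → ℂ), 𝓘(ℝ, Fin n → ℂ)⟯ Circular.Blowup n,
        (∀ t ∈ Set.Icc (0 : ℝ) 1, Circular.IsNormalizing (D t) (φ t)) ∧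
        ContMDiffOn (𝓘(ℝ, ℝ).prod 𝓘(ℝ, Fin n → ℂ)) 𝓘(ℝ, Fin n → ℂ) ∞
          (fun q : ℝ × Circular.Blowup n => φ q.1 q.2)
          (Set.Icc (0 : ℝ) 1 ×ˢ (Set.univ : Set (Circular.Blowup n)))) := by
  classical
  have family : ∀ D : ℝ → Set (Circular.Cn n),
      (∀ t ∈ Set.Icc (0 : ℝ) 1, Circular.IsCircularDomain (D t)) →
      ContDiffOn ℝ ∞ (fun q : ℝ × Circular.Cn n => Circular.minkowski (D q.1) q.2)
        (Set.Icc (0 : ℝ) 1 ×ˢ {z : Circular.Cn n | z ≠ 0}) →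
      ∃ φ : ℝ → Circular.Blowup n ≃ₘ⟮𝓘(ℝ, Fin n → ℂ), 𝓘(ℝ, Fin n → ℂ)⟯ Circular.Blowup n,
        (∀ t ∈ Set.Icc (0 : ℝ) 1, Circular.IsNormalizing (D t) (φ t)) ∧
        ContMDiffOn (𝓘(ℝ, ℝ).prod 𝓘(ℝ, Fin n → ℂ)) 𝓘(ℝ, Fin n → ℂ) ∞
          (fun q : ℝ × Circular.Blowup n => φ q.1 q.2)
          (Set.Icc (0 : ℝ) 1 ×ˢ (Set.univ : Set (Circular.Blowup n))) := by
    intro D hD hDs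
    obtain ⟨Φ, Ψ, h, hμ, hdμ⟩ := Circular.exists_homogeneousDiffeo
      (Circular.isPositiveQuadratic_norm_sq n)
      (F := fun t z => Circular.minkowski (D t) z ^ 2)
      (fun t ht => (hD t ht).isPositiveQuadratic) (hDs.pow 2)
    refine ⟨fun t => if ht : t ∈ Set.Icc (0 : ℝ) 1 then Circular.Blowup.liftDiffeomorph h ht
      else Diffeomorph.refl _ _ _, fun t ht => ?_, ?_⟩
    · simp only [dif_pos ht]
      exact Circular.isNormalizing_liftDiffeomorph (hD t ht) h ht (hμ t ht) (hdμ t ht)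
    · refine Circular.Blowup.contMDiffOn_of_fiberMap h (f := fun t => ⇑(if ht : t ∈ Set.Icc (0 : ℝ) 1
        then Circular.Blowup.liftDiffeomorph h ht else Diffeomorph.refl _ _ _))
        fun t ht v hv ζ => ?_
      simp only [dif_pos ht]
      exact Circular.Blowup.liftDiffeomorph_fiberMap h ht v hv ζ
  refine ⟨fun D hD => ?_, family⟩
  -- A single domain is a constant family, which is smooth because its Minkowski function is.
  obtain ⟨φ, hφ, -⟩ := family (fun _ => D) (fun _ _ => hD) fun q hq =>
    ((hD.contDiffAt_minkowski hq.2).comp q contDiffAt_snd).contDiffWithinAt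
  exact ⟨φ 0, hφ 0 (Set.left_mem_Icc.2 zero_le_one)⟩
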